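/- Theorem. Let $S$ be a finite semigroup such that the rational semigroup algebra $\mathbb{Q}S$ has an identity element and contains a nonzero nilpotent element. Terminology. A finite-dimensional unital $\mathbb{Q}$-algebra $A$ has the *hyperbolic property* if for every $\mathbb{Z}$-order $\Gamma\subset A$ (a unital subring that is finitely generated as a $\mathbb{Z}$-module and satisfies $\mathbb{Q}\Gamma=A$) the group $\mathbb{Z}^2$ does not embed in the unit group $\mathcal{U}(\Gamma)$. A *Higman group* is a finite group that is either abelian of exponent dividing $4$ or $6$, or a Hamiltonian $2$-group (a nonabelian $2$-group all of whose subgroups are normal). A *principal series* of $S$ is a chain $S=S_1\supset S_2\supset\cdots\supset S_n\supset S_{n+1}=\emptyset$ of ideals of $S$ such that $S_{i+1}$ is a maximal (proper, possibly empty) ideal of $S_i$ for $1\le i\le n$. Its factors are the Rees factors $S_i/S_{i+1}=(S_i\setminus S_{i+1})\cup\{\theta\}$, in which $s\cdot t$ is the product $st$ of $S$ if $st\notin S_{i+1}$, all other products being $\theta$. A factor is said to be isomorphic to a group $G$ if it is isomorphic to $G\cup\{\theta\}$, the group with a zero adjoined. For a $2\times 2$ matrix $P$ with entries in $\{1\}\cup\{\theta\}=\{1,0\}$,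 $\mathcal{M}(\{1\};2,2;P)$ is the Rees matrix semigroup consisting of the $2\times 2$ matrix units $e_{ij}$ and the zero matrix, with multiplication $A\cdot B=APB$. Then $\mathbb{Q}S$ is semisimple and has the hyperbolic property if and only if $S$ has a principal series in which all factors except for exactly one designated factor are isomorphic to Higman groups, and the exceptional factor is isomorphic to some $K$ of one of the following types: 1. one of the groups $S_3$, $D_4$ (the dihedral group of order $8$), $Q_{12}=C_3\rtimes C_4$ with a generator of $C_4$ acting by inversion, or $C_4\rtimes C_4$ with nontrivial action; 2. one of the Rees matrix semigroups $\mathcal{M}\left(\{1\};2,2;\begin{pmatrix}1&0\\0&1\end{pmatrix}\right)$ or $\mathcal{M}\left(\{1\};2,2;\begin{pmatrix}1&1\\0&1\end{pmatrix}\right)$. In particular, if $S$ has such a principal series in which the exceptional factor is isomorphic to a group $K$ of type 1, then $S$ is the disjoint union of subsemigroups, one of which is isomorphic to $K$ while each of the others is isomorphic to a Higman group. -/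

import Mathlib

universe u v

/-! ### Ideals, Rees factors and principal series of a semigroup -/

/-- `I` is a (possibly empty) two-sided ideal of the semigroup `T`. -/
def IsSemigroupIdeal {T : Type u} [Semigroup T] (I : Set T) : Prop :=
  ∀ t : T, ∀ a ∈ I, t * a ∈ I ∧ a * t ∈ I

/-- `I` is maximal among the proper two-sided ideals of the semigroup `T`. Since the empty set
counts as an ideal, `∅` is a maximal ideal of `T` if and only if `T` is a (nonempty) simple
semigroup. -/
def IsMaximalSemigroupIdeal {T : Type u} [Semigroup T] (I : Set T) : Prop :=
  IsSemigroupIdeal I ∧ I ≠ Set.univ ∧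
    ∀ J : Set T, IsSemigroupIdeal J → I ⊆ J → J = I ∨ J = Set.univ

/-- The underlying set `(T \ I) ∪ {θ}` of the Rees factor `T / I`; here `zero` is `θ`. For `I = ∅`
this is `T` with a new zero adjoined. -/
inductive ReesFactor (T : Type u) (I : Set T) : Type u
  | zero : ReesFactor T I
  | of (t : T) (ht : t ∉ I) : ReesFactor T I

open Classical in
/-- Multiplication of the Rees factor: `s · t` is the product `s * t` of `T` if that lies outside
`I`, and is `θ` otherwise. -/
noncomputable instance ReesFactor.instMul (T : Type u) [Semigroup T] (I : Set T) :
    Mul (ReesFactor T I) where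
  mul
    | .of s _, .of t _ => if h : s * t ∈ I then .zero else .of (s * t) h
    | _, _ => .zero

/-- A principal series `S = S₁ ⊃ S₂ ⊃ ⋯ ⊃ Sₙ ⊃ Sₙ₊₁ = ∅` of the semigroup `S`: every `Sᵢ` is an
ideal of `S`, and `Sᵢ₊₁` is a maximal ideal of `Sᵢ`. (Indices are shifted to start at `0`.) -/
structure PrincipalSeries (S : Type u) [Semigroup S] where
  /-- the number of factors -/
  length : ℕ
  /-- the terms of the series -/
  term : Fin (length + 1) → Subsemigroup S
  term_zero : term 0 = ⊤
  term_last : term (Fin.last length) = ⊥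
  isIdeal : ∀ i, IsSemigroupIdeal (term i : Set S)
  le : ∀ i : Fin length, term i.succ ≤ term i.castSucc
  isMaximal : ∀ i : Fin length,
    IsMaximalSemigroupIdeal {t : term i.castSucc | (t : S) ∈ term i.succ}

/-- The factor `Sᵢ / Sᵢ₊₁` of a principal series. -/
abbrev PrincipalSeries.Factor {S : Type u} [Semigroup S] (P : PrincipalSeries S)
    (i : Fin P.length) : Type u :=
  ReesFactor (P.term i.castSucc) {t : P.term i.castSucc | (t : S) ∈ P.term i.succ}

/-! ### Rees matrix semigroups -/

/-- The `I × Λ` Rees matrices over `G ∪ {θ}`: `entry i g l` is the matrix `(g)_{i l}` whose only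
nonzero entry is `g`, in row `i` and column `l`, and `zero` is the null matrix. The sandwich matrix
`P` is a parameter because multiplication depends on it. -/
inductive ReesMatrix {G : Type u} {I Λ : Type v} (P : Matrix Λ I (WithZero G)) : Type (max u v)
  | zero : ReesMatrix P
  | entry (i : I) (g : G) (l : Λ) : ReesMatrix P

open Classical in
/-- The product `A ∘ P ∘ B` of Rees matrices: `(a)_{i l} (b)_{j k} = (a p_{l j} b)_{i k}`, the null
matrix if `p_{l j} = θ`. -/
noncomputable instance ReesMatrix.instMul {G : Type u} [Group G] {I Λ : Type v}
    (P : Matrix Λ I (WithZero G)) : Mul (ReesMatrix P) where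
  mul
    | .entry i a l, .entry j b k =>
        if h : P l j = 0 then .zero else .entry i (a * WithZero.unzero h * b) k
    | _, _ => .zero

/-! ### The groups that occur -/

/-- A Higman group: a finite group that is either abelian of exponent dividing `4` or `6`, or a
Hamiltonian `2`-group (a nonabelian `2`-group all of whose subgroups are normal). -/
def IsHigmanGroup (G : Type u) [Group G] : Prop :=
  Finite G ∧
    (((∀ a b : G, a * b = b * a) ∧ (Monoid.exponent G ∣ 4 ∨ Monoid.exponent G ∣ 6)) ∨
      (IsPGroup 2 G ∧ (¬ ∀ a b : G, a * b = b * a) ∧ ∀ H : Subgroup G, H.Normal))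

/-- The cyclic group `Cₙ`, written multiplicatively. -/
abbrev CyclicGroup (n : ℕ) : Type := Multiplicative (ZMod n)

/-- `K` is isomorphic to one of the groups `S₃`, `D₄` (the dihedral group of order `8`),
`Q₁₂ = C₃ ⋊ C₄` with (a generator of) `C₄` acting by inversion, or `C₄ ⋊ C₄` with a nontrivial
action. -/
def IsExceptionalGroup (K : Type u) [Group K] : Prop :=
  Nonempty (K ≃* Equiv.Perm (Fin 3)) ∨
  Nonempty (K ≃* DihedralGroup 4) ∨
  (∃ φ : CyclicGroup 4 →* MulAut (CyclicGroup 3),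
    (∀ c, φ (Multiplicative.ofAdd 1) c = c⁻¹) ∧
      Nonempty (K ≃* CyclicGroup 3 ⋊[φ] CyclicGroup 4)) ∨
  (∃ φ : CyclicGroup 4 →* MulAut (CyclicGroup 4),
    φ ≠ 1 ∧ Nonempty (K ≃* CyclicGroup 4 ⋊[φ] CyclicGroup 4))

/-! ### Types of factors

A factor of a principal series is said to be isomorphic to a group `G` if it is isomorphic to `G`
with a zero adjoined. -/

/-- `F` is isomorphic to a Higman group with a zero adjoined. -/
def IsHigmanFactor (F : Type u) [Mul F] : Prop :=
  ∃ (G : Type u) (_ : Group G), IsHigmanGroup G ∧ Nonempty (F ≃* WithZero G)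

/-- `F` is isomorphic to one of the four exceptional groups with a zero adjoined, or to one of the
Rees matrix semigroups over the trivial group with sandwich matrix `[1, 0; 0, 1]` or
`[1, 1; 0, 1]`. -/
def IsExceptionalFactor (F : Type u) [Mul F] : Prop :=
  (∃ (K : Type u) (_ : Group K), IsExceptionalGroup K ∧ Nonempty (F ≃* WithZero K)) ∨
  Nonempty (F ≃* ReesMatrix (!![1, 0; 0, 1] : Matrix (Fin 2) (Fin 2) (WithZero Unit))) ∨
  Nonempty (F ≃* ReesMatrix (!![1, 1; 0, 1] : Matrix (Fin 2) (Fin 2) (WithZero Unit)))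

/-- `S` is the disjoint union of subsemigroups, one of which is isomorphic to the group `K` while
all the others are isomorphic to Higman groups. -/
def IsDisjointUnionOfHigmanGroupsAnd (S : Type u) [Semigroup S] (K : Type u) [Group K] : Prop :=
  ∃ (ι : Type) (T : ι → Subsemigroup S) (i₀ : ι),
    (∀ i j, i ≠ j → Disjoint (T i : Set S) (T j : Set S)) ∧
    (∀ s : S, ∃ i, s ∈ T i) ∧
    Nonempty (T i₀ ≃* K) ∧
    ∀ i, i ≠ i₀ → ∃ (G : Type u) (_ : Group G), IsHigmanGroup G ∧ Nonempty (T i ≃* G)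

/-! ### The rational semigroup algebra -/

/-- `ℚS` is a unitary algebra: it has a two-sided identity. (`S` itself need not have one.) -/
def IsUnitarySemigroupAlgebra (S : Type u) [Semigroup S] : Prop :=
  ∃ e : MonoidAlgebra ℚ S, ∀ x : MonoidAlgebra ℚ S, e * x = x ∧ x * e = x

/-- The semigroup algebra `ℚS`, for a semigroup `S` such that `ℚS` is unitary. Its addition,
multiplication and scalar multiplication are those of `MonoidAlgebra ℚ S`. -/
def RatSemigroupAlgebra (S : Type u) [Semigroup S] (_h : IsUnitarySemigroupAlgebra S) : Type u :=
  MonoidAlgebra ℚ S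

/-- `ℚS` as a ring; its `1` is the two-sided identity that exists by assumption. -/
noncomputable instance RatSemigroupAlgebra.instRing (S : Type u) [Semigroup S]
    (h : IsUnitarySemigroupAlgebra S) : Ring (RatSemigroupAlgebra S h) :=
  { (inferInstance : NonUnitalRing (MonoidAlgebra ℚ S)) with
    one := h.choose
    one_mul := fun x => (h.choose_spec x).1
    mul_one := fun x => (h.choose_spec x).2 }

/-- `ℚS` as a `ℚ`-vector space. -/
noncomputable instance RatSemigroupAlgebra.instModule (S : Type u) [Semigroup S]
    (h : IsUnitarySemigroupAlgebra S) : Module ℚ (RatSemigroupAlgebra S h) :=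
  (inferInstance : Module ℚ (MonoidAlgebra ℚ S))

/-- `ℚS` as a `ℚ`-algebra. -/
noncomputable instance RatSemigroupAlgebra.instAlgebra (S : Type u) [Semigroup S]
    (h : IsUnitarySemigroupAlgebra S) : Algebra ℚ (RatSemigroupAlgebra S h) :=
  Algebra.ofModule
    (fun r x y => smul_mul_assoc (α := ℚ) (β := MonoidAlgebra ℚ S) r x y)
    (fun r x y => mul_smul_comm (α := ℚ) (β := MonoidAlgebra ℚ S) r x y)

/-! ### The hyperbolic property -/

/-- A `ℤ`-order of the `ℚ`-algebra `A`: a unitary subring that is finitely generated as a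
`ℤ`-module and spans `A` over `ℚ`. -/
def IsZOrder {A : Type u} [Ring A] [Algebra ℚ A] (Γ : Subring A) : Prop :=
  Module.Finite ℤ Γ ∧ Submodule.span ℚ (Γ : Set A) = ⊤

/-- The hyperbolic property of a (finite-dimensional) `ℚ`-algebra `A`: for every `ℤ`-order `Γ` of
`A`, the group `ℤ²` does not embed in the unit group of `Γ`. -/
def HasHyperbolicProperty (A : Type u) [Ring A] [Algebra ℚ A] : Prop :=
  ∀ Γ : Subring A, IsZOrder Γ →
    ¬ ∃ f : Multiplicative (ℤ × ℤ) →* Γˣ, Function.Injective f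

/-! ### Integral units -/

/-! The hyperbolic property is first freed from the choice of an order. Units of an order are
integral together with their inverses; conversely, if `u` is such a unit, a pigeonhole argument
modulo a common denominator puts some power of `u` into any given order. So for an algebra that has
an order the property amounts to `HasRankOneUnits`: two commuting integral units are always
multiplicatively dependent. This condition passes to corners and can be checked in products. It has
two consequences that drive everything. If all products among x and y vanish, then 1 + x and 1 + y
commute, so x and y are linearly dependent. If x ≠ 0 and x² = 0, the integral units living on the
part of the algebra orthogonal to x are torsion.

Suppose ℚS is semisimple with rank one units. Every ideal of S spans an ideal of ℚS with a central
identity, so a principal series exists and cuts ℚS into orthogonal blocks, each having the nonzero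
elements of one Rees factor as a basis. A nilpotent element has a nonzero component in one block,
the exceptional one. `IsFactorBasis.classification` shows that a factor is a group with zero or one
of the two Rees matrix semigroups: for an idempotent e, the elements r - er with re = r multiply to
zero, so at most one of them is nonzero, and likewise on the other side. Rees blocks contain
nilpotents, so outside the exceptional block only groups occur, with torsion integral units.

For groups, the elements (1 - g)xĝ of square zero (ĝ being the sum of the powers of g) detect cyclic
subgroups that are not normal, and cyclotomic units of infinite order restrict the orders of
elements to 1, 2, 3, 4, 6. Torsion units force all subgroups to be normal and the group to be Higman
(`isHigmanGroup_of_isReduced`). Rank one units together with nilpotents force a nonnormal cyclic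
subgroup of order 2 or 4 and index 3 or 4, and the four possibilities are the four exceptional
groups (`isExceptionalGroup_of_hasRankOneUnits`).

Conversely, a series of the stated form makes ℚS a product of the algebras of its factors
(`nonempty_ringEquiv_pi_of_isBlockModel`). Higman groups have torsion integral units by the
classical argument with the involution g ↦ g⁻¹. In 2 × 2 rational matrices commuting units lie in a
quadratic algebra, and rank one is a statement on Pell equations. The algebras of the exceptional
groups embed into one such matrix algebra times definite quaternion algebras, whose integral units
are torsion. A product of one rank one algebra and torsion ones has rank one. -/

/-- A unit `u` of a ring such that `u` and `u⁻¹` are both integral over `ℤ`. -/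
def IsIntegralUnit {A : Type*} [Ring A] (u : Aˣ) : Prop :=
  IsIntegral ℤ (u : A) ∧ IsIntegral ℤ ((u⁻¹ : Aˣ) : A)

/-- Any two commuting integral units of `A` satisfy a nontrivial multiplicative relation. -/
def HasRankOneUnits (A : Type*) [Ring A] : Prop :=
  ∀ u v : Aˣ, Commute u v → IsIntegralUnit u → IsIntegralUnit v →
    ∃ m n : ℤ, (m ≠ 0 ∨ n ≠ 0) ∧ u ^ m * v ^ n = 1

/-- Every integral unit of `A` has finite order. -/
def HasTorsionUnits (A : Type*) [Ring A] : Prop :=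
  ∀ u : Aˣ, IsIntegralUnit u → ∃ k : ℕ, 0 < k ∧ u ^ k = 1

section

variable {A B : Type*} [Ring A] [Ring B]

lemma IsIntegralUnit.map (f : A →+* B) {u : Aˣ} (h : IsIntegralUnit u) :
    IsIntegralUnit (Units.map (f : A →* B) u) := by
  have hf : ∀ x : A, IsIntegral ℤ x → IsIntegral ℤ (f x) := fun x hx =>
    hx.map f.toIntAlgHom
  exact ⟨hf _ h.1, by rw [← map_inv]; exact hf _ h.2⟩

/-- The ring need not be commutative, so the argument takes place in ℤ[x], a finite ℤ-module. -/
lemma IsIntegral.pow_of_ring {x : A} (h : IsIntegral ℤ x) (n : ℕ) : IsIntegral ℤ (x ^ n) := by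
  have hx : x ∈ Algebra.adjoin ℤ {x} := Algebra.self_mem_adjoin_singleton ℤ x
  have hfin : Module.Finite ℤ (Algebra.adjoin ℤ {x}) :=
    Module.Finite.iff_fg.mpr h.fg_adjoin_singleton
  have := IsIntegral.of_finite ℤ (⟨x, hx⟩ ^ n : Algebra.adjoin ℤ {x})
  simpa using this.map (Algebra.adjoin ℤ {x}).val

lemma IsIntegralUnit.pow {u : Aˣ} (h : IsIntegralUnit u) (n : ℕ) : IsIntegralUnit (u ^ n) :=
  ⟨by simpa using h.1.pow_of_ring n, by
    rw [← inv_pow]; simpa using h.2.pow_of_ring n⟩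

lemma isIntegral_of_mem_subring {Γ : Subring A} [Module.Finite ℤ Γ] {x : A} (hx : x ∈ Γ) :
    IsIntegral ℤ x := by
  have := IsIntegral.of_finite ℤ (⟨x, hx⟩ : Γ)
  exact this.map Γ.subtype.toIntAlgHom

/-- A nonzero multiple of every element of a finitely generated subgroup of the rational span of
`Γ` lies in `Γ`. -/
lemma exists_nsmul_mem_of_mem_span [Algebra ℚ A] (Γ : Subring A) {x : A}
    (hx : x ∈ Submodule.span ℚ (Γ : Set A)) : ∃ m : ℕ, 0 < m ∧ m • x ∈ Γ := by
  induction hx using Submodule.span_induction with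
  | mem x h => exact ⟨1, one_pos, by simpa using h⟩
  | zero => exact ⟨1, one_pos, by simp⟩
  | add x y _ _ hx hy =>
    obtain ⟨m, hm, h1⟩ := hx
    obtain ⟨n, hn, h2⟩ := hy
    refine ⟨m * n, Nat.mul_pos hm hn, ?_⟩
    rw [smul_add]
    refine Γ.add_mem ?_ ?_
    · rw [mul_comm, mul_smul]; exact Γ.nsmul_mem h1 n
    · rw [mul_smul]; exact Γ.nsmul_mem h2 m
  | smul q x _ hx =>
    obtain ⟨m, hm, h1⟩ := hx
    refine ⟨q.den * m, Nat.mul_pos q.den_pos hm, ?_⟩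
    have h2 : (q.den * m) • q • x = q.num • m • x := by
      rw [← Nat.cast_smul_eq_nsmul ℚ, ← Nat.cast_smul_eq_nsmul ℚ m x, ← Int.cast_smul_eq_zsmul ℚ,
        smul_smul, smul_smul]
      congr 1
      push_cast
      rw [mul_right_comm, Rat.den_mul_eq_num]
    rw [h2]
    exact Γ.zsmul_mem h1 _

/-- If all powers of an integral unit lie in the rational span of a subring `Γ`, then some power of
the unit and its inverse lie in `Γ`. -/
lemma IsIntegralUnit.exists_pow_mem [Algebra ℚ A] (Γ : Subring A) {u : Aˣ}
    (hu : IsIntegralUnit u) (hspan : ∀ n : ℕ, ((u ^ n : Aˣ) : A) ∈ Submodule.span ℚ (Γ : Set A)) :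
    ∃ k : ℕ, 0 < k ∧ ((u ^ k : Aˣ) : A) ∈ Γ ∧ (((u ^ k)⁻¹ : Aˣ) : A) ∈ Γ := by
  set Λ := Algebra.adjoin ℤ {(u : A)} with hΛ
  have huΛ : (u : A) ∈ Λ := Algebra.self_mem_adjoin_singleton ℤ _
  have hfg : (Subalgebra.toSubmodule Λ).FG := hu.1.fg_adjoin_singleton
  -- the inverse of `u` is a polynomial in `u`
  have hinv : ((u⁻¹ : Aˣ) : A) ∈ Λ := by
    obtain ⟨p, hp, hpe⟩ := hu.2
    rw [← Polynomial.aeval_def] at hpe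
    -- Multiplying by u ^ n clears the inverses in a polynomial of degree at most n in u⁻¹. A monic
    -- equation of degree d + 1 for u⁻¹, multiplied by u ^ d, then expresses u⁻¹ through u.
    have key : ∀ n : ℕ, ∀ q : Polynomial ℤ, q.natDegree ≤ n →
        (u : A) ^ n * Polynomial.aeval ((u⁻¹ : Aˣ) : A) q ∈ Λ := by
      intro n q hq
      rw [Polynomial.aeval_eq_sum_range' (Nat.lt_succ_of_le hq), Finset.mul_sum]
      refine Λ.sum_mem fun i hi => ?_
      rw [mul_smul_comm]
      refine Λ.smul_mem ?_ _
      have hi' : i ≤ n := Nat.lt_succ_iff.mp (Finset.mem_range.mp hi)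
      have : (u : A) ^ n * ((u⁻¹ : Aˣ) : A) ^ i = (u : A) ^ (n - i) := by
        rw [← Units.val_pow_eq_pow_val, ← Units.val_pow_eq_pow_val, ← Units.val_mul,
          ← Units.val_pow_eq_pow_val, inv_pow, pow_sub u hi']
      rw [this]
      exact Λ.pow_mem huΛ _
    rcases Nat.eq_zero_or_pos p.natDegree with h0 | hpos
    · have : p = 1 := by
        rw [Polynomial.eq_C_of_natDegree_eq_zero h0]
        have := hp.coeff_natDegree
        rw [h0] at this
        simp [this]
      rw [this] at hpe
      have hA : (1 : A) = 0 := by simpa using hpe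
      have : ((u⁻¹ : Aˣ) : A) = 0 := by rw [← mul_one ((u⁻¹ : Aˣ) : A), hA, mul_zero]
      rw [this]; exact Λ.zero_mem
    · obtain ⟨d, hd⟩ : ∃ d, p.natDegree = d + 1 := ⟨p.natDegree - 1, by omega⟩
      have hsum : p = Polynomial.X ^ (d + 1) + p.eraseLead := by
        have := p.eraseLead_add_monomial_natDegree_leadingCoeff
        rw [hp.leadingCoeff, hd, Polynomial.monomial_one_right_eq_X_pow] at this
        rw [add_comm]; exact this.symm
      have hq : p.eraseLead.natDegree ≤ d := by
        have := p.eraseLead_natDegree_le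
        omega
      rw [hsum, map_add, map_pow, Polynomial.aeval_X] at hpe
      have h1 : (u : A) ^ d * ((u⁻¹ : Aˣ) : A) ^ (d + 1) = ((u⁻¹ : Aˣ) : A) := by
        rw [pow_succ, ← mul_assoc, ← Units.val_pow_eq_pow_val, ← Units.val_pow_eq_pow_val,
          ← Units.val_mul, inv_pow, mul_inv_cancel, Units.val_one, one_mul]
      have h2 := key d _ hq
      have h3 : ((u⁻¹ : Aˣ) : A) =
          -((u : A) ^ d * Polynomial.aeval ((u⁻¹ : Aˣ) : A) p.eraseLead) := by
        rw [eq_neg_iff_add_eq_zero]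
        nth_rewrite 1 [← h1]
        rw [← mul_add, hpe, mul_zero]
      rw [h3]
      exact Λ.neg_mem h2
  -- a common denominator
  have hΛspan : ∀ x ∈ Λ, x ∈ Submodule.span ℚ (Γ : Set A) := by
    intro x hx
    have : Λ = (Polynomial.aeval (R := ℤ) (u : A)).range :=
      Algebra.adjoin_singleton_eq_range_aeval ℤ _
    rw [this] at hx
    obtain ⟨q, rfl⟩ := hx
    simp only [AlgHom.toRingHom_eq_coe, RingHom.coe_coe]
    rw [Polynomial.aeval_eq_sum_range]
    refine Submodule.sum_mem _ fun i _ => ?_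
    rw [← Int.cast_smul_eq_zsmul ℚ]
    refine Submodule.smul_mem _ _ ?_
    simpa using hspan i
  obtain ⟨s, hs⟩ := hfg
  have hsΛ : ∀ x ∈ s, x ∈ Λ := fun x hx => by
    have : x ∈ Subalgebra.toSubmodule Λ := hs ▸ Submodule.subset_span hx
    exact this
  have hm : ∃ m : ℕ, 0 < m ∧ ∀ x ∈ s, m • x ∈ Γ := by
    choose! f hf using fun x (hx : x ∈ s) =>
      exists_nsmul_mem_of_mem_span Γ (hΛspan x (hsΛ x hx))
    refine ⟨∏ x ∈ s, f x, Finset.prod_pos fun x hx => (hf x hx).1, fun x hx => ?_⟩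
    obtain ⟨c, hc⟩ := Finset.dvd_prod_of_mem f hx
    rw [hc, mul_comm, mul_smul]
    exact Γ.nsmul_mem (hf x hx).2 c
  obtain ⟨m, hm0, hm⟩ := hm
  have hmΛ : ∀ x ∈ Λ, m • x ∈ Γ := by
    intro x hx
    have hx' : x ∈ Submodule.span ℤ (s : Set A) := by rw [hs]; exact hx
    clear hx
    induction hx' using Submodule.span_induction with
    | mem x h => exact hm x h
    | zero => simp
    | add x y h1 h2 hx hy =>
      rw [smul_add]
      exact Γ.add_mem hx hy
    | smul q x h1 hx =>
      rw [smul_comm]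
      exact Γ.zsmul_mem hx _
  -- pigeonhole on coordinates modulo `m`
  have hcoord : ∀ n : ℕ, ∃ c : s → ℤ, (u : A) ^ n = ∑ x, c x • (x : A) := by
    intro n
    have : (u : A) ^ n ∈ Submodule.span ℤ (s : Set A) := by
      rw [hs]; exact Λ.pow_mem huΛ n
    obtain ⟨c, hc⟩ := (Submodule.mem_span_finset').mp this
    exact ⟨c, hc.symm⟩
  choose c hc using hcoord
  have : NeZero m := ⟨hm0.ne'⟩
  obtain ⟨i, j, hij, hcij⟩ := Finite.exists_ne_map_eq_of_infinite
    (fun n : ℕ => fun x : s => (c n x : ZMod m))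
  wlog hlt : i < j generalizing i j
  · exact this j i hij.symm hcij.symm (lt_of_le_of_ne (not_lt.mp hlt) hij.symm)
  -- From u ^ j - u ^ i = m y one gets u ^ (j - i) = 1 + m u ^ (-i) y, and m Λ ⊆ Γ. The inverse is
  -- treated in the same way with u ^ (-j).
  have hdiv : ∃ y ∈ Λ, (u : A) ^ j - (u : A) ^ i = m • y := by
    have hd : ∀ x : s, ∃ d : ℤ, c j x - c i x = m * d := fun x => by
      have := congr_fun hcij x
      obtain ⟨d, hd⟩ := (ZMod.intCast_eq_intCast_iff_dvd_sub _ _ _).mp this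
      exact ⟨d, hd⟩
    choose d hd using hd
    refine ⟨∑ x, d x • (x : A), Λ.sum_mem fun x _ => Λ.zsmul_mem (hsΛ x x.2) _, ?_⟩
    rw [hc, hc, ← Finset.sum_sub_distrib, Finset.smul_sum]
    refine Finset.sum_congr rfl fun x _ => ?_
    rw [← sub_smul, hd, mul_smul, natCast_zsmul]
  obtain ⟨y, hy, hyeq⟩ := hdiv
  have hpowinv : ∀ n : ℕ, ((u⁻¹ : Aˣ) : A) ^ n ∈ Λ := fun n => Λ.pow_mem hinv n
  have e1 : ((u⁻¹ : Aˣ) : A) ^ i * (u : A) ^ i = 1 := by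
    rw [← Units.val_pow_eq_pow_val, ← Units.val_pow_eq_pow_val, ← Units.val_mul]; simp
  have e2 : ((u⁻¹ : Aˣ) : A) ^ j * (u : A) ^ j = 1 := by
    rw [← Units.val_pow_eq_pow_val, ← Units.val_pow_eq_pow_val, ← Units.val_mul]; simp
  have e3 : ((u⁻¹ : Aˣ) : A) ^ i * (u : A) ^ j = ((u ^ (j - i) : Aˣ) : A) := by
    rw [← Units.val_pow_eq_pow_val, ← Units.val_pow_eq_pow_val, ← Units.val_mul, pow_sub u hlt.le,
      inv_pow]
    congr 1
    exact ((Commute.refl u).pow_pow _ _).inv_left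
  have e4 : ((u⁻¹ : Aˣ) : A) ^ j * (u : A) ^ i = (((u ^ (j - i))⁻¹ : Aˣ) : A) := by
    rw [← Units.val_pow_eq_pow_val, ← Units.val_pow_eq_pow_val, ← Units.val_mul, pow_sub u hlt.le,
      inv_pow, mul_inv_rev, inv_inv]
    congr 1
    exact ((Commute.refl u).pow_pow _ _).inv_left
  refine ⟨j - i, by omega, ?_, ?_⟩
  · have : ((u ^ (j - i) : Aˣ) : A) = 1 + m • (((u⁻¹ : Aˣ) : A) ^ i * y) := by
      rw [← mul_smul_comm, ← hyeq, mul_sub, e1, e3]; abel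
    rw [this]
    exact Γ.add_mem Γ.one_mem (hmΛ _ (Λ.mul_mem (hpowinv i) hy))
  · have : (((u ^ (j - i))⁻¹ : Aˣ) : A) = 1 - m • (((u⁻¹ : Aˣ) : A) ^ j * y) := by
      rw [← mul_smul_comm, ← hyeq, mul_sub, e2, e4]; abel
    rw [this]
    exact Γ.sub_mem Γ.one_mem (hmΛ _ (Λ.mul_mem (hpowinv j) hy))

/-- An algebra with rank one units has the hyperbolic property. -/
theorem HasRankOneUnits.hasHyperbolicProperty [Algebra ℚ A] (h : HasRankOneUnits A) :
    HasHyperbolicProperty A := by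
  rintro Γ ⟨hfin, -⟩ ⟨f, hf⟩
  have hint : ∀ w : Γˣ, IsIntegralUnit (Units.map (Γ.subtype : Γ →* A) w) := fun w =>
    ⟨isIntegral_of_mem_subring (Γ := Γ) w.1.2, by
      rw [← map_inv]; exact isIntegral_of_mem_subring (Γ := Γ) (w⁻¹).1.2⟩
  let a : Multiplicative (ℤ × ℤ) := Multiplicative.ofAdd (1, 0)
  let b : Multiplicative (ℤ × ℤ) := Multiplicative.ofAdd (0, 1)
  have hcomm : Commute (f a) (f b) := by
    rw [Commute, SemiconjBy, ← map_mul f, ← map_mul f, mul_comm a b]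
  obtain ⟨m, n, hmn, hrel⟩ := h _ _ (hcomm.map (Units.map (Γ.subtype : Γ →* A))) (hint (f a))
    (hint (f b))
  have hinj : Function.Injective (Units.map (Γ.subtype : Γ →* A)) :=
    Units.map_injective Subtype.val_injective
  rw [← map_zpow (Units.map (Γ.subtype : Γ →* A)), ← map_zpow (Units.map (Γ.subtype : Γ →* A)),
    ← map_mul] at hrel
  have h1 := hinj (hrel.trans (map_one _).symm)
  rw [← map_zpow f, ← map_zpow f, ← map_mul] at h1
  have h2 := hf (h1.trans (map_one f).symm)
  have h3 := congrArg Multiplicative.toAdd h2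
  simp [a, b] at h3
  rcases hmn with h | h
  · exact h h3.1
  · exact h h3.2

/-- An algebra with the hyperbolic property that contains an order has rank one units. -/
theorem HasHyperbolicProperty.hasRankOneUnits [Algebra ℚ A] (h : HasHyperbolicProperty A)
    {Γ : Subring A} (hΓ : IsZOrder Γ) : HasRankOneUnits A := by
  intro u v huv hu hv
  by_contra! hcon
  have hspan : ∀ x : A, x ∈ Submodule.span ℚ (Γ : Set A) := fun x => by rw [hΓ.2]; trivial
  obtain ⟨k, hk, hk1, hk2⟩ := hu.exists_pow_mem Γ fun n => hspan _
  obtain ⟨l, hl, hl1, hl2⟩ := hv.exists_pow_mem Γ fun n => hspan _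
  let U : Γˣ := ⟨⟨_, hk1⟩, ⟨_, hk2⟩, Subtype.ext (u ^ k).mul_inv, Subtype.ext (u ^ k).inv_mul⟩
  let V : Γˣ := ⟨⟨_, hl1⟩, ⟨_, hl2⟩, Subtype.ext (v ^ l).mul_inv, Subtype.ext (v ^ l).inv_mul⟩
  have hinj : Function.Injective (Units.map (Γ.subtype : Γ →* A)) :=
    Units.map_injective Subtype.val_injective
  have hU : Units.map (Γ.subtype : Γ →* A) U = u ^ k := Units.ext rfl
  have hV : Units.map (Γ.subtype : Γ →* A) V = v ^ l := Units.ext rfl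
  have hUV : Commute U V := by
    apply hinj
    rw [map_mul, map_mul, hU, hV]
    exact (huv.pow_pow k l)
  refine h Γ hΓ ⟨⟨⟨fun p => U ^ (Multiplicative.toAdd p).1 * V ^ (Multiplicative.toAdd p).2,
    by simp⟩, fun p q => ?_⟩, ?_⟩
  · simp only [toAdd_mul, Prod.fst_add, Prod.snd_add, zpow_add]
    have := (hUV.zpow_zpow (Multiplicative.toAdd q).1 (Multiplicative.toAdd p).2).eq
    simp only [mul_assoc]
    congr 1
    rw [← mul_assoc, this, mul_assoc]
  · rw [injective_iff_map_eq_one]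
    intro p hp
    have hp' := congrArg (Units.map (Γ.subtype : Γ →* A)) hp
    simp only [MonoidHom.coe_mk, OneHom.coe_mk, map_mul, map_zpow, hU, hV, map_one] at hp'
    rw [← zpow_natCast, ← zpow_natCast, ← zpow_mul, ← zpow_mul] at hp'
    -- An element of the kernel is a relation between u and v with exponents k p₁ and l p₂. These
    -- vanish, and k, l are positive.
    have := mt (hcon _ _) (not_not.mpr hp')
    push Not at this
    obtain ⟨h1, h2⟩ := this
    have e1 : (Multiplicative.toAdd p).1 = 0 := by
      rcases mul_eq_zero.mp h1 with h | h
      · omega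
      · exact h
    have e2 : (Multiplicative.toAdd p).2 = 0 := by
      rcases mul_eq_zero.mp h2 with h | h
      · omega
      · exact h
    exact Multiplicative.toAdd.injective (Prod.ext e1 e2)

lemma isIntegral_one_add_of_sq_eq_zero {x : A} (hx : x * x = 0) : IsIntegral ℤ (1 + x) := by
  refine ⟨(Polynomial.X - 1) ^ 2, (Polynomial.monic_X_sub_C 1).pow 2, ?_⟩
  rw [← Polynomial.aeval_def]
  simp [pow_two, hx]

/-- The unit `1 + x` for an element `x` of square zero. -/
def oneAddUnit (x : A) (hx : x * x = 0) : Aˣ :=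
  ⟨1 + x, 1 - x, by simp [mul_sub, add_mul, hx], by simp [mul_add, sub_mul, hx]⟩

lemma isIntegralUnit_oneAddUnit {x : A} (hx : x * x = 0) : IsIntegralUnit (oneAddUnit x hx) :=
  ⟨isIntegral_one_add_of_sq_eq_zero hx, by
    have := isIntegral_one_add_of_sq_eq_zero (x := -x) (by simpa using hx)
    simpa [oneAddUnit, ← sub_eq_add_neg] using this⟩

lemma oneAddUnit_zpow {x : A} (hx : x * x = 0) (n : ℤ) :
    ((oneAddUnit x hx ^ n : Aˣ) : A) = 1 + n • x := by
  have hnat : ∀ (x : A) (hx : x * x = 0) (n : ℕ),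
      ((oneAddUnit x hx ^ n : Aˣ) : A) = 1 + n • x := by
    intro x hx n
    induction n with
    | zero => simp
    | succ n ih =>
      rw [pow_succ, Units.val_mul, ih]
      simp only [oneAddUnit, mul_add, add_mul, one_mul, mul_one, smul_mul_assoc, hx, succ_nsmul]
      simp [add_assoc]
  have hinv : (oneAddUnit x hx)⁻¹ = oneAddUnit (-x) (by simpa using hx) := by
    ext; simp [oneAddUnit, sub_eq_add_neg]
  obtain ⟨k, rfl | rfl⟩ := n.eq_nat_or_neg
  · simpa using hnat x hx k
  · rw [zpow_neg, ← inv_zpow, hinv, zpow_natCast, hnat]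
    simp

/-- In an algebra with rank one units, two elements spanning a subspace with zero multiplication
are linearly dependent. -/
lemma HasRankOneUnits.exists_smul_add_smul_eq_zero (h : HasRankOneUnits A) {x y : A}
    (hx : x * x = 0) (hy : y * y = 0) (hxy : x * y = 0) (hyx : y * x = 0) :
    ∃ m n : ℤ, (m ≠ 0 ∨ n ≠ 0) ∧ m • x + n • y = 0 := by
  obtain ⟨m, n, hmn, hrel⟩ := h (oneAddUnit x hx) (oneAddUnit y hy)
    (by ext; simp [oneAddUnit, mul_add, add_mul, hxy, hyx]; abel)
    (isIntegralUnit_oneAddUnit hx) (isIntegralUnit_oneAddUnit hy)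
  refine ⟨m, n, hmn, ?_⟩
  have := congrArg (Units.val) hrel
  -- All products vanish, so (1 + m x)(1 + n y) = 1 reads m x + n y = 0.
  rw [Units.val_mul, oneAddUnit_zpow, oneAddUnit_zpow] at this
  simp only [mul_add, add_mul, mul_one, one_mul, smul_mul_smul_comm, hxy, smul_zero, add_zero,
    Units.val_one, add_assoc] at this
  simpa using this

/-- An integral unit acting trivially on the part of the algebra that contains a given nonzero
element of square zero has finite order. -/
lemma HasRankOneUnits.exists_pow_eq_one [IsAddTorsionFree A] (h : HasRankOneUnits A) {x e : A}
    (hx : x * x = 0) (hx0 : x ≠ 0) (hex : e * x = x) (hxe : x * e = x) {u : Aˣ}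
    (hu : IsIntegralUnit u) (hue : (u : A) * e = e) (heu : e * (u : A) = e) :
    ∃ k : ℕ, 0 < k ∧ u ^ k = 1 := by
  have hux : (u : A) * x = x := by rw [← hex, ← mul_assoc, hue]
  have hxu : x * (u : A) = x := by rw [← hxe, mul_assoc, heu]
  obtain ⟨m, n, hmn, hrel⟩ := h u (oneAddUnit x hx)
    (by ext; simp [oneAddUnit, mul_add, add_mul, hux, hxu]) hu (isIntegralUnit_oneAddUnit hx)
  have hu' : e * ((u⁻¹ : Aˣ) : A) = e := by
    nth_rewrite 1 [← heu]; simp [mul_assoc]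
  have heum : e * ((u ^ m : Aˣ) : A) = e := by
    have key : ∀ w : Aˣ, e * (w : A) = e → ∀ k : ℕ, e * ((w ^ k : Aˣ) : A) = e := by
      intro w hw k
      induction k with
      | zero => simp
      | succ k ih => rw [pow_succ, Units.val_mul, ← mul_assoc, ih, hw]
    obtain ⟨k, rfl | rfl⟩ := m.eq_nat_or_neg
    · simpa using key u heu k
    · rw [zpow_neg, ← inv_zpow, zpow_natCast]; exact key _ hu' k
  -- Multiplication by e absorbs u ^ m and leaves e + n x = e, so n = 0 and the relation only
  -- involves u.
  have h1 := congrArg (fun w : Aˣ => e * (w : A)) hrel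
  simp only [Units.val_mul, oneAddUnit_zpow, ← mul_assoc, heum, Units.val_one, mul_one, mul_add,
    mul_smul_comm, hex] at h1
  have h2 : n • x = 0 := by simpa using h1
  have hn : n = 0 := by
    rcases smul_eq_zero.mp h2 with h | h
    · exact h
    · exact absurd h hx0
  have hm : m ≠ 0 := by
    rcases hmn with h | h
    · exact h
    · exact absurd hn h
  rw [hn] at hrel
  simp only [zpow_zero, mul_one] at hrel
  exact ⟨m.natAbs, by omega, by simpa using hrel⟩

/-- Units of `A` have rank one if `A` embeds into the product of an algebra whose units have rank
one and of finitely many algebras whose integral units are torsion. -/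
theorem hasRankOneUnits_of_injective {ι : Type*} [Finite ι] {C : ι → Type*} [∀ i, Ring (C i)]
    (f : A →+* B) (g : ∀ i, A →+* C i) (hB : HasRankOneUnits B)
    (hC : ∀ i, HasTorsionUnits (C i))
    (hinj : ∀ x, f x = 0 → (∀ i, g i x = 0) → x = 0) : HasRankOneUnits A := by
  -- A power trivialises all torsion components at once; a relation then only has to be found in
  -- `B`.
  have hpow : ∀ u : Aˣ, IsIntegralUnit u →
      ∃ k : ℕ, 0 < k ∧ ∀ i, g i ((u ^ k : Aˣ) : A) = 1 := by
    intro u hu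
    have := Fintype.ofFinite ι
    choose k hk hk1 using fun i => hC i _ (hu.map (g i))
    refine ⟨∏ i, k i, Finset.prod_pos fun i _ => hk i, fun i => ?_⟩
    obtain ⟨c, hc⟩ := Finset.dvd_prod_of_mem k (Finset.mem_univ i)
    have h1 := congrArg Units.val (hk1 i)
    simp only [Units.val_pow_eq_pow_val, Units.coe_map, Units.val_one, MonoidHom.coe_coe] at h1
    rw [hc, pow_mul, Units.val_pow_eq_pow_val, Units.val_pow_eq_pow_val, map_pow, map_pow, h1,
      one_pow]
  intro u v huv hu hv
  obtain ⟨k, hk, hk1⟩ := hpow u hu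
  obtain ⟨l, hl, hl1⟩ := hpow v hv
  obtain ⟨m, n, hmn, hrel⟩ := hB _ _ ((huv.pow_pow k l).map (Units.map (f : A →* B)))
    ((hu.pow k).map f) ((hv.pow l).map f)
  refine ⟨k * m, l * n, ?_, ?_⟩
  · rcases hmn with h | h
    · exact Or.inl (mul_ne_zero (by omega) h)
    · exact Or.inr (mul_ne_zero (by omega) h)
  · rw [zpow_mul, zpow_mul, zpow_natCast, zpow_natCast]
    ext
    rw [Units.val_one, ← sub_eq_zero]
    apply hinj
    · rw [← map_zpow, ← map_zpow, ← map_mul] at hrel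
      have := congrArg Units.val hrel
      simp only [Units.coe_map, MonoidHom.coe_coe, Units.val_one] at this
      rw [map_sub, this, map_one, sub_self]
    · intro i
      have h1 : Units.map (g i : A →* C i) (u ^ k) = 1 := Units.ext (hk1 i)
      have h2 : Units.map (g i : A →* C i) (v ^ l) = 1 := Units.ext (hl1 i)
      have h3 : Units.map (g i : A →* C i) ((u ^ k) ^ m * (v ^ l) ^ n) = 1 := by
        rw [map_mul, map_zpow, map_zpow, h1, h2]; simp
      have := congrArg Units.val h3
      simp only [Units.coe_map, MonoidHom.coe_coe, Units.val_one] at this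
      rw [map_sub, this, map_one, sub_self]

theorem hasRankOneUnits_of_injective' {f : A →+* B} (hf : Function.Injective f)
    (hB : HasRankOneUnits B) : HasRankOneUnits A :=
  hasRankOneUnits_of_injective (ι := Empty) (C := fun _ => A) f (fun i => i.elim) hB
    (fun i => i.elim) fun x hx _ => hf (by rw [hx, map_zero])

/-- The unit of `A` extending a unit of a (not necessarily unital) subalgebra by `1` on the
complement of its identity. -/
def extendUnit (ι : B →ₙ+* A) : Bˣ →* Aˣ where
  toFun u := ⟨ι u + (1 - ι 1), ι (u⁻¹ : Bˣ) + (1 - ι 1), by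
      simp only [mul_add, add_mul, mul_sub, sub_mul, mul_one, one_mul, ← map_mul]; simp, by
      simp only [mul_add, add_mul, mul_sub, sub_mul, mul_one, one_mul, ← map_mul]; simp⟩
  map_one' := by ext; simp
  map_mul' u v := by
    ext
    simp only [mul_add, add_mul, mul_sub, sub_mul, mul_one, one_mul, ← map_mul, Units.val_mul]
    simp

lemma extendUnit_val (ι : B →ₙ+* A) (u : Bˣ) :
    (extendUnit ι u : A) = ι u + (1 - ι 1) := rfl

lemma extendUnit_injective {ι : B →ₙ+* A} (hι : Function.Injective ι) :
    Function.Injective (extendUnit ι) := by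
  intro u v h
  have := congrArg Units.val h
  simp only [extendUnit_val, add_left_inj] at this
  exact Units.ext (hι this)

/-- A polynomial acts separately on the two orthogonal parts, by evaluation at b and at 1. So if p
annihilates b, the product p (X - 1) annihilates the extended element. -/
lemma isIntegral_extend (ι : B →ₙ+* A) {b : B} (hb : IsIntegral ℤ b) :
    IsIntegral ℤ (ι b + (1 - ι 1)) := by
  obtain ⟨p, hp, hpe⟩ := hb
  refine ⟨p * (Polynomial.X - 1), hp.mul (Polynomial.monic_X_sub_C 1), ?_⟩
  rw [← Polynomial.aeval_def] at hpe ⊢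
  have hpow : ∀ n : ℕ, (ι b + (1 - ι 1)) ^ n = ι (b ^ n) + (1 - ι 1) := by
    intro n
    induction n with
    | zero => simp
    | succ n ih =>
      rw [pow_succ, ih]
      simp only [mul_add, add_mul, mul_sub, sub_mul, mul_one, one_mul, ← map_mul, pow_succ]
      simp
  have key : ∀ q : Polynomial ℤ, Polynomial.aeval (ι b + (1 - ι 1)) q =
      ι (Polynomial.aeval b q) + q.eval 1 • (1 - ι 1) := by
    intro q
    induction q using Polynomial.induction_on' with
    | add p q hp hq => simp only [map_add, hp, hq, Polynomial.eval_add, add_smul]; abel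
    | monomial n a =>
      rw [Polynomial.aeval_monomial, Polynomial.aeval_monomial, hpow, Polynomial.eval_monomial,
        mul_add, ← Algebra.smul_def, ← Algebra.smul_def, ← Algebra.smul_def, map_zsmul]
      simp
  rw [key, map_mul, hpe]
  simp

lemma IsIntegralUnit.extendUnit (ι : B →ₙ+* A) {u : Bˣ} (hu : IsIntegralUnit u) :
    IsIntegralUnit (extendUnit ι u) :=
  ⟨isIntegral_extend ι hu.1, by rw [← map_inv]; exact isIntegral_extend ι hu.2⟩

/-- The rank one property passes to corner subalgebras. -/
theorem HasRankOneUnits.of_nonUnital (hA : HasRankOneUnits A) {ι : B →ₙ+* A}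
    (hι : Function.Injective ι) : HasRankOneUnits B := by
  intro u v huv hu hv
  obtain ⟨m, n, hmn, hrel⟩ := hA _ _ (huv.map (_root_.extendUnit ι)) (hu.extendUnit ι)
    (hv.extendUnit ι)
  refine ⟨m, n, hmn, extendUnit_injective hι ?_⟩
  rw [map_mul, map_zpow, map_zpow, hrel, map_one]

/-- If there is a nilpotent element orthogonal to a corner, the corner has torsion units. -/
theorem HasRankOneUnits.hasTorsionUnits_of_nonUnital [IsAddTorsionFree A]
    (hA : HasRankOneUnits A) {ι : B →ₙ+* A}
    (hι : Function.Injective ι) {x : A} (hx : x * x = 0) (hx0 : x ≠ 0) (h1 : ι 1 * x = 0)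
    (h2 : x * ι 1 = 0) : HasTorsionUnits B := by
  intro u hu
  have e1 : (_root_.extendUnit ι u : A) * (1 - ι 1) = 1 - ι 1 := by
    simp only [extendUnit_val, add_mul, mul_sub, sub_mul, mul_one, one_mul, ← map_mul]
    simp
  have e2 : (1 - ι 1) * (_root_.extendUnit ι u : A) = 1 - ι 1 := by
    simp only [extendUnit_val, mul_add, mul_sub, sub_mul, mul_one, one_mul, ← map_mul]
    simp
  -- The complementary idempotent 1 - ι 1 fixes x, and the extended unit acts trivially on it.
  obtain ⟨k, hk, hk1⟩ := hA.exists_pow_eq_one hx hx0 (e := 1 - ι 1) (by simp [sub_mul, h1])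
    (by simp [mul_sub, h2]) (hu.extendUnit ι) e1 e2
  exact ⟨k, hk, extendUnit_injective hι (by rw [map_pow, hk1, map_one])⟩

end


/-! ### Integral units of small algebras -/

lemma rat_eq_one_or_neg_one_of_isIntegral {q r : ℚ} (hq : IsIntegral ℤ q) (hr : IsIntegral ℤ r)
    (h : q * r = 1) : q = 1 ∨ q = -1 := by
  obtain ⟨a, rfl⟩ := IsIntegrallyClosed.isIntegral_iff.mp hq
  obtain ⟨b, rfl⟩ := IsIntegrallyClosed.isIntegral_iff.mp hr
  have : a * b = 1 := by
    simp only [algebraMap_int_eq, eq_intCast] at h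
    exact_mod_cast h
  rcases Int.eq_one_or_neg_one_of_mul_eq_one this with h | h <;> simp [h]

/-- Products and sums of commuting integral elements are integral. -/
lemma isIntegral_add_mul_of_commute {A : Type*} [Ring A] {x y : A} (hxy : Commute x y)
    (hx : IsIntegral ℤ x) (hy : IsIntegral ℤ y) :
    IsIntegral ℤ (x + y) ∧ IsIntegral ℤ (x * y) := by
  have hcomm : IsMulCommutative (Algebra.adjoin ℤ ({x, y} : Set A)) :=
    Algebra.isMulCommutative_adjoin ℤ (by
      rintro a (rfl | rfl) b (rfl | rfl)
      exacts [rfl, hxy.eq, hxy.eq.symm, rfl])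
  let x' : Algebra.adjoin ℤ ({x, y} : Set A) := ⟨x, Algebra.subset_adjoin (by simp)⟩
  let y' : Algebra.adjoin ℤ ({x, y} : Set A) := ⟨y, Algebra.subset_adjoin (by simp)⟩
  let inst : CommRing (Algebra.adjoin ℤ ({x, y} : Set A)) :=
    { (inferInstance : Ring (Algebra.adjoin ℤ ({x, y} : Set A))) with
      mul_comm := fun a b => hcomm.is_comm.comm a b }
  have hinj : Function.Injective (Algebra.adjoin ℤ ({x, y} : Set A)).val := Subtype.val_injective
  have hx' : IsIntegral ℤ x' := (isIntegral_algHom_iff _ hinj).mp hx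
  have hy' : IsIntegral ℤ y' := (isIntegral_algHom_iff _ hinj).mp hy
  exact ⟨(hx'.add hy').map (Algebra.adjoin ℤ ({x, y} : Set A)).val, (hx'.mul hy').map (Algebra.adjoin ℤ ({x, y} : Set A)).val⟩

section Quaternion

open Quaternion

lemma isIntegral_star_quaternion {a b c : ℚ} {x : ℍ[ℚ,a,b,c]} (hx : IsIntegral ℤ x) :
    IsIntegral ℤ (star x) := by
  obtain ⟨p, hp, hpe⟩ := hx
  refine ⟨p, hp, ?_⟩
  rw [← Polynomial.aeval_def] at hpe ⊢
  have : Polynomial.aeval (star x) p = star (Polynomial.aeval x p) := by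
    rw [Polynomial.aeval_eq_sum_range, Polynomial.aeval_eq_sum_range, star_sum]
    refine Finset.sum_congr rfl fun i _ => ?_
    rw [← star_pow, ← Int.cast_smul_eq_zsmul ℚ, ← Int.cast_smul_eq_zsmul ℚ,
      QuaternionAlgebra.star_smul]
  rw [this, hpe, star_zero]

lemma quaternion_isIntegral_coe {a b c q : ℚ} (h : IsIntegral ℤ (q : ℍ[ℚ,a,b,c])) :
    IsIntegral ℤ q := by
  refine (isIntegral_algHom_iff (algebraMap ℚ ℍ[ℚ,a,b,c]).toIntAlgHom ?_).mp h
  exact (algebraMap ℚ ℍ[ℚ,a,b,c]).injective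

/-- Integral units of a definite quaternion algebra over `ℚ` have finite order. -/
theorem hasTorsionUnits_quaternion {a b c : ℚ} (hab : b ^ 2 + 4 * a < 0) (hc : c < 0) :
    HasTorsionUnits ℍ[ℚ,a,b,c] := by
  intro u hu
  -- The reduced trace x + x* and the reduced norm x x* are rational and inherit integrality,
  -- because x commutes with its conjugate.
  have htr : ∀ x : ℍ[ℚ,a,b,c], IsIntegral ℤ x → IsIntegral ℤ (2 * x.re + b * x.imI) := by
    intro x hx
    apply quaternion_isIntegral_coe (a := a) (b := b) (c := c)
    rw [← QuaternionAlgebra.self_add_star']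
    exact (isIntegral_add_mul_of_commute
      (star_comm_self' x).symm hx
      (isIntegral_star_quaternion hx)).1
  let N : ℍ[ℚ,a,b,c] → ℚ := fun x => (x * star x).re
  have hNcoe : ∀ x : ℍ[ℚ,a,b,c], x * star x = (N x : ℍ[ℚ,a,b,c]) := fun x =>
    QuaternionAlgebra.mul_star_eq_coe x
  have hNint : ∀ x : ℍ[ℚ,a,b,c], IsIntegral ℤ x → IsIntegral ℤ (N x) := by
    intro x hx
    apply quaternion_isIntegral_coe (a := a) (b := b) (c := c)
    rw [← hNcoe]
    exact (isIntegral_add_mul_of_commute (star_comm_self' x).symm hx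
      (isIntegral_star_quaternion hx)).2
  have hNmul : ∀ x y : ℍ[ℚ,a,b,c], N (x * y) = N x * N y := by
    intro x y
    have : ((N (x * y) : ℚ) : ℍ[ℚ,a,b,c]) = ((N x * N y : ℚ) : ℍ[ℚ,a,b,c]) := by
      rw [← hNcoe, star_mul, QuaternionAlgebra.coe_mul, ← hNcoe x, mul_assoc, ← mul_assoc y,
        hNcoe y, QuaternionAlgebra.comm, ← mul_assoc]
    exact QuaternionAlgebra.coe_injective this
  -- Completing squares exhibits the norm form as positive definite under the two sign hypotheses;
  -- the first square is that of the trace.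
  have hN4 : ∀ x : ℍ[ℚ,a,b,c], 4 * N x = (2 * x.re + b * x.imI) ^ 2 +
      -(b ^ 2 + 4 * a) * x.imI ^ 2 +
      -c * ((2 * x.imJ + b * x.imK) ^ 2 + -(b ^ 2 + 4 * a) * x.imK ^ 2) := by
    intro x
    simp [N]
    ring
  have hquad : ∀ x : ℍ[ℚ,a,b,c],
      x * x = (2 * x.re + b * x.imI) • x - (N x : ℍ[ℚ,a,b,c]) := by
    intro x
    rw [← hNcoe, QuaternionAlgebra.star_eq_two_re_sub, mul_sub, ← QuaternionAlgebra.comm,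
      QuaternionAlgebra.coe_mul_eq_smul]
    abel
  have hmul : N (u : ℍ[ℚ,a,b,c]) * N ((u⁻¹ : ℍ[ℚ,a,b,c]ˣ) : ℍ[ℚ,a,b,c]) = 1 := by
    rw [← hNmul, Units.mul_inv]; simp [N]
  have hD : 0 < -(b ^ 2 + 4 * a) := by linarith
  have hpos : 0 ≤ 4 * N (u : ℍ[ℚ,a,b,c]) := by
    rw [hN4]
    have : 0 ≤ -c := by linarith
    positivity
  have hN1 : N (u : ℍ[ℚ,a,b,c]) = 1 := by
    rcases rat_eq_one_or_neg_one_of_isIntegral (hNint _ hu.1) (hNint _ hu.2) hmul with h | h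
    · exact h
    · rw [h] at hpos; norm_num at hpos
  have h4 := hN4 (u : ℍ[ℚ,a,b,c])
  have hq := hquad (u : ℍ[ℚ,a,b,c])
  obtain ⟨t, ht⟩ := IsIntegrallyClosed.isIntegral_iff.mp (htr _ hu.1)
  simp only [algebraMap_int_eq, eq_intCast] at ht
  rw [hN1] at h4 hq
  rw [← ht] at h4 hq
  rw [Int.cast_smul_eq_zsmul] at hq
  set w : ℍ[ℚ,a,b,c] := (u : ℍ[ℚ,a,b,c]) with hw
  have hrest : 0 ≤ -(b ^ 2 + 4 * a) * w.imI ^ 2 +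
      -c * ((2 * w.imJ + b * w.imK) ^ 2 + -(b ^ 2 + 4 * a) * w.imK ^ 2) := by
    have : 0 ≤ -c := by linarith
    positivity
  have ht2 : t ^ 2 ≤ 4 := by
    have : (t : ℚ) ^ 2 ≤ 4 := by linarith
    exact_mod_cast this
  have hone : ((1 : ℚ) : ℍ[ℚ,a,b,c]) = 1 := QuaternionAlgebra.coe_one
  rw [hone] at hq
  -- the extreme values of the trace
  have hext : t ^ 2 = 4 → w * w = 1 := by
    intro h
    have hc' : 0 < -c := by linarith
    have h0 : -(b ^ 2 + 4 * a) * w.imI ^ 2 +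
        -c * ((2 * w.imJ + b * w.imK) ^ 2 + -(b ^ 2 + 4 * a) * w.imK ^ 2) = 0 := by
      have : (t : ℚ) ^ 2 = 4 := by exact_mod_cast h
      linarith
    have h1 : 0 ≤ -(b ^ 2 + 4 * a) * w.imI ^ 2 := by positivity
    have h2 : 0 ≤ (2 * w.imJ + b * w.imK) ^ 2 := by positivity
    have h3 : 0 ≤ -(b ^ 2 + 4 * a) * w.imK ^ 2 := by positivity
    have h5 : 0 ≤ -c * ((2 * w.imJ + b * w.imK) ^ 2 + -(b ^ 2 + 4 * a) * w.imK ^ 2) := by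
      positivity
    have hI : w.imI = 0 := by
      have : -(b ^ 2 + 4 * a) * w.imI ^ 2 = 0 := by linarith
      simpa [hD.ne'] using (mul_eq_zero.mp this).resolve_left hD.ne'
    have h6 : (2 * w.imJ + b * w.imK) ^ 2 + -(b ^ 2 + 4 * a) * w.imK ^ 2 = 0 := by
      have : -c * ((2 * w.imJ + b * w.imK) ^ 2 + -(b ^ 2 + 4 * a) * w.imK ^ 2) = 0 := by linarith
      exact (mul_eq_zero.mp this).resolve_left hc'.ne'
    have hK : w.imK = 0 := by
      have : -(b ^ 2 + 4 * a) * w.imK ^ 2 = 0 := by linarith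
      simpa using (mul_eq_zero.mp this).resolve_left hD.ne'
    have hJ : w.imJ = 0 := by
      rw [hK] at h6
      have : (2 * w.imJ) ^ 2 = 0 := by linarith
      simpa using this
    have hre : w.re * w.re = 1 := by
      have : (t : ℚ) ^ 2 = 4 := by exact_mod_cast h
      rw [hI] at ht
      rw [ht] at this
      linarith
    ext <;> simp [hI, hJ, hK, hre]
  -- The unit satisfies w² = t w - 1 with an integer trace |t| ≤ 2. The cases t = ±2, 0, ±1 give
  -- orders dividing 2, 4, 6, with common multiple 12.
  refine ⟨12, by norm_num, Units.ext ?_⟩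
  rw [Units.val_pow_eq_pow_val, Units.val_one, ← hw]
  have ht3 : -2 ≤ t := by nlinarith
  have ht4 : t ≤ 2 := by nlinarith
  have hsix : w ^ 12 = (w * w) ^ 6 := by rw [← pow_two, ← pow_mul]
  interval_cases t
  · rw [hsix, hext (by norm_num), one_pow]
  · have h3 : w ^ 3 = 1 := by
      rw [pow_succ, pow_two, hq]
      simp only [sub_mul, smul_mul_assoc, hq]
      simp
    rw [show 12 = 3 * 4 from rfl, pow_mul, h3, one_pow]
  · rw [hsix, hq]; simp [(by decide : Even 6).neg_pow]
  · have h3 : w ^ 3 = -1 := by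
      rw [pow_succ, pow_two, hq]
      simp only [sub_mul, smul_mul_assoc, hq]
      simp
    rw [show 12 = 3 * 4 from rfl, pow_mul, h3]
    simp [(by decide : Even 4).neg_pow]
  · rw [hsix, hext (by norm_num), one_pow]

end Quaternion

/-! ### The Pell equation -/

/-- For d = 0 the solutions with x = 1 form an additive group in the coordinate y. -/
lemma Pell.Solution₁.zpow_of_zero (a : Pell.Solution₁ 0) (ha : a.x = 1) (n : ℤ) :
    (a ^ n).x = 1 ∧ (a ^ n).y = n * a.y := by
  have hnat : ∀ n : ℕ, (a ^ n).x = 1 ∧ (a ^ n).y = n * a.y := by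
    intro n
    induction n with
    | zero => simp
    | succ n ih =>
      rw [pow_succ, Pell.Solution₁.x_mul, Pell.Solution₁.y_mul, ih.1, ih.2, ha]
      push_cast
      constructor <;> ring
  obtain ⟨k, rfl | rfl⟩ := n.eq_nat_or_neg
  · simpa using hnat k
  · rw [zpow_neg, Pell.Solution₁.x_inv, Pell.Solution₁.y_inv, zpow_natCast, (hnat k).1, (hnat k).2]
    simp

/-- The solutions of the Pell equation form a group of rank at most one, for every `d`. -/
theorem Pell.Solution₁.exists_zpow_mul_zpow_eq_one (d : ℤ) (a b : Pell.Solution₁ d) :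
    ∃ m n : ℤ, (m ≠ 0 ∨ n ≠ 0) ∧ a ^ m * b ^ n = 1 := by
  rcases lt_trichotomy d 0 with hd | rfl | hd
  -- For d < 0 every solution has x = 0 or y = 0, so its square has y = 0 and is ±1.
  · refine ⟨4, 0, by simp, ?_⟩
    have hsq : ∀ c : Pell.Solution₁ d, c.y = 0 → c ^ 2 = 1 := by
      intro c hc
      rcases Pell.Solution₁.eq_one_or_neg_one_iff_y_eq_zero.mpr hc with h | h <;> simp [h]
    have h4 : a ^ (4 : ℤ) = (a ^ 2) ^ 2 := by rw [← pow_mul]; norm_cast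
    rw [zpow_zero, mul_one, h4]
    apply hsq
    rw [pow_two, Pell.Solution₁.y_mul]
    rcases Pell.Solution₁.eq_zero_of_d_neg hd a with h | h <;> simp [h]
  · have hx : ∀ c : Pell.Solution₁ 0, (c ^ 2).x = 1 := by
      intro c
      have := c.prop
      rw [pow_two, Pell.Solution₁.x_mul]
      linarith [pow_two c.x]
    by_cases h : (a ^ 2).y = 0
    · refine ⟨2, 0, by simp, ?_⟩
      rw [zpow_zero, mul_one]
      exact Pell.Solution₁.ext (by simpa using hx a) (by simpa using h)
    · refine ⟨2 * (b ^ 2).y, 2 * -(a ^ 2).y, Or.inr (by simpa using h), ?_⟩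
      rw [zpow_mul, zpow_mul]
      obtain ⟨h1, h2⟩ := Pell.Solution₁.zpow_of_zero (a ^ 2) (hx a) (b ^ 2).y
      obtain ⟨h3, h4⟩ := Pell.Solution₁.zpow_of_zero (b ^ 2) (hx b) (-(a ^ 2).y)
      have e : ∀ c : Pell.Solution₁ 0, c ^ (2 : ℤ) = c ^ 2 := fun c => by norm_cast
      apply Pell.Solution₁.ext
      · rw [Pell.Solution₁.x_mul, e, e, h1, h3]; simp
      · rw [Pell.Solution₁.y_mul, e, e, h1, h2, h3, h4]; simp; ring
  · by_cases hsq : IsSquare d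
    -- For d = k² > 0 the factorisation (x - ky)(x + ky) = 1 over ℤ forces y = 0.
    · refine ⟨2, 0, by simp, ?_⟩
      obtain ⟨k, rfl⟩ := hsq
      have h1 : (a.x - k * a.y) * (a.x + k * a.y) = 1 := by
        have := a.prop; linarith
      have hy : a.y = 0 := by
        have hk : k ≠ 0 := by rintro rfl; simp at hd
        rcases Int.eq_one_or_neg_one_of_mul_eq_one' h1 with h | h
        · have : k * a.y = 0 := by linarith [h.1, h.2]
          exact (mul_eq_zero.mp this).resolve_left hk
        · have : k * a.y = 0 := by linarith [h.1, h.2]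
          exact (mul_eq_zero.mp this).resolve_left hk
      rw [zpow_zero, mul_one]
      rcases Pell.Solution₁.eq_one_or_neg_one_iff_y_eq_zero.mpr hy with h | h
      · simp [h]
      · rw [h]; norm_cast; simp
    · obtain ⟨f, hf⟩ := Pell.IsFundamental.exists_of_not_isSquare hd hsq
      -- Every solution is ± a power of the fundamental one; squaring removes the sign.
      have hp : ∀ c : Pell.Solution₁ d, ∃ i : ℤ, c ^ (2 : ℤ) = f ^ i := by
        intro c
        obtain ⟨i, h | h⟩ := hf.eq_zpow_or_neg_zpow c
        · exact ⟨i * 2, by rw [h, zpow_mul]⟩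
        · refine ⟨i * 2, ?_⟩
          rw [h, zpow_mul]
          norm_cast
          simp
      obtain ⟨i, hi⟩ := hp a
      obtain ⟨j, hj⟩ := hp b
      by_cases h0 : i = 0
      · exact ⟨2, 0, by simp, by rw [hi, h0]; simp⟩
      · refine ⟨2 * j, 2 * -i, Or.inr (by simpa using h0), ?_⟩
        rw [zpow_mul, zpow_mul, hi, hj, ← zpow_mul, ← zpow_mul, ← zpow_add]
        convert zpow_zero f using 2
        ring

/-! ### Two by two matrices -/

section Matrix

open Matrix

/-- The image of `ℤ√d` in the matrix algebra under `√d ↦ T`, where `T² = d`. -/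
def zsqrtdToMatrix {d : ℤ} (T : Matrix (Fin 2) (Fin 2) ℚ) (hT : T * T = (d : ℚ) • 1) :
    ℤ√d →+* Matrix (Fin 2) (Fin 2) ℚ where
  toFun z := (z.re : ℚ) • 1 + (z.im : ℚ) • T
  map_one' := by simp
  map_zero' := by simp
  map_add' x y := by simp; module
  map_mul' x y := by
    simp only [Zsqrtd.re_mul, Zsqrtd.im_mul, mul_add, add_mul, smul_mul_smul_comm, hT, one_mul,
      mul_one]
    push_cast
    module

/-- The centralizer of a nonscalar 2 × 2 matrix is spanned by 1 and that matrix, and a nonzero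
matrix of trace zero is not scalar. The coefficient β is read off at a nonzero entry of `T`. -/
lemma exists_eq_smul_add_smul_of_commute {T V : Matrix (Fin 2) (Fin 2) ℚ}
    (hT0 : T ≠ 0) (htr : T 1 1 = - T 0 0) (h : Commute V T) :
    ∃ α β : ℚ, V = α • 1 + β • T := by
  have e : V * T = T * V := h
  have e00 := congrFun (congrFun e 0) 0
  have e01 := congrFun (congrFun e 0) 1
  have e10 := congrFun (congrFun e 1) 0
  simp only [Matrix.mul_apply, Fin.sum_univ_two, htr] at e00 e01 e10
  have key : ∀ β : ℚ, V 0 1 = β * T 0 1 → V 1 0 = β * T 1 0 → V 0 0 - V 1 1 = 2 * β * T 0 0 →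
      ∃ α β : ℚ, V = α • 1 + β • T := by
    intro β h1 h2 h3
    refine ⟨V 0 0 - β * T 0 0, β, ?_⟩
    ext i j
    fin_cases i <;> fin_cases j <;> simp [h1, h2, htr]
    linarith
  by_cases h01 : T 0 1 = 0
  · by_cases h10 : T 1 0 = 0
    · have h00 : T 0 0 ≠ 0 := by
        intro h00
        apply hT0
        ext i j
        fin_cases i <;> fin_cases j <;> simp [h00, h01, h10, htr]
      refine key ((V 0 0 - V 1 1) / (2 * T 0 0)) ?_ ?_ (by field_simp)
      · rw [h01, mul_zero]
        rw [h01] at e01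
        have : V 0 1 * (2 * T 0 0) = 0 := by linarith
        simpa [h00] using this
      · rw [h10, mul_zero]
        rw [h10] at e10
        have : V 1 0 * (2 * T 0 0) = 0 := by linarith
        simpa [h00] using this
    · refine key (V 1 0 / T 1 0) ?_ (by field_simp) ?_
      · field_simp; linarith
      · field_simp; linarith
  · refine key (V 0 1 / T 0 1) (by field_simp) ?_ ?_
    · field_simp; linarith
    · field_simp; linarith

/-- If u is not scalar, everything commuting with u lies in ℚ[T] with T² an integer d. Up to a
power, integral units of ℚ[T] are elements of norm one in ℤ√d, that is, solutions of the Pell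
equation. The values d = 0 and d a square do occur here, for unipotent and for split u. -/
theorem hasRankOneUnits_matrix : HasRankOneUnits (Matrix (Fin 2) (Fin 2) ℚ) := by
  intro u v huv hu hv
  set T₀ : Matrix (Fin 2) (Fin 2) ℚ := (u : Matrix (Fin 2) (Fin 2) ℚ) -
    ((u.1 0 0 + u.1 1 1) / 2) • 1 with hT₀
  by_cases hsc : T₀ = 0
  · -- scalar case
    set q := (u.1 0 0 + u.1 1 1) / 2 with hq
    have huq : (u : Matrix (Fin 2) (Fin 2) ℚ) = algebraMap ℚ _ q := by
      rw [Algebra.algebraMap_eq_smul_one]; exact sub_eq_zero.mp hsc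
    have hq0 : q ≠ 0 := by
      intro h
      rw [h, map_zero] at huq
      exact u.ne_zero huq
    have huq' : ((u⁻¹ : (Matrix (Fin 2) (Fin 2) ℚ)ˣ) : Matrix (Fin 2) (Fin 2) ℚ) =
        algebraMap ℚ _ q⁻¹ := by
      rw [Units.inv_eq_of_mul_eq_one_right (a := algebraMap ℚ _ q⁻¹)]
      rw [huq, ← map_mul, mul_inv_cancel₀ hq0, map_one]
    have hint : ∀ r : ℚ, IsIntegral ℤ (algebraMap ℚ (Matrix (Fin 2) (Fin 2) ℚ) r) →
        IsIntegral ℤ r := fun r hr =>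
      (isIntegral_algHom_iff (algebraMap ℚ (Matrix (Fin 2) (Fin 2) ℚ)).toIntAlgHom
        (algebraMap ℚ (Matrix (Fin 2) (Fin 2) ℚ)).injective).mp hr
    have h1 := hint _ (huq ▸ hu.1)
    have h2 := hint _ (huq' ▸ hu.2)
    refine ⟨2, 0, by simp, ?_⟩
    have : u ^ 2 = 1 := by
      ext1
      rw [Units.val_pow_eq_pow_val, huq]
      rcases rat_eq_one_or_neg_one_of_isIntegral h1 h2 (mul_inv_cancel₀ hq0) with h | h <;>
        simp [h]
    simpa using this
  have htr₀ : T₀ 1 1 = - T₀ 0 0 := by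
    simp [hT₀]; ring
  have hsq₀ : T₀ * T₀ = (T₀ 0 0 ^ 2 + T₀ 0 1 * T₀ 1 0) • 1 := by
    ext i j
    fin_cases i <;> fin_cases j <;> simp [Matrix.mul_apply, Fin.sum_univ_two, htr₀] <;> ring
  set δ := T₀ 0 0 ^ 2 + T₀ 0 1 * T₀ 1 0 with hδ
  -- Rescaling by the denominator turns T₀² = δ into an integer, δ.num · δ.den.
  set T : Matrix (Fin 2) (Fin 2) ℚ := (δ.den : ℚ) • T₀ with hTdef
  have hden : (δ.den : ℚ) ≠ 0 := by exact_mod_cast δ.den_nz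
  have hT0 : T ≠ 0 := smul_ne_zero hden hsc
  have htr : T 1 1 = - T 0 0 := by simp [hTdef, htr₀]
  have hT : T * T = ((δ.num * δ.den : ℤ) : ℚ) • 1 := by
    rw [hTdef, smul_mul_smul_comm, hsq₀, smul_smul]
    congr 1
    nth_rewrite 3 [← Rat.num_div_den δ]
    push_cast
    field_simp
  set d := δ.num * δ.den with hd
  set φ := zsqrtdToMatrix T hT with hφ
  have hφinj : Function.Injective φ := by
    rw [injective_iff_map_eq_zero]
    intro z hz
    have hz' : (z.re : ℚ) • (1 : Matrix (Fin 2) (Fin 2) ℚ) + (z.im : ℚ) • T = 0 := hz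
    have him : z.im = 0 := by
      by_contra him
      apply hT0
      have h00 := congrFun (congrFun hz' 0) 0
      have h11 := congrFun (congrFun hz' 1) 1
      have h01 := congrFun (congrFun hz' 0) 1
      have h10 := congrFun (congrFun hz' 1) 0
      simp [htr, him] at h00 h11 h01 h10
      have : (z.im : ℚ) * T 0 0 = 0 := by linarith
      have h00' : T 0 0 = 0 := by simpa [him] using this
      ext i j
      fin_cases i <;> fin_cases j <;> simp [h00', h01, h10, htr]
    rw [him] at hz'
    have h00 := congrFun (congrFun hz' 0) 0
    simp at h00
    exact Zsqrtd.ext h00 him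
  have huT₀ : Commute (u : Matrix (Fin 2) (Fin 2) ℚ) T₀ := by
    rw [hT₀]
    exact (Commute.refl _).sub_right ((Commute.one_right _).smul_right _)
  have hvT₀ : Commute (v : Matrix (Fin 2) (Fin 2) ℚ) T₀ := by
    rw [hT₀]
    exact (huv.symm.map (Units.coeHom _)).sub_right ((Commute.one_right _).smul_right _)
  let Ψ : Pell.Solution₁ d →* (Matrix (Fin 2) (Fin 2) ℚ)ˣ :=
    (Units.map (φ : ℤ√d →* Matrix (Fin 2) (Fin 2) ℚ)).comp
      (Unitary.toUnits : unitary (ℤ√d) →* (ℤ√d)ˣ)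
  have main : ∀ w : (Matrix (Fin 2) (Fin 2) ℚ)ˣ, IsIntegralUnit w →
      Commute (w : Matrix (Fin 2) (Fin 2) ℚ) T₀ → ∃ k : ℕ, 0 < k ∧ ∃ s : Pell.Solution₁ d, Ψ s = w ^ k := by
    intro w hw hwT
    obtain ⟨k, hk, ⟨z, hz⟩, ⟨z', hz'⟩⟩ := hw.exists_pow_mem φ.range fun n => by
      have hc : Commute ((w ^ n : (Matrix (Fin 2) (Fin 2) ℚ)ˣ) : Matrix (Fin 2) (Fin 2) ℚ) T := by
        rw [Units.val_pow_eq_pow_val, hTdef]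
        exact (hwT.pow_left n).smul_right _
      obtain ⟨α, β, h⟩ := exists_eq_smul_add_smul_of_commute hT0 htr hc
      rw [h]
      refine Submodule.add_mem _ (Submodule.smul_mem _ _ (Submodule.subset_span φ.range.one_mem))
        (Submodule.smul_mem _ _ (Submodule.subset_span ⟨⟨0, 1⟩, ?_⟩))
      simp [hφ, zsqrtdToMatrix]
    have hzz : z * z' = 1 := by
      apply hφinj
      rw [map_mul, hz, hz', map_one, Units.mul_inv]
    have hnorm : z.norm * z'.norm = 1 := by rw [← Zsqrtd.norm_mul, hzz, Zsqrtd.norm_one]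
    have hnorm2 : (z ^ 2).norm = 1 := by
      rw [pow_two, Zsqrtd.norm_mul]
      rcases Int.eq_one_or_neg_one_of_mul_eq_one hnorm with h | h <;> simp [h]
    -- The norm of z is ±1, and squaring makes it 1.
    refine ⟨k * 2, by omega, ⟨z ^ 2, Zsqrtd.norm_eq_one_iff_mem_unitary.mp hnorm2⟩, ?_⟩
    ext1
    change φ (z ^ 2) = _
    rw [map_pow, hz, pow_mul, Units.val_pow_eq_pow_val _ 2]
  obtain ⟨k, hk, s, hs⟩ := main u hu huT₀
  obtain ⟨l, hl, t, ht⟩ := main v hv hvT₀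
  obtain ⟨m, n, hmn, hrel⟩ := Pell.Solution₁.exists_zpow_mul_zpow_eq_one d s t
  refine ⟨k * m, l * n, ?_, ?_⟩
  · rcases hmn with h | h
    · exact Or.inl (mul_ne_zero (by omega) h)
    · exact Or.inr (mul_ne_zero (by omega) h)
  · rw [_root_.zpow_mul, _root_.zpow_mul, zpow_natCast, zpow_natCast, ← hs, ← ht, ← map_zpow, ← map_zpow,
      ← map_mul, hrel, map_one]

end Matrix


/-! ### The standard involution of a rational group algebra -/

section Involution

open MonoidAlgebra

variable {G : Type*} [Group G]

/-- Every conjugate of `g` is `g` or `g⁻¹`. -/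
def HasInverseConjugates (G : Type*) [Group G] : Prop :=
  ∀ g h : G, h * g * h⁻¹ = g ∨ h * g * h⁻¹ = g⁻¹

/-- The linear extension of `g ↦ g⁻¹`. -/
noncomputable def groupInvolution (x : MonoidAlgebra ℚ G) : MonoidAlgebra ℚ G :=
  mapDomain (fun g : G => g⁻¹) x

lemma groupInvolution_single (g : G) (r : ℚ) :
    groupInvolution (single g r) = single g⁻¹ r := mapDomain_single

lemma groupInvolution_add (x y : MonoidAlgebra ℚ G) :
    groupInvolution (x + y) = groupInvolution x + groupInvolution y := mapDomain_add ..

lemma groupInvolution_groupInvolution (x : MonoidAlgebra ℚ G) :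
    groupInvolution (groupInvolution x) = x := by
  induction x using MonoidAlgebra.induction_linear with
  | zero => simp [groupInvolution]
  | add x y hx hy => rw [groupInvolution_add, groupInvolution_add, hx, hy]
  | single g r => simp [groupInvolution_single]

lemma coeff_groupInvolution (x : MonoidAlgebra ℚ G) (g : G) :
    (groupInvolution x).coeff g = x.coeff g⁻¹ := by
  classical
  induction x using MonoidAlgebra.induction_linear with
  | zero => simp [groupInvolution]
  | add x y hx hy => rw [groupInvolution_add]; simp [hx, hy]
  | single h r =>
    rw [groupInvolution_single, coeff_single, coeff_single, Finsupp.single_apply,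
      Finsupp.single_apply]
    simp [inv_eq_iff_eq_inv]

lemma groupInvolution_mul (x y : MonoidAlgebra ℚ G) :
    groupInvolution (x * y) = groupInvolution y * groupInvolution x := by
  induction x using MonoidAlgebra.induction_linear with
  | zero => simp [groupInvolution]
  | add x x' hx hx' => rw [add_mul, groupInvolution_add, groupInvolution_add, hx, hx', mul_add]
  | single g r =>
    induction y using MonoidAlgebra.induction_linear with
    | zero => simp [groupInvolution]
    | add x x' hx hx' => rw [mul_add, groupInvolution_add, groupInvolution_add, hx, hx', add_mul]
    | single h s => simp [groupInvolution_single, single_mul_single, mul_comm]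

lemma coeff_one_mul_groupInvolution [Fintype G] (x : MonoidAlgebra ℚ G) :
    (x * groupInvolution x).coeff 1 = ∑ g, x.coeff g ^ 2 := by
  rw [coeff_mul_apply_left, Finsupp.sum_fintype _ _ (by simp)]
  refine Finset.sum_congr rfl fun g _ => ?_
  rw [coeff_groupInvolution]
  simp [pow_two]

/-- The coefficient of x x* at the identity is the sum of the squares of the rational coefficients
of x. -/
lemma eq_zero_of_mul_groupInvolution_eq_zero [Finite G] {x : MonoidAlgebra ℚ G}
    (h : x * groupInvolution x = 0) : x = 0 := by
  have := Fintype.ofFinite G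
  have h1 := coeff_one_mul_groupInvolution x
  rw [h] at h1
  ext g
  have h2 := (Finset.sum_eq_zero_iff_of_nonneg fun g _ => sq_nonneg (x.coeff g)).mp
    (h1.symm.trans (by simp)) g (Finset.mem_univ g)
  simpa using h2

/-- In a group in which conjugates are trivial or inverses, symmetric elements are central. -/
lemma HasInverseConjugates.commute (hG : HasInverseConjugates G) {c : MonoidAlgebra ℚ G}
    (hc : groupInvolution c = c) (x : MonoidAlgebra ℚ G) : Commute c x := by
  induction x using MonoidAlgebra.induction_linear with
  | zero => exact Commute.zero_right c
  | add x y hx hy => exact hx.add_right hy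
  | single h r =>
    rw [Commute, SemiconjBy]
    ext k
    rw [coeff_mul_single_apply, coeff_single_mul_apply, mul_comm]
    congr 1
    have h1 : k * h⁻¹ = h * (h⁻¹ * k) * h⁻¹ := by group
    rcases hG (h⁻¹ * k) h with h2 | h2
    · rw [h1, h2]
    · rw [h1, h2, ← coeff_groupInvolution, hc]

/-- Let x² = 0. The symmetric element c = x x* is central, so c c* = c² = x c x* = x² (x*)² = 0.
Positivity gives c = 0 and then x = 0. -/
theorem HasInverseConjugates.isReduced [Finite G] (hG : HasInverseConjugates G) :
    IsReduced (MonoidAlgebra ℚ G) := by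
  rw [isReduced_iff_pow_one_lt 2 one_lt_two]
  intro x hx
  apply eq_zero_of_mul_groupInvolution_eq_zero
  have hd : groupInvolution (x * groupInvolution x) = x * groupInvolution x := by
    rw [groupInvolution_mul, groupInvolution_groupInvolution]
  apply eq_zero_of_mul_groupInvolution_eq_zero
  rw [hd, mul_assoc, ← (hG.commute hd (groupInvolution x)).eq, mul_assoc x, ← mul_assoc x x,
    ← pow_two, hx, zero_mul]

-- For a fourth root of unity a, the number a + a⁻¹ is 0 or ±2, a root of X³ - 4X. For a sixth root
-- of unity it is ±1 or ±2, whence the companion identity that follows. That these values are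
-- integers is what makes exponents 4 and 6 work.
open Polynomial in
lemma add_pow_three_of_pow_four_eq_one {A : Type*} [Ring A] {a : A} (h : a ^ 4 = 1) :
    (a + a ^ 3) ^ 3 = 4 * (a + a ^ 3) := by
  have e : ((X + X ^ 3) ^ 3 - 4 * (X + X ^ 3) : ℤ[X]) = (X ^ 5 + 3 * X ^ 3 + 4 * X) * (X ^ 4 - 1) := by
    ring
  have := congrArg (aeval a) e
  rw [map_mul _ _ (X ^ 4 - 1)] at this
  simp only [map_sub, map_pow, map_mul, map_add, aeval_X, map_ofNat, map_one, h, sub_self,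
    mul_zero] at this
  exact sub_eq_zero.mp this

open Polynomial in
lemma add_pow_five_of_pow_six_eq_one {A : Type*} [Ring A] {a : A} (h : a ^ 6 = 1) :
    ((a + a ^ 5) ^ 2 - 1) * ((a + a ^ 5) ^ 2 - 4) = 0 := by
  have e : (((X + X ^ 5) ^ 2 - 1) * ((X + X ^ 5) ^ 2 - 4) : ℤ[X]) =
      ((X ^ 2 + 2) + (X ^ 4 + 2) * (2 * (X ^ 4 + X ^ 2 + 1) - 3) +
        (X ^ 6 - 1) * (X ^ 4 + 2) ^ 2) * (X ^ 6 - 1) := by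
    ring
  have := congrArg (aeval a) e
  rw [map_mul _ _ (X ^ 6 - 1)] at this
  simpa only [map_sub, map_pow, map_mul, map_add, aeval_X, map_ofNat, map_one, h, sub_self,
    mul_zero] using this

lemma sum_single_coeff [Fintype G] (x : MonoidAlgebra ℚ G) :
    ∑ g, x.coeff g • single g (1 : ℚ) = x := by
  classical
  ext h
  simp [coeff_sum]

/-- An integral unit of a commutative algebra that is a rational combination of elements with
integral spectrum is `±1` modulo nilpotents. -/
lemma isNilpotent_mul_self_sub_one {C ι : Type*} [CommRing C] [Algebra ℚ C] [Fintype ι] {σ : ι → C}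
    (hσ : ∀ i, σ i ^ 3 = 4 * σ i ∨ (σ i ^ 2 - 1) * (σ i ^ 2 - 4) = 0) {p q : ι → ℚ}
    (hcd : (∑ i, p i • σ i) * (∑ i, q i • σ i) = 1) (hc : IsIntegral ℤ (∑ i, p i • σ i))
    (hd : IsIntegral ℤ (∑ i, q i • σ i)) :
    IsNilpotent ((∑ i, p i • σ i) * (∑ i, p i • σ i) - 1) := by
  -- Modulo a prime ideal each σ i becomes an integer. The unit becomes a rational number that is
  -- integral with integral inverse, hence ±1.
  rw [nilpotent_iff_mem_prime]
  intro J hJ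
  have hn : ∀ i, ∃ n : ℤ, Ideal.Quotient.mk J (σ i) = n := by
    intro i
    rcases hσ i with h | h
    · have h2 := congrArg (Ideal.Quotient.mk J) h
      simp only [map_pow, map_mul, map_ofNat] at h2
      have : Ideal.Quotient.mk J (σ i) * ((Ideal.Quotient.mk J (σ i) - 2) *
          (Ideal.Quotient.mk J (σ i) + 2)) = 0 := by linear_combination h2
      rcases mul_eq_zero.mp this with h | h
      · exact ⟨0, by simpa using h⟩
      rcases mul_eq_zero.mp h with h | h
      · exact ⟨2, by push_cast; linear_combination h⟩
      · exact ⟨-2, by push_cast; linear_combination h⟩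
    · have h2 := congrArg (Ideal.Quotient.mk J) h
      simp only [map_pow, map_mul, map_sub, map_one, map_ofNat, map_zero] at h2
      have : (Ideal.Quotient.mk J (σ i) - 1) * ((Ideal.Quotient.mk J (σ i) + 1) *
          ((Ideal.Quotient.mk J (σ i) - 2) * (Ideal.Quotient.mk J (σ i) + 2))) = 0 := by
        linear_combination h2
      rcases mul_eq_zero.mp this with h | h
      · exact ⟨1, by push_cast; linear_combination h⟩
      rcases mul_eq_zero.mp h with h | h
      · exact ⟨-1, by push_cast; linear_combination h⟩
      rcases mul_eq_zero.mp h with h | h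
      · exact ⟨2, by push_cast; linear_combination h⟩
      · exact ⟨-2, by push_cast; linear_combination h⟩
  choose n hn using hn
  have hrat : ∀ p : ι → ℚ, Ideal.Quotient.mk J (∑ i, p i • σ i) =
      algebraMap ℚ (C ⧸ J) (∑ i, p i * n i) := by
    intro p
    rw [map_sum, map_sum]
    refine Finset.sum_congr rfl fun g _ => ?_
    rw [Algebra.smul_def, map_mul, map_mul, hn, map_intCast]
    rfl
  have hint : ∀ q : ℚ, IsIntegral ℤ (algebraMap ℚ (C ⧸ J) q) → IsIntegral ℤ q := fun q hq =>
    (isIntegral_algHom_iff (algebraMap ℚ (C ⧸ J)).toIntAlgHom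
      (algebraMap ℚ (C ⧸ J)).injective).mp hq
  have hqi := hint _ (hrat p ▸ hc.map (Ideal.Quotient.mk J).toIntAlgHom)
  have hri := hint _ (hrat q ▸ hd.map (Ideal.Quotient.mk J).toIntAlgHom)
  have hqr : (∑ i, p i * n i) * (∑ i, q i * n i) = 1 := by
    apply (algebraMap ℚ (C ⧸ J)).injective
    rw [map_mul, ← hrat, ← hrat, ← map_mul, hcd, map_one, map_one]
  rw [← Ideal.Quotient.eq_zero_iff_mem, map_sub, map_mul, map_one, hrat, ← map_mul]
  rcases rat_eq_one_or_neg_one_of_isIntegral hqi hri hqr with h | h <;> simp [h]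

/-- A symmetric integral unit with symmetric integral inverse squares to `1`. -/
lemma HasInverseConjugates.mul_self_eq_one [Finite G] (hG : HasInverseConjugates G)
    (hexp : (∀ g : G, g ^ 4 = 1) ∨ ∀ g : G, g ^ 6 = 1) {c d : MonoidAlgebra ℚ G}
    (hc : groupInvolution c = c) (hd : groupInvolution d = d) (hcd : c * d = 1)
    (hci : IsIntegral ℤ c) (hdi : IsIntegral ℤ d) : c * c = 1 := by
  have := Fintype.ofFinite G
  have hred := hG.isReduced
  let C := Subalgebra.center ℚ (MonoidAlgebra ℚ G)
  have hmem : ∀ x : MonoidAlgebra ℚ G, groupInvolution x = x → x ∈ C := fun x hx =>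
    Subalgebra.mem_center_iff.mpr fun y => (hG.commute hx y).eq.symm
  let σ : G → C := fun g => ⟨single g 1 + single g⁻¹ 1, hmem _ (by
    rw [groupInvolution_add, groupInvolution_single, groupInvolution_single, inv_inv, add_comm])⟩
  let c' : C := ⟨c, hmem c hc⟩
  let d' : C := ⟨d, hmem d hd⟩
  have hcd' : c' * d' = 1 := Subtype.ext hcd
  have hinj : Function.Injective (C.val.toRingHom.toIntAlgHom) := Subtype.val_injective
  have hci' : IsIntegral ℤ c' := (isIntegral_algHom_iff _ hinj).mp hci
  have hdi' : IsIntegral ℤ d' := (isIntegral_algHom_iff _ hinj).mp hdi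
  -- Symmetry gives x = (x + x*) / 2, a combination of the central elements g + g⁻¹.
  have hexpand : ∀ x (hx : groupInvolution x = x), (⟨x, hmem x hx⟩ : C) =
      ∑ g, (x.coeff g / 2) • σ g := by
    intro x hx
    apply Subtype.ext
    have h1 : x = ∑ g, x.coeff g • single g⁻¹ (1 : ℚ) := by
      conv_lhs => rw [← sum_single_coeff x]
      rw [← Equiv.sum_comp (Equiv.inv G)]
      refine Finset.sum_congr rfl fun g _ => ?_
      simp only [Equiv.inv_apply]
      rw [← coeff_groupInvolution, hx]
    have h2 : x = (1 / 2 : ℚ) • (x + x) := by rw [← two_smul ℚ x, smul_smul]; norm_num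
    have h3 : x + x = ∑ g, x.coeff g • (single g (1 : ℚ) + single g⁻¹ 1) := by
      simp only [smul_add, Finset.sum_add_distrib]
      rw [← h1, sum_single_coeff]
    simp only [AddSubmonoidClass.coe_finsetSum, Subalgebra.coe_smul, σ]
    conv_lhs => rw [h2, h3, Finset.smul_sum]
    refine Finset.sum_congr rfl fun g _ => ?_
    rw [smul_smul]
    congr 1
    ring
  have hσ : ∀ g, σ g ^ 3 = 4 * σ g ∨ (σ g ^ 2 - 1) * (σ g ^ 2 - 4) = 0 := by
    intro g
    have hinv : ∀ n : ℕ, g ^ (n + 1) = 1 →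
        ((σ g : C) : MonoidAlgebra ℚ G) = single g 1 + single g 1 ^ n := by
      intro n hn
      have : g⁻¹ = g ^ n := inv_eq_of_mul_eq_one_right (by rw [← pow_succ', hn])
      simp [σ, single_pow, this]
    have hsg : ∀ n : ℕ, g ^ n = 1 → (single g (1 : ℚ)) ^ n = 1 := by
      intro n hn
      rw [single_pow, hn, one_pow, one_def]
    rcases hexp with h | h
    · left
      apply Subtype.ext
      have := add_pow_three_of_pow_four_eq_one (hsg 4 (h g))
      rw [← hinv 3 (h g)] at this
      exact this
    · right
      apply Subtype.ext
      have := add_pow_five_of_pow_six_eq_one (hsg 6 (h g))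
      rw [← hinv 5 (h g)] at this
      exact this
  have hc'' : c' = ∑ g, (c.coeff g / 2) • σ g := hexpand c hc
  have hd'' : d' = ∑ g, (d.coeff g / 2) • σ g := hexpand d hd
  have hnil : IsNilpotent (c' * c' - 1) := by
    rw [hc''] at hcd' hci' ⊢
    rw [hd''] at hcd' hdi'
    exact isNilpotent_mul_self_sub_one hσ hcd' hci' hdi'
  have h1 : IsNilpotent (c * c - 1) := hnil.map C.val
  exact sub_eq_zero.mp h1.eq_zero

/-- The integral group ring, as a subring of the rational group algebra. -/
noncomputable def integralGroupRing (G : Type*) [Group G] : Subring (MonoidAlgebra ℚ G) :=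
  (mapRingHom G (Int.castRingHom ℚ)).range

lemma mem_integralGroupRing {x : MonoidAlgebra ℚ G} :
    x ∈ integralGroupRing G ↔ ∀ g, ∃ n : ℤ, x.coeff g = n := by
  have h := range_map (M := G) (Int.castRingHom ℚ : ℤ →+ ℚ)
  have h' := Set.ext_iff.mp h x
  simp only [Set.mem_range, Set.mem_ofPred_eq] at h'
  constructor
  · rintro ⟨y, hy⟩ g
    obtain ⟨n, hn⟩ := h'.mp ⟨y, hy⟩ g
    exact ⟨n, hn.symm⟩
  · intro hx
    obtain ⟨y, hy⟩ := h'.mpr fun g => (hx g).imp fun n hn => hn.symm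
    exact ⟨y, hy⟩

lemma isIntegral_of_mem_integralGroupRing [Finite G] {x : MonoidAlgebra ℚ G}
    (hx : x ∈ integralGroupRing G) : IsIntegral ℤ x := by
  obtain ⟨y, rfl⟩ := hx
  have : Module.Finite ℤ (MonoidAlgebra ℤ G) :=
    Module.Finite.equiv (MonoidAlgebra.coeffLinearEquiv ℤ).symm
  exact (IsIntegral.of_finite ℤ y).map (mapRingHom G (Int.castRingHom ℚ)).toIntAlgHom

lemma groupInvolution_mem_integralGroupRing {x : MonoidAlgebra ℚ G}
    (hx : x ∈ integralGroupRing G) : groupInvolution x ∈ integralGroupRing G := by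
  rw [mem_integralGroupRing] at hx ⊢
  intro g
  rw [coeff_groupInvolution]
  exact hx _

lemma mem_span_integralGroupRing (x : MonoidAlgebra ℚ G) :
    x ∈ Submodule.span ℚ (integralGroupRing G : Set (MonoidAlgebra ℚ G)) := by
  induction x using MonoidAlgebra.induction_linear with
  | zero => exact Submodule.zero_mem _
  | add x y hx hy => exact Submodule.add_mem _ hx hy
  | single g r =>
    have : single g r = r • single g (1 : ℚ) := by simp
    rw [this]
    exact Submodule.smul_mem _ _ (Submodule.subset_span ⟨single g 1, by simp⟩)

/-- An integral element with `∑ x_g ^ 2 = 1` is, up to sign, an element of the group. -/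
lemma eq_single_of_sum_sq_eq_one [Fintype G] {x : MonoidAlgebra ℚ G}
    (hx : x ∈ integralGroupRing G) (h : ∑ g, x.coeff g ^ 2 = 1) :
    ∃ g, x = single g (x.coeff g) ∧ x.coeff g ^ 2 = 1 := by
  classical
  rw [mem_integralGroupRing] at hx
  choose n hn using hx
  have hsum : ∑ g, n g ^ 2 = 1 := by
    simp only [hn] at h
    exact_mod_cast h
  obtain ⟨g, hg⟩ : ∃ g, n g ≠ 0 := by
    by_contra! hcon
    simp [hcon] at hsum
  have hsplit := Finset.add_sum_erase Finset.univ (fun g => n g ^ 2) (Finset.mem_univ g)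
  have h1 : 1 ≤ n g ^ 2 := by
    have := sq_pos_of_ne_zero hg; omega
  have hnn : ∀ k ∈ Finset.univ.erase g, 0 ≤ n k ^ 2 := fun k _ => sq_nonneg _
  have h2 : ∑ k ∈ Finset.univ.erase g, n k ^ 2 = 0 := by
    have := Finset.sum_nonneg hnn
    rw [hsum] at hsplit
    linarith
  have h3 := (Finset.sum_eq_zero_iff_of_nonneg hnn).mp h2
  refine ⟨g, ?_, ?_⟩
  · ext k
    rw [coeff_single, Finsupp.single_apply]
    split_ifs with hk
    · rw [hk]
    · have := h3 k (Finset.mem_erase.mpr ⟨fun h => hk h.symm, Finset.mem_univ k⟩)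
      rw [hn]
      have : n k = 0 := by simpa using this
      simp [this]
  · rw [hn]
    rw [h2, hsum, add_zero] at hsplit
    exact_mod_cast hsplit

/-- The integral units of the rational group algebra of a Higman group have finite order. -/
theorem HasInverseConjugates.hasTorsionUnits [Finite G] (hG : HasInverseConjugates G)
    (hexp : (∀ g : G, g ^ 4 = 1) ∨ ∀ g : G, g ^ 6 = 1) :
    HasTorsionUnits (MonoidAlgebra ℚ G) := by
  classical
  have := Fintype.ofFinite G
  intro u hu
  obtain ⟨k, hk, hk1, hk2⟩ := hu.exists_pow_mem (integralGroupRing G) fun n =>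
    mem_span_integralGroupRing _
  set w := u ^ k with hw
  set c : MonoidAlgebra ℚ G := (w : MonoidAlgebra ℚ G) * groupInvolution w with hc
  set d : MonoidAlgebra ℚ G :=
    groupInvolution ((w⁻¹ : (MonoidAlgebra ℚ G)ˣ) : MonoidAlgebra ℚ G) *
      ((w⁻¹ : (MonoidAlgebra ℚ G)ˣ) : MonoidAlgebra ℚ G) with hd
  -- The element c = w w* is a symmetric unit of the integral group ring with inverse d, hence c² =
  -- 1.
  have hcm : c ∈ integralGroupRing G :=
    Subring.mul_mem _ hk1 (groupInvolution_mem_integralGroupRing hk1)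
  have hdm : d ∈ integralGroupRing G :=
    Subring.mul_mem _ (groupInvolution_mem_integralGroupRing hk2) hk2
  have hcs : groupInvolution c = c := by
    rw [hc, groupInvolution_mul, groupInvolution_groupInvolution]
  have hds : groupInvolution d = d := by
    rw [hd, groupInvolution_mul, groupInvolution_groupInvolution]
  have hinv1 : groupInvolution (1 : MonoidAlgebra ℚ G) = 1 := by
    rw [one_def, groupInvolution_single, inv_one]
  have hcd : c * d = 1 := by
    rw [hc, hd, mul_assoc, ← mul_assoc (groupInvolution _), ← groupInvolution_mul, Units.inv_mul,
      hinv1, one_mul, Units.mul_inv]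
  have hcc := hG.mul_self_eq_one hexp hcs hds hcd (isIntegral_of_mem_integralGroupRing hcm)
    (isIntegral_of_mem_integralGroupRing hdm)
  have hc1 : c.coeff 1 = ∑ g, (w : MonoidAlgebra ℚ G).coeff g ^ 2 :=
    coeff_one_mul_groupInvolution _
  -- The coefficient of c c* = c² = 1 at the identity. So the integral element c is ± a group
  -- element, and its positive coefficient at the identity leaves only c = 1.
  have hcsum : ∑ g, c.coeff g ^ 2 = 1 := by
    rw [← coeff_one_mul_groupInvolution, hcs, hcc]
    simp
  obtain ⟨g, hg, hg1⟩ := eq_single_of_sum_sq_eq_one hcm hcsum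
  have hpos : 0 < c.coeff 1 := by
    rw [hc1]
    refine lt_of_le_of_ne (Finset.sum_nonneg fun g _ => sq_nonneg _) fun h0 => w.ne_zero ?_
    ext g
    have := (Finset.sum_eq_zero_iff_of_nonneg fun g _ => sq_nonneg _).mp h0.symm g
      (Finset.mem_univ g)
    simpa using this
  have hg2 : g = 1 := by
    by_contra hne
    rw [hg, coeff_single, Finsupp.single_apply, if_neg hne] at hpos
    exact lt_irrefl _ hpos
  have hc11 : c.coeff 1 = 1 := by
    rw [hg2] at hg1
    nlinarith
  -- Now w w* = 1, and the same argument shows that w is ± a group element.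
  obtain ⟨h, hh, hh1⟩ := eq_single_of_sum_sq_eq_one hk1 (hc1.symm.trans hc11)
  refine ⟨k * (2 * orderOf h), Nat.mul_pos hk (Nat.mul_pos two_pos (orderOf_pos h)), ?_⟩
  rw [pow_mul, ← hw]
  ext1
  rw [Units.val_pow_eq_pow_val, hh, single_pow, pow_mul (_ : ℚ) 2 (orderOf h), hh1, one_pow, mul_comm,
    pow_mul h, pow_orderOf_eq_one, one_pow, Units.val_one, one_def]

end Involution


/-! ### Units of infinite order in group algebras of cyclic groups -/

/-- The homomorphism from the cyclic group of order `n` that sends the generator to `g`. -/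
def cyclicHom (n : ℕ) [NeZero n] {M : Type*} [Monoid M] (g : M) (hg : g ^ n = 1) :
    CyclicGroup n →* M where
  toFun x := g ^ (Multiplicative.toAdd x).val
  map_one' := by simp
  map_mul' x y := by
    rw [toAdd_mul, ZMod.val_add, ← pow_eq_pow_mod _ hg, pow_add]

lemma cyclicHom_ofAdd_natCast (n : ℕ) [NeZero n] {M : Type*} [Monoid M] (g : M) (hg : g ^ n = 1)
    (i : ℕ) : cyclicHom n g hg (Multiplicative.ofAdd (i : ZMod n)) = g ^ i := by
  change g ^ (i : ZMod n).val = g ^ i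
  rw [ZMod.val_natCast, ← pow_eq_pow_mod _ hg]

lemma cyclicHom_ofAdd_one (n : ℕ) [NeZero n] {M : Type*} [Monoid M] (g : M) (hg : g ^ n = 1) :
    cyclicHom n g hg (Multiplicative.ofAdd 1) = g := by
  simpa using cyclicHom_ofAdd_natCast n g hg 1

lemma cyclicHom_injective {n : ℕ} [NeZero n] {G : Type*} [Group G] {g : G} (hg : orderOf g = n) :
    Function.Injective (cyclicHom n g (hg ▸ pow_orderOf_eq_one g)) := by
  intro x y h
  have h' : g ^ (Multiplicative.toAdd x).val = g ^ (Multiplicative.toAdd y).val := h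
  rw [pow_inj_mod, hg, Nat.mod_eq_of_lt (ZMod.val_lt _), Nat.mod_eq_of_lt (ZMod.val_lt _)] at h'
  exact Multiplicative.toAdd.injective (ZMod.val_injective n h')

/-! ### Averages over the powers of an element of finite order -/

section GeomAvg

variable {R : Type*} [Ring R] [Algebra ℚ R]

/-- The average of the powers of `h`. -/
def powAverage (n : ℕ) (h : R) : R := (n : ℚ)⁻¹ • ∑ i ∈ Finset.range n, h ^ i

lemma powAverage_mul_of_mul_eq {n : ℕ} (hn : n ≠ 0) {h x : R} (hx : h * x = x) :
    powAverage n h * x = x := by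
  have : ∀ i : ℕ, h ^ i * x = x := by
    intro i
    induction i with
    | zero => simp
    | succ i ih => rw [pow_succ, mul_assoc, hx, ih]
  rw [powAverage, smul_mul_assoc, Finset.sum_mul, Finset.sum_congr rfl fun i _ => this i,
    Finset.sum_const, Finset.card_range, ← Nat.cast_smul_eq_nsmul ℚ, smul_smul,
    inv_mul_cancel₀ (by exact_mod_cast hn), one_smul]

lemma mul_powAverage_of_mul_eq {n : ℕ} (hn : n ≠ 0) {h x : R} (hx : x * h = x) :
    x * powAverage n h = x := by
  have : ∀ i : ℕ, x * h ^ i = x := by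
    intro i
    induction i with
    | zero => simp
    | succ i ih => rw [pow_succ', ← mul_assoc, hx, ih]
  rw [powAverage, mul_smul_comm, Finset.mul_sum, Finset.sum_congr rfl fun i _ => this i,
    Finset.sum_const, Finset.card_range, ← Nat.cast_smul_eq_nsmul ℚ, smul_smul,
    inv_mul_cancel₀ (by exact_mod_cast hn), one_smul]

lemma mul_powAverage {n : ℕ} {h : R} (hh : h ^ n = 1) : h * powAverage n h = powAverage n h := by
  have := mul_geom_sum h n
  rw [hh, sub_self, sub_mul, one_mul, sub_eq_zero] at this
  rw [powAverage, mul_smul_comm, this]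

lemma powAverage_mul_self {n : ℕ} (hn : n ≠ 0) {h : R} (hh : h ^ n = 1) :
    powAverage n h * powAverage n h = powAverage n h :=
  powAverage_mul_of_mul_eq hn (mul_powAverage hh)

lemma map_powAverage {S : Type*} [Ring S] [Algebra ℚ S] (f : R →ₐ[ℚ] S) (n : ℕ) (h : R) :
    f (powAverage n h) = powAverage n (f h) := by
  simp [powAverage]

end GeomAvg

/-- The cyclotomic unit `1 + g + ⋯ + g ^ (k - 1)`, modified so as to be trivial on the fixed part of
a power `h` of `g`. -/
lemma exists_cyclotomic_unit {R : Type*} [CommRing R] [Algebra ℚ R] {n j k : ℕ} (hn : n ≠ 0)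
    (hk : Nat.Coprime k n) (g : R) (hg : g ^ n = 1) :
    ∃ u : Rˣ, IsIntegralUnit u ∧ (u : R) =
      (∑ i ∈ Finset.range k, g ^ i) * (1 - powAverage n (g ^ j)) + powAverage n (g ^ j) := by
  set e := powAverage n (g ^ j) with he
  have hh : (g ^ j) ^ n = 1 := by rw [← pow_mul, mul_comm, pow_mul, hg, one_pow]
  have hee : e * e = e := powAverage_mul_self hn hh
  -- Here l inverts k modulo n, so y = (g - 1) / (g ^ k - 1), formally, is a polynomial in g ^ k.
  obtain ⟨l, hl⟩ : ∃ l : ℕ, g ^ (k * l) = g := by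
    rcases Nat.lt_or_ge 1 n with h1 | h1
    · obtain ⟨l, -, hl⟩ := Nat.exists_mul_mod_eq_one_of_coprime hk h1
      exact ⟨l, by rw [pow_eq_pow_mod _ hg, hl, pow_one]⟩
    · have : n = 1 := by omega
      rw [this, pow_one] at hg
      exact ⟨0, by simp [hg]⟩
  set b := ∑ i ∈ Finset.range k, g ^ i with hb
  set y := ∑ i ∈ Finset.range l, (g ^ k) ^ i with hy
  have hb1 : (g - 1) * b = g ^ k - 1 := mul_geom_sum g k
  have hy1 : (g ^ k - 1) * y = g - 1 := by
    have := mul_geom_sum (g ^ k) l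
    rw [← pow_mul, hl] at this
    exact this
  -- The product b y is 1 up to an element fixed by g. That element is killed by 1 - e, so y (1 - e)
  -- + e is the inverse sought.
  have hby : g * (b * y - 1) = b * y - 1 := by linear_combination y * hb1 + hy1
  have hbyj : g ^ j * (b * y - 1) = b * y - 1 := by
    have : ∀ j : ℕ, g ^ j * (b * y - 1) = b * y - 1 := by
      intro j
      induction j with
      | zero => simp
      | succ i ih => rw [pow_succ, mul_assoc, hby, ih]
    exact this j
  have hbye : e * (b * y - 1) = b * y - 1 := powAverage_mul_of_mul_eq hn hbyj
  have hgi : IsIntegral ℤ g := IsIntegral.of_pow (Nat.pos_of_ne_zero hn) (hg ▸ isIntegral_one)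
  have hei : IsIntegral ℤ e :=
    ⟨Polynomial.X ^ 2 - Polynomial.X, by monicity!, by simp [pow_two, hee]⟩
  have hbi : IsIntegral ℤ b := IsIntegral.sum _ fun i _ => hgi.pow i
  have hyi : IsIntegral ℤ y := IsIntegral.sum _ fun i _ => (hgi.pow k).pow i
  refine ⟨⟨b * (1 - e) + e, y * (1 - e) + e, ?_, ?_⟩, ⟨?_, ?_⟩, rfl⟩
  · linear_combination (b * y - b - y + 1) * hee - hbye
  · linear_combination (b * y - b - y + 1) * hee - hbye
  · exact (hbi.mul (isIntegral_one.sub hei)).add hei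
  · exact (hyi.mul (isIntegral_one.sub hei)).add hei

/-- The excluded n > 0 are those with at most two residues prime to n. The witnesses are 2 for n
odd, n/2 - 1 if 4 divides n, and n/2 - 2 if n ≡ 2 modulo 4. -/
lemma exists_coprime_lt_half {n : ℕ} (h0 : n ≠ 0) (h1 : n ≠ 1) (h2 : n ≠ 2) (h3 : n ≠ 3)
    (h4 : n ≠ 4) (h6 : n ≠ 6) : ∃ k, 1 < k ∧ 2 * k < n ∧ Nat.Coprime k n := by
  have h : n % 4 = 0 ∨ n % 4 = 1 ∨ n % 4 = 2 ∨ n % 4 = 3 := by omega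
  have odd : n % 2 = 1 → ∃ k, 1 < k ∧ 2 * k < n ∧ Nat.Coprime k n := fun h =>
    ⟨2, by omega, by omega, (Nat.coprime_two_left).mpr (Nat.odd_iff.mpr h)⟩
  rcases h with h | h | h | h
  · obtain ⟨m, rfl⟩ : ∃ m, n = 4 * m := ⟨n / 4, by omega⟩
    obtain ⟨t, rfl⟩ : ∃ t, m = t + 1 := ⟨m - 1, by omega⟩
    refine ⟨2 * t + 1, by omega, by omega, ?_⟩
    have h2 : Nat.Coprime (2 * t + 1) 2 := by simp
    have h3 : 4 * (t + 1) = 2 + 2 * (2 * t + 1) := by ring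
    rw [h3, Nat.coprime_add_mul_right_right]
    exact h2
  · exact odd (by omega)
  · obtain ⟨t, rfl⟩ : ∃ t, n = 4 * t + 6 := ⟨(n - 6) / 4, by omega⟩
    refine ⟨2 * t + 1, by omega, by omega, ?_⟩
    have h2 : Nat.Coprime (2 * t + 1) 4 := by
      rw [show 4 = 2 ^ 2 from rfl]
      exact Nat.Coprime.pow_right 2 (by simp)
    have h3 : 4 * t + 6 = 4 + 2 * (2 * t + 1) := by ring
    rw [h3, Nat.coprime_add_mul_right_right]
    exact h2
  · exact odd (by omega)

/-- The norm equals sin(πk/n) / sin(π/n), and the sine increases up to π/2. -/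
lemma one_lt_norm_geom_sum {n k : ℕ} (hk : 1 < k) (hkn : 2 * k < n) :
    1 < ‖∑ i ∈ Finset.range k, Complex.exp (2 * Real.pi * Complex.I / n) ^ i‖ := by
  have hn : (0 : ℝ) < n := by exact_mod_cast (by omega : 0 < n)
  set ζ := Complex.exp (2 * Real.pi * Complex.I / n) with hζ
  have hnorm : ∀ m : ℕ, ‖ζ ^ m - 1‖ = ‖2 * Real.sin (Real.pi * m / n)‖ := by
    intro m
    have : ζ ^ m = Complex.exp (Complex.I * ((2 * Real.pi * m / n : ℝ) : ℂ)) := by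
      rw [hζ, ← Complex.exp_nat_mul]; congr 1; push_cast; ring
    rw [this, Complex.norm_exp_I_mul_ofReal_sub_one]
    congr 3
    ring
  have hpos : ∀ m : ℕ, 0 < m → 2 * m < n → 0 < Real.sin (Real.pi * m / n) := by
    intro m hm hmn
    have hm' : (0 : ℝ) < m := by exact_mod_cast hm
    apply Real.sin_pos_of_pos_of_lt_pi
    · have := Real.pi_pos; positivity
    · rw [div_lt_iff₀ hn]
      have : (m : ℝ) < n := by exact_mod_cast (by omega : m < n)
      exact mul_lt_mul_of_pos_left this Real.pi_pos
  have h1 := hpos 1 one_pos (by omega)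
  have h2 : Real.sin (Real.pi * (1 : ℕ) / n) < Real.sin (Real.pi * k / n) := by
    apply Real.sin_lt_sin_of_lt_of_le_pi_div_two
    · have h3 : 0 ≤ Real.pi * (1 : ℕ) / n := by have := Real.pi_pos; positivity
      linarith [Real.pi_pos]
    · rw [div_le_iff₀ hn]
      have : (2 : ℝ) * k ≤ n := by exact_mod_cast hkn.le
      nlinarith [Real.pi_pos]
    · have : ((1 : ℕ) : ℝ) < k := by exact_mod_cast hk
      have := Real.pi_pos
      gcongr
  have hgeom := mul_geom_sum ζ k
  have h4 := congrArg norm hgeom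
  rw [norm_mul, hnorm k] at h4
  have h5 := hnorm 1
  rw [pow_one] at h5
  rw [h5, Real.norm_of_nonneg (by linarith), Real.norm_of_nonneg (by linarith)] at h4
  by_contra! hle
  nlinarith

/-! ### Orders of group elements and integral units -/

section Group

open MonoidAlgebra

variable {G : Type*} [Group G]

lemma powAverage_single_pow (n : ℕ) (g : G) (j : ℕ) :
    powAverage n (single (g ^ j) (1 : ℚ)) = powAverage n (single g 1 ^ j) := by
  rw [single_pow, one_pow]

/-- The character sending γ to a primitive root ζ kills the average of γ ^ j, because ζ ^ j ≠ 1. It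
therefore sends the unit to a geometric sum of modulus greater than 1, so the order is infinite.
Triviality of the unit on the fixed part of γ ^ j is kept so that it can be combined with a
nilpotent element in that part. -/
lemma exists_integralUnit_cyclicGroup {n j : ℕ} [NeZero n] (hj : ¬ n ∣ j)
    (h1 : n ≠ 1) (h2 : n ≠ 2) (h3 : n ≠ 3) (h4 : n ≠ 4) (h6 : n ≠ 6)
    {γ : MonoidAlgebra ℚ (CyclicGroup n)} (hγ : γ = single (Multiplicative.ofAdd 1) 1) :
    ∃ u : (MonoidAlgebra ℚ (CyclicGroup n))ˣ, IsIntegralUnit u ∧ (∀ m : ℕ, 0 < m → u ^ m ≠ 1) ∧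
      (u : MonoidAlgebra ℚ (CyclicGroup n)) * powAverage n (γ ^ j) = powAverage n (γ ^ j) := by
  have h0 : n ≠ 0 := NeZero.ne n
  obtain ⟨k, hk1, hkn, hk⟩ := exists_coprime_lt_half h0 h1 h2 h3 h4 h6
  have hγn : γ ^ n = 1 := by
    rw [hγ, single_pow, ← ofAdd_nsmul, one_pow]
    simp [one_def]
  obtain ⟨w, hw, hwe⟩ := exists_cyclotomic_unit (j := j) h0 hk γ hγn
  have hee : powAverage n (γ ^ j) * powAverage n (γ ^ j) = powAverage n (γ ^ j) :=
    powAverage_mul_self h0 (by rw [← pow_mul, mul_comm, pow_mul, hγn, one_pow])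
  refine ⟨w, hw, ?_, ?_⟩
  · intro m hm hwm
    obtain ⟨ζ, hζ, hprim⟩ : ∃ ζ, ζ = Complex.exp (2 * Real.pi * Complex.I / n) ∧
        IsPrimitiveRoot ζ n := ⟨_, rfl, Complex.isPrimitiveRoot_exp n h0⟩
    obtain ⟨χ, hχγ⟩ : ∃ χ : MonoidAlgebra ℚ (CyclicGroup n) →ₐ[ℚ] ℂ, χ γ = ζ :=
      ⟨MonoidAlgebra.lift ℚ ℂ (CyclicGroup n) (cyclicHom n ζ hprim.pow_eq_one), by
        rw [hγ, MonoidAlgebra.lift_single, cyclicHom_ofAdd_one, one_smul]⟩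
    have hχe : χ (powAverage n (γ ^ j)) = 0 := by
      have hne : ζ ^ j ≠ 1 := by
        intro h
        rw [hprim.pow_eq_one_iff_dvd] at h
        exact hj h
      have h7 := mul_powAverage (R := ℂ) (n := n) (h := ζ ^ j)
        (by rw [← pow_mul, mul_comm, pow_mul, hprim.pow_eq_one, one_pow])
      rw [map_powAverage, map_pow, hχγ]
      have : (ζ ^ j - 1) * powAverage n (ζ ^ j) = 0 := by rw [sub_mul, h7, one_mul, sub_self]
      exact (mul_eq_zero.mp this).resolve_left (sub_ne_zero.mpr hne)
    have hχw : χ w = ∑ i ∈ Finset.range k, ζ ^ i := by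
      rw [hwe, map_add, map_mul, map_sub, hχe, map_sum]
      simp [hχγ]
    have h8 : χ w ^ m = 1 := by
      rw [← map_pow, ← Units.val_pow_eq_pow_val, hwm, Units.val_one, map_one]
    have h9 := one_lt_norm_geom_sum hk1 hkn
    rw [← hζ, ← hχw] at h9
    have h10 := congrArg norm h8
    rw [norm_pow, norm_one] at h10
    exact absurd h10 (one_lt_pow₀ h9 hm.ne').ne'
  · rw [hwe]
    generalize powAverage n (γ ^ j) = e at hee
    linear_combination (1 - ∑ i ∈ Finset.range k, γ ^ i) * hee

/-- An element of order other than `1, 2, 3, 4, 6` yields an integral unit of infinite order. -/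
theorem exists_integralUnit_of_orderOf {g : G} {n j : ℕ} (hn : orderOf g = n) (hj : g ^ j ≠ 1)
    (h0 : n ≠ 0) (h1 : n ≠ 1) (h2 : n ≠ 2) (h3 : n ≠ 3) (h4 : n ≠ 4) (h6 : n ≠ 6) :
    ∃ u : (MonoidAlgebra ℚ G)ˣ, IsIntegralUnit u ∧ (∀ m : ℕ, 0 < m → u ^ m ≠ 1) ∧
      (u : MonoidAlgebra ℚ G) * powAverage n (single (g ^ j) 1) =
        powAverage n (single (g ^ j) 1) ∧
      powAverage n (single (g ^ j) 1) * (u : MonoidAlgebra ℚ G) =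
        powAverage n (single (g ^ j) 1) := by
  have : NeZero n := ⟨h0⟩
  obtain ⟨γ, hγ⟩ : ∃ γ : MonoidAlgebra ℚ (CyclicGroup n), γ = single (Multiplicative.ofAdd 1) 1 :=
    ⟨_, rfl⟩
  have hj' : ¬ n ∣ j := fun h => hj (orderOf_dvd_iff_pow_eq_one.mp (hn ▸ h))
  obtain ⟨w, hw, hinf, hwe⟩ := exists_integralUnit_cyclicGroup hj' h1 h2 h3 h4 h6 hγ
  obtain ⟨Ψ, hΨinj, hΨγ⟩ : ∃ Ψ : MonoidAlgebra ℚ (CyclicGroup n) →ₐ[ℚ] MonoidAlgebra ℚ G,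
      Function.Injective Ψ ∧ Ψ γ = single g 1 :=
    ⟨mapDomainAlgHom ℚ ℚ (cyclicHom n g (hn ▸ pow_orderOf_eq_one g)),
      mapDomain_injective (cyclicHom_injective hn), by
        rw [hγ]
        exact mapDomain_single.trans (by rw [cyclicHom_ofAdd_one])⟩
  have hΨe : Ψ (powAverage n (γ ^ j)) = powAverage n (single (g ^ j) 1) := by
    rw [map_powAverage, map_pow, hΨγ, powAverage_single_pow]
  have hcoe : ((Units.map (Ψ.toRingHom : _ →* _) w : (MonoidAlgebra ℚ G)ˣ) : MonoidAlgebra ℚ G) =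
    Ψ w := rfl
  refine ⟨Units.map (Ψ.toRingHom : _ →* _) w, hw.map Ψ.toRingHom, ?_, ?_, ?_⟩
  · intro m hm hum
    refine hinf m hm (Units.map_injective
      (f := (Ψ.toRingHom : MonoidAlgebra ℚ (CyclicGroup n) →* MonoidAlgebra ℚ G)) hΨinj ?_)
    rw [map_pow, hum, map_one]
  · rw [hcoe, ← hΨe, ← map_mul, hwe]
  · rw [hcoe, ← hΨe, ← map_mul, mul_comm, hwe]

lemma HasTorsionUnits.orderOf_mem (h : HasTorsionUnits (MonoidAlgebra ℚ G)) [Finite G] (g : G) :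
    orderOf g ∈ ({1, 2, 3, 4, 6} : Set ℕ) := by
  by_contra hcon
  simp only [Set.mem_insert_iff, Set.mem_singleton_iff, not_or] at hcon
  obtain ⟨h1, h2, h3, h4, h6⟩ := hcon
  obtain ⟨u, hu, hinf, -⟩ := exists_integralUnit_of_orderOf (g := g) (j := 1) rfl
    (by rw [pow_one]; exact fun h => h1 (orderOf_eq_one_iff.mpr h)) (orderOf_pos g).ne' h1 h2 h3 h4
    h6
  obtain ⟨k, hk, hk1⟩ := h u hu
  exact hinf k hk hk1

instance MonoidAlgebra.instIsAddTorsionFreeRat (M : Type*) : IsAddTorsionFree (MonoidAlgebra ℚ M) :=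
  IsAddTorsionFree.of_module_rat _

/-- If `x` is a nonzero element of square zero fixed by a nontrivial power of `g`, the order of `g`
is one of `1, 2, 3, 4, 6`. -/
lemma HasRankOneUnits.orderOf_mem (h : HasRankOneUnits (MonoidAlgebra ℚ G)) [Finite G] {g : G}
    {j : ℕ} (hj : g ^ j ≠ 1) {x : MonoidAlgebra ℚ G} (hx : x * x = 0) (hx0 : x ≠ 0)
    (hgx : single (g ^ j) 1 * x = x) (hxg : x * single (g ^ j) 1 = x) :
    orderOf g ∈ ({1, 2, 3, 4, 6} : Set ℕ) := by
  by_contra hcon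
  simp only [Set.mem_insert_iff, Set.mem_singleton_iff, not_or] at hcon
  obtain ⟨h1, h2, h3, h4, h6⟩ := hcon
  have h0 : orderOf g ≠ 0 := (orderOf_pos g).ne'
  obtain ⟨u, hu, hinf, hue, heu⟩ := exists_integralUnit_of_orderOf rfl hj h0 h1 h2 h3 h4 h6
  obtain ⟨k, hk, hk1⟩ := h.exists_pow_eq_one hx hx0 (powAverage_mul_of_mul_eq h0 hgx)
    (mul_powAverage_of_mul_eq h0 hxg) hu hue heu
  exact hinf k hk hk1

end Group


/-! ### Cyclic subgroups that are not normal -/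

section NonNormal

open MonoidAlgebra

variable {G : Type*} [Group G]

lemma zpowers_normal_iff {g : G} :
    (Subgroup.zpowers g).Normal ↔ ∀ x : G, x⁻¹ * g * x ∈ Subgroup.zpowers g := by
  constructor
  · intro h x
    simpa using h.conj_mem g (Subgroup.mem_zpowers g) x⁻¹
  · intro h
    refine ⟨fun n hn x => ?_⟩
    obtain ⟨k, rfl⟩ := Subgroup.mem_zpowers_iff.mp hn
    rw [← conj_zpow]
    exact Subgroup.zpow_mem _ (by simpa using h x⁻¹) k

/-- The sum of the elements of a subgroup. -/
noncomputable def subgroupSum [Finite G] (L : Subgroup G) : MonoidAlgebra ℚ G :=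
  .ofCoeff (Finsupp.equivFunOnFinite.symm (Set.indicator (L : Set G) 1))

lemma coeff_subgroupSum [Finite G] (L : Subgroup G) [DecidablePred (· ∈ L)] (y : G) :
    (subgroupSum L).coeff y = if y ∈ L then 1 else 0 := by
  simp [subgroupSum, Set.indicator_apply]

lemma single_mul_subgroupSum [Finite G] {L : Subgroup G} {l : G} (hl : l ∈ L) :
    single l 1 * subgroupSum L = subgroupSum L := by
  classical
  ext y
  rw [coeff_single_mul_apply, one_mul, coeff_subgroupSum, coeff_subgroupSum]
  simp [Subgroup.mul_mem_cancel_left L (L.inv_mem hl)]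

lemma subgroupSum_mul_single [Finite G] {L : Subgroup G} {l : G} (hl : l ∈ L) :
    subgroupSum L * single l 1 = subgroupSum L := by
  classical
  ext y
  rw [coeff_mul_single_apply, mul_one, coeff_subgroupSum, coeff_subgroupSum]
  simp [Subgroup.mul_mem_cancel_right L (L.inv_mem hl)]

/-- The element `(1 - g) x ĝ` of square zero, where `ĝ` is the sum of the powers of `g`. -/
noncomputable def bicyclicElement [Finite G] (g x : G) : MonoidAlgebra ℚ G :=
  (single x 1 - single (g * x) 1) * subgroupSum (Subgroup.zpowers g)

variable [Finite G]

/-- The factor ĝ (1 - g) = 0 appears in the middle. -/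
lemma bicyclicElement_mul (g x y : G) : bicyclicElement g x * bicyclicElement g y = 0 := by
  have h1 : single (g * y) (1 : ℚ) = single g 1 * single y 1 := by simp [single_mul_single]
  have h2 : subgroupSum (Subgroup.zpowers g) * (single y 1 - single (g * y) 1) = 0 := by
    rw [h1, mul_sub, ← mul_assoc, subgroupSum_mul_single (Subgroup.mem_zpowers g), sub_self]
  rw [bicyclicElement, bicyclicElement, mul_assoc, ← mul_assoc (subgroupSum _), h2, zero_mul,
    mul_zero]

open Classical in
lemma coeff_bicyclicElement (g x y : G) : (bicyclicElement g x).coeff y =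
    (if x⁻¹ * y ∈ Subgroup.zpowers g then 1 else 0) -
      (if x⁻¹ * g⁻¹ * y ∈ Subgroup.zpowers g then 1 else 0) := by
  rw [bicyclicElement, sub_mul, coeff_sub, Finsupp.sub_apply, coeff_single_mul_apply,
    coeff_single_mul_apply, one_mul, one_mul, coeff_subgroupSum, coeff_subgroupSum, mul_inv_rev]

lemma coeff_bicyclicElement_self {g x : G} (hx : x⁻¹ * g * x ∉ Subgroup.zpowers g) :
    (bicyclicElement g x).coeff x = 1 := by
  classical
  have : x⁻¹ * g⁻¹ * x ∉ Subgroup.zpowers g := by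
    intro h
    apply hx
    have := Subgroup.inv_mem _ h
    simpa [mul_assoc] using this
  rw [coeff_bicyclicElement, if_neg this]
  simp

lemma bicyclicElement_ne_zero {g x : G} (hx : x⁻¹ * g * x ∉ Subgroup.zpowers g) :
    bicyclicElement g x ≠ 0 := by
  intro h
  have := coeff_bicyclicElement_self hx
  rw [h] at this
  simp at this

/-- Elements built from the same g have zero products, so by rank one they are proportional. Since y
is in the support of the second one, it lies in the support of the first, contained in x⟨g⟩ ∪ gx⟨g⟩.
-/
lemma HasRankOneUnits.mem_zpowers_or (h : HasRankOneUnits (MonoidAlgebra ℚ G)) {g x y : G}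
    (hx : x⁻¹ * g * x ∉ Subgroup.zpowers g) (hy : y⁻¹ * g * y ∉ Subgroup.zpowers g) :
    x⁻¹ * y ∈ Subgroup.zpowers g ∨ x⁻¹ * g⁻¹ * y ∈ Subgroup.zpowers g := by
  classical
  obtain ⟨m, n, hmn, hrel⟩ := h.exists_smul_add_smul_eq_zero (bicyclicElement_mul g x x)
    (bicyclicElement_mul g y y) (bicyclicElement_mul g x y) (bicyclicElement_mul g y x)
  rw [← Int.cast_smul_eq_zsmul ℚ, ← Int.cast_smul_eq_zsmul ℚ] at hrel
  by_contra! hcon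
  have h0 : (bicyclicElement g x).coeff y = 0 := by
    rw [coeff_bicyclicElement, if_neg hcon.1, if_neg hcon.2, sub_zero]
  have hn : n = 0 := by
    have := congrArg (fun z : MonoidAlgebra ℚ G => z.coeff y) hrel
    simpa [h0, coeff_bicyclicElement_self hy] using this
  rw [hn, Int.cast_zero, zero_smul, add_zero] at hrel
  have hm : m = 0 := by
    have := congrArg (fun z : MonoidAlgebra ℚ G => z.coeff x) hrel
    simpa [coeff_bicyclicElement_self hx] using this
  omega

/-- If x does not normalise ⟨g⟩, neither does g²x, so g²x lies in x⟨g⟩ or in gx⟨g⟩. The first is the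
claim and the second would put x⁻¹gx into ⟨g⟩. -/
lemma HasRankOneUnits.conj_sq_mem_zpowers (h : HasRankOneUnits (MonoidAlgebra ℚ G)) (g x : G) :
    x⁻¹ * g ^ 2 * x ∈ Subgroup.zpowers g := by
  by_cases hx : x⁻¹ * g * x ∈ Subgroup.zpowers g
  · have := Subgroup.pow_mem _ hx 2
    have e : (x⁻¹ * g * x) ^ 2 = x⁻¹ * g ^ 2 * x := by simpa using conj_pow (a := x⁻¹) (b := g) (i := 2)
    rwa [e] at this
  · have hy : (g ^ 2 * x)⁻¹ * g * (g ^ 2 * x) ∉ Subgroup.zpowers g := by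
      have : (g ^ 2 * x)⁻¹ * g * (g ^ 2 * x) = x⁻¹ * g * x := by group
      rwa [this]
    rcases h.mem_zpowers_or hx hy with h1 | h1
    · simpa [mul_assoc] using h1
    · refine absurd ?_ hx
      have : x⁻¹ * g⁻¹ * (g ^ 2 * x) = x⁻¹ * g * x := by group
      rwa [this] at h1

/-- Moving g² to the right past an element of the group conjugates it into ⟨g⟩, where ĝ absorbs it.
This makes `orderOf_mem` applicable with the power g². -/
lemma bicyclicElement_fixed (h : HasRankOneUnits (MonoidAlgebra ℚ G)) (g x : G) :
    single (g ^ 2) 1 * bicyclicElement g x = bicyclicElement g x ∧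
      bicyclicElement g x * single (g ^ 2) 1 = bicyclicElement g x := by
  constructor
  · have h1 : ∀ y : G, g ^ 2 * y = y * (y⁻¹ * g ^ 2 * y) := fun y => by group
    rw [bicyclicElement, ← mul_assoc, mul_sub, single_mul_single, single_mul_single, h1 x,
      h1 (g * x), sub_mul, sub_mul]
    have key : ∀ y : G, single (y * (y⁻¹ * g ^ 2 * y)) (1 * 1 : ℚ) *
        subgroupSum (Subgroup.zpowers g) = single y 1 * subgroupSum (Subgroup.zpowers g) := by
      intro y
      rw [← single_mul_single, mul_assoc, single_mul_subgroupSum (h.conj_sq_mem_zpowers g y)]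
    rw [key, key]
  · rw [bicyclicElement, mul_assoc,
      subgroupSum_mul_single (Subgroup.pow_mem _ (Subgroup.mem_zpowers g) 2)]

lemma HasRankOneUnits.zpowers_normal_of_odd (h : HasRankOneUnits (MonoidAlgebra ℚ G)) {g : G}
    (hg : Odd (orderOf g)) : (Subgroup.zpowers g).Normal := by
  rw [zpowers_normal_iff]
  intro x
  obtain ⟨k, hk⟩ := hg
  have e : g = (g ^ 2) ^ (k + 1) := by
    rw [← pow_mul, show 2 * (k + 1) = orderOf g + 1 by omega, pow_succ, pow_orderOf_eq_one, one_mul]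
  have e2 : x⁻¹ * g * x = (x⁻¹ * g ^ 2 * x) ^ (k + 1) := by
    have := conj_pow (a := x⁻¹) (b := g ^ 2) (i := k + 1)
    rw [inv_inv] at this
    rw [this, ← e]
  rw [e2]
  exact Subgroup.pow_mem _ (h.conj_sq_mem_zpowers g x) _

/-- A cyclic subgroup that is not normal has index `3` or `4`. -/
lemma HasRankOneUnits.index_zpowers (h : HasRankOneUnits (MonoidAlgebra ℚ G)) {g : G}
    (hg : ¬ (Subgroup.zpowers g).Normal) :
    Nat.card G = 3 * orderOf g ∨ Nat.card G = 4 * orderOf g := by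
  rw [zpowers_normal_iff] at hg
  push Not at hg
  obtain ⟨x, hx⟩ := hg
  set L := Subgroup.zpowers g with hL
  set N := Subgroup.normalizer (L : Set G) with hN
  have hmem : ∀ y, y ∈ N ↔ y⁻¹ * g * y ∈ L := by
    intro y
    constructor
    · intro hy
      have := (Subgroup.mem_normalizer_iff.mp (N.inv_mem hy) g).mp (Subgroup.mem_zpowers g)
      simpa using this
    · intro hy
      have hle : L.map (MulAut.conj y⁻¹).toMonoidHom ≤ L := by
        rw [hL, MonoidHom.map_zpowers, Subgroup.zpowers_le]
        simpa using hy
      have heq : L.map (MulAut.conj y⁻¹).toMonoidHom = L := by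
        apply Subgroup.eq_of_le_of_card_ge hle
        rw [Subgroup.card_map_of_injective (MulAut.conj y⁻¹).injective]
      rw [← N.inv_mem_iff, Subgroup.mem_normalizer_iff]
      intro z
      constructor
      · intro hz
        rw [← heq]
        exact ⟨z, hz, by simp⟩
      · intro hz
        rw [← heq] at hz
        obtain ⟨w, hw, hwz⟩ := hz
        have : w = z := by simpa using hwz
        rwa [← this]
  -- By `mem_zpowers_or` the elements outside the normalizer fill exactly two left cosets of ⟨g⟩.
  have hcompl : (N : Set G)ᶜ = (fun l => x * l) '' (L : Set G) ∪ (fun l => g * x * l) '' (L : Set G) := by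
    ext y
    constructor
    · intro hy
      have hy' : y⁻¹ * g * y ∉ L := fun h => hy ((hmem y).mpr h)
      rcases h.mem_zpowers_or hx hy' with h1 | h1
      · exact Or.inl ⟨_, h1, by simp⟩
      · exact Or.inr ⟨_, h1, by simp [mul_assoc]⟩
    · have key : ∀ z : G, z⁻¹ * g * z ∉ L → ∀ l ∈ L, z * l ∉ N := by
        intro z hz l hl hzl
        rw [hmem] at hzl
        apply hz
        have := L.mul_mem (L.mul_mem hl hzl) (L.inv_mem hl)
        convert this using 1
        group
      rintro (⟨l, hl, rfl⟩ | ⟨l, hl, rfl⟩)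
      · exact key x hx l hl
      · refine key (g * x) ?_ l hl
        convert hx using 1
        group
  have hdisj : Disjoint ((fun l => x * l) '' (L : Set G)) ((fun l => g * x * l) '' (L : Set G)) := by
    rw [Set.disjoint_left]
    rintro _ ⟨l, hl, rfl⟩ ⟨l', hl', he⟩
    apply hx
    have : x⁻¹ * g * x = l * l'⁻¹ := by
      have he' : g * x * l' = x * l := he
      rw [eq_mul_inv_iff_mul_eq, mul_assoc x⁻¹, mul_assoc x⁻¹, he']
      group
    rw [this]
    exact L.mul_mem hl (L.inv_mem hl')
  have hcard : Nat.card G = Nat.card N + 2 * Nat.card L := by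
    have h1 := Set.ncard_add_ncard_compl (N : Set G)
    rw [hcompl, Set.ncard_union_eq hdisj, Set.ncard_image_of_injective _ (mul_right_injective x),
      Set.ncard_image_of_injective _ (mul_right_injective (g * x))] at h1
    have e1 : (N : Set G).ncard = Nat.card N := rfl
    have e2 : (L : Set G).ncard = Nat.card L := rfl
    omega
  have hLN : L ≤ N := Subgroup.le_normalizer
  have hLcard : Nat.card L = orderOf g := Nat.card_zpowers g
  have hpos : 0 < orderOf g := orderOf_pos g
  obtain ⟨r, hr⟩ := Subgroup.card_dvd_of_le hLN
  obtain ⟨s, hs⟩ := N.card_subgroup_dvd_card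
  rw [hr, hLcard] at hs hcard
  -- With r = |N : L| and s = |G : N|. Hence r divides 2, and the index rs = r + 2 is 3 or 4.
  have h2 : r * s = r + 2 := by
    apply Nat.eq_of_mul_eq_mul_left hpos
    rw [← mul_assoc, ← hs, hcard]
    ring
  have h3 : r ∣ 2 := by
    have : r ∣ r + 2 := ⟨s, h2.symm⟩
    exact (Nat.dvd_add_right (dvd_refl r)).mp this
  have h4 : r ≤ 2 := Nat.le_of_dvd two_pos h3
  have h5 : r ≠ 0 := by rintro rfl; simp at h3
  rw [hcard]
  rcases (show r = 1 ∨ r = 2 by omega) with rfl | rfl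
  · exact Or.inl (by ring)
  · exact Or.inr (by ring)

lemma HasRankOneUnits.orderOf_of_not_normal (h : HasRankOneUnits (MonoidAlgebra ℚ G)) {g : G}
    (hg : ¬ (Subgroup.zpowers g).Normal) : orderOf g = 2 ∨ orderOf g = 4 := by
  have heven : ¬ Odd (orderOf g) := fun ho => hg (h.zpowers_normal_of_odd ho)
  have hmem : orderOf g ∈ ({1, 2, 3, 4, 6} : Set ℕ) := by
    obtain ⟨x, hx⟩ : ∃ x : G, x⁻¹ * g * x ∉ Subgroup.zpowers g := by
      rw [zpowers_normal_iff] at hg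
      push Not at hg
      exact hg
    by_cases h2 : g ^ 2 = 1
    · have := orderOf_dvd_of_pow_eq_one h2
      rcases (Nat.dvd_prime Nat.prime_two).mp this with h | h <;> simp [h]
    · obtain ⟨h3, h4⟩ := bicyclicElement_fixed h g x
      exact h.orderOf_mem h2 (bicyclicElement_mul g x x) (bicyclicElement_ne_zero hx) h3 h4
  simp only [Set.mem_insert_iff, Set.mem_singleton_iff] at hmem
  rcases hmem with h1 | h1 | h1 | h1 | h1
  · exact absurd (by rw [h1]; exact odd_one) heven
  · exact Or.inl h1
  · exact absurd (by rw [h1]; decide) heven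
  · exact Or.inr h1
  -- Order 6: if ⟨g⟩ is not normal then neither is ⟨g³⟩, of order 2, since conjugates of g² stay in
  -- ⟨g⟩. The group would have 18 or 24 elements and also 6 or 8.
  · exfalso
    have hn3 : ¬ (Subgroup.zpowers (g ^ 3)).Normal := by
      intro hn
      apply hg
      rw [zpowers_normal_iff] at hn ⊢
      intro x
      have e : x⁻¹ * g * x = (x⁻¹ * g ^ 3 * x) * (x⁻¹ * g ^ 2 * x)⁻¹ := by group
      rw [e]
      refine Subgroup.mul_mem _ ?_ (Subgroup.inv_mem _ (h.conj_sq_mem_zpowers g x))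
      exact (Subgroup.zpowers_le.mpr (Subgroup.pow_mem _ (Subgroup.mem_zpowers g) 3)) (hn x)
    have h3 : orderOf (g ^ 3) = 2 := by rw [orderOf_pow, h1]; rfl
    have e1 := h.index_zpowers hg
    have e2 := h.index_zpowers hn3
    rw [h1] at e1
    rw [h3] at e2
    omega

end NonNormal


/-! ### Finite groups all of whose cyclic subgroups are normal -/

section Dedekind

variable {G : Type*} [Group G]

lemma commute_of_mem_zpowers {g z : G} (hz : z ∈ Subgroup.zpowers g) : Commute z g := by
  obtain ⟨k, rfl⟩ := Subgroup.mem_zpowers_iff.mp hz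
  exact (Commute.refl g).zpow_left k

/-- Either ⟨z⟩ and ⟨h⟩ are normal subgroups with trivial intersection, or ⟨z⟩, being of prime order,
lies in ⟨h⟩. -/
lemma commute_of_orderOf_prime (hD : ∀ g : G, (Subgroup.zpowers g).Normal) {z : G}
    (hz : (orderOf z).Prime) (h : G) : Commute z h := by
  by_cases hd : Disjoint (Subgroup.zpowers z) (Subgroup.zpowers h)
  · exact Subgroup.commute_of_normal_of_disjoint _ _ (hD z) (hD h) hd z h
      (Subgroup.mem_zpowers z) (Subgroup.mem_zpowers h)
  · have hfact := Fact.mk hz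
    have hle : Subgroup.zpowers z ≤ Subgroup.zpowers h := by
      have hcard : (Nat.card (Subgroup.zpowers z)).Prime := by rwa [Nat.card_zpowers]
      have := Fact.mk hcard
      rcases ((Subgroup.zpowers h).subgroupOf (Subgroup.zpowers z)).eq_bot_or_eq_top_of_prime_card
        with h1 | h1
      · exact absurd (Subgroup.subgroupOf_eq_bot.mp h1).symm hd
      · exact Subgroup.subgroupOf_eq_top.mp h1
    exact commute_of_mem_zpowers (hle (Subgroup.mem_zpowers z))

lemma commute_of_sq_eq_one (hD : ∀ g : G, (Subgroup.zpowers g).Normal) {z : G}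
    (hz : z ^ 2 = 1) (h : G) : Commute z h := by
  by_cases h1 : z = 1
  · rw [h1]; exact Commute.one_left h
  · exact commute_of_orderOf_prime hD (by rw [orderOf_eq_prime hz h1]; exact Nat.prime_two) h

lemma commute_of_pow_three_eq_one (hD : ∀ g : G, (Subgroup.zpowers g).Normal) {z : G}
    (hz : z ^ 3 = 1) (h : G) : Commute z h := by
  by_cases h1 : z = 1
  · rw [h1]; exact Commute.one_left h
  · exact commute_of_orderOf_prime hD (by rw [orderOf_eq_prime hz h1]; exact Nat.prime_three) h

lemma commute_of_pow_six (hD : ∀ g : G, (Subgroup.zpowers g).Normal) (h6 : ∀ g : G, g ^ 6 = 1)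
    (a b : G) : Commute a b := by
  have e : a = a ^ 3 * (a ^ 2)⁻¹ := by group
  rw [e]
  refine Commute.mul_left (commute_of_sq_eq_one hD ?_ b)
    (commute_of_pow_three_eq_one hD ?_ b).inv_left
  · rw [← pow_mul]; exact h6 a
  · rw [← pow_mul]; exact h6 a

/-- A cyclic 2-group has a single involution. -/
lemma eq_pow_of_sq_eq_one {a c : G} {s : ℕ} (ha : a ^ 2 ^ (s + 1) = 1) (ha' : a ^ 2 ^ s ≠ 1)
    (hc : c ∈ Subgroup.zpowers a) (hc2 : c ^ 2 = 1) (hc1 : c ≠ 1) : c = a ^ 2 ^ s := by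
  have := Fact.mk Nat.prime_two
  have hord : orderOf a = 2 ^ (s + 1) := orderOf_eq_prime_pow ha' ha
  obtain ⟨k, rfl⟩ := Subgroup.mem_zpowers_iff.mp hc
  have h1 : a ^ (k * 2) = 1 := by rw [zpow_mul]; exact_mod_cast hc2
  rw [← orderOf_dvd_iff_zpow_eq_one, hord, pow_succ] at h1
  push_cast at h1
  obtain ⟨m, rfl⟩ := Int.dvd_of_mul_dvd_mul_right two_ne_zero h1
  have h2 : a ^ ((2 : ℤ) ^ s) = a ^ 2 ^ s := by exact_mod_cast zpow_natCast a (2 ^ s)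
  have h3 : (a ^ 2 ^ s) ^ 2 = 1 := by rw [← pow_mul, ← pow_succ, ha]
  rw [zpow_mul, h2] at hc1 ⊢
  rcases Int.even_or_odd' m with ⟨r, rfl | rfl⟩
  · rw [zpow_mul] at hc1
    exact absurd (by rw [zpow_ofNat, h3, one_zpow]) hc1
  · rw [zpow_add, zpow_mul, zpow_ofNat, h3, one_zpow, one_mul, zpow_one]

lemma mem_zpowers_of_sq_ne_one {b c : G} (hb : b ^ 4 = 1) (hc : c ∈ Subgroup.zpowers b)
    (hc2 : c ^ 2 ≠ 1) : b ∈ Subgroup.zpowers c := by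
  obtain ⟨k, rfl⟩ := Subgroup.mem_zpowers_iff.mp hc
  have hb' : b ^ (4 : ℤ) = 1 := by exact_mod_cast hb
  rcases Int.even_or_odd' k with ⟨r, rfl | rfl⟩
  · exfalso
    apply hc2
    rw [← zpow_ofNat, ← zpow_mul, show 2 * r * (2 : ℤ) = 4 * r by ring, zpow_mul,
      hb', one_zpow]
  · refine ⟨2 * r + 1, ?_⟩
    show (b ^ (2 * r + 1)) ^ (2 * r + 1) = b
    rw [← zpow_mul, show (2 * r + 1) * (2 * r + 1) = 4 * (r * r + r) + 1 by ring, zpow_add,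
      zpow_mul, hb', one_zpow, one_mul, zpow_one]

/-- If `b x = d x b` with `d² = 1` and `d` commuting with `b`, `x`, then powers of `x b` split. -/
lemma mul_pow_two_mul {x b d : G} (hd : Commute d x) (hd' : Commute d b) (hbx : b * x = d * x * b)
    (hd2 : d ^ 2 = 1) (k : ℕ) : (x * b) ^ (2 * k) = d ^ k * x ^ (2 * k) * b ^ (2 * k) := by
  have h1 : (x * b) ^ 2 = d * x ^ 2 * b ^ 2 := by
    calc (x * b) ^ 2 = x * (b * x) * b := by rw [pow_two]; group
      _ = (x * d) * x * b * b := by rw [hbx]; group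
      _ = d * x ^ 2 * b ^ 2 := by rw [← hd.eq]; simp only [pow_two, mul_assoc]
  have h2 : Commute (x ^ 2) b := by
    have h3 : b * x * x = x * x * b := by
      calc b * x * x = d * x * (b * x) := by conv_lhs => rw [hbx, mul_assoc]
        _ = d * (x * d) * x * b := by rw [hbx]; simp only [mul_assoc]
        _ = d ^ 2 * x * x * b := by rw [← hd.eq, pow_two]; simp only [mul_assoc]
        _ = x * x * b := by rw [hd2, one_mul]
    show x ^ 2 * b = b * x ^ 2
    rw [pow_two, ← h3, mul_assoc]
  rw [pow_mul, h1, (Commute.mul_left (hd'.pow_right 2) (h2.pow_right 2)).mul_pow,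
    (hd.pow_right 2).mul_pow, ← pow_mul, ← pow_mul]

/-- Induction on the exponents of the orders, as in Dedekind's theorem. The commutator c lies in ⟨a⟩
∩ ⟨b⟩ and turns out to be their common involution. If a had order above 4, a suitable a ^ 2 ^ r * b
would have smaller order than b and still not commute with a. -/
lemma pow_four_of_not_commute_aux (hD : ∀ g : G, (Subgroup.zpowers g).Normal) (N : ℕ) :
    ∀ s t : ℕ, s + t ≤ N → t ≤ s → ∀ a b : G, a ^ 2 ^ s = 1 → b ^ 2 ^ t = 1 → ¬ Commute a b →
      a ^ 4 = 1 ∧ b ^ 4 = 1 := by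
  induction N with
  | zero =>
    intro s t hst hts a b ha hb hab
    obtain ⟨rfl, rfl⟩ : s = 0 ∧ t = 0 := by omega
    rw [pow_zero, pow_one] at ha
    exact absurd (by rw [ha]; exact Commute.one_left b) hab
  | succ N ih =>
    have ih' : ∀ s t : ℕ, s + t ≤ N → ∀ a b : G, a ^ 2 ^ s = 1 → b ^ 2 ^ t = 1 → ¬ Commute a b →
        a ^ 4 = 1 ∧ b ^ 4 = 1 := by
      intro s t hst a b ha hb hab
      rcases le_total t s with h | h
      · exact ih s t hst h a b ha hb hab
      · exact (ih t s (by omega) h b a hb ha (fun h => hab h.symm)).symm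
    intro s t hst hts a b ha hb hab
    have ht2 : 2 ≤ t := by
      by_contra! hlt
      apply hab
      refine (commute_of_sq_eq_one hD ?_ a).symm
      obtain rfl | rfl : t = 0 ∨ t = 1 := by omega
      · rw [pow_zero, pow_one] at hb; rw [hb, one_pow]
      · simpa using hb
    obtain ⟨t, rfl⟩ := Nat.exists_eq_add_of_le' ht2
    obtain ⟨s, rfl⟩ := Nat.exists_eq_add_of_le' (ht2.trans hts)
    by_cases hs0 : s = 0
    · obtain rfl : t = 0 := by omega
      subst hs0
      exact ⟨ha, hb⟩
    by_cases ha' : a ^ 2 ^ (s + 1) = 1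
    · exact ih' _ _ (by omega) a b ha' hb hab
    by_cases hb' : b ^ 2 ^ (t + 1) = 1
    · exact ih' _ _ (by omega) a b ha hb' hab
    exfalso
    obtain ⟨c, hc⟩ : ∃ c, c = a * b * a⁻¹ * b⁻¹ := ⟨_, rfl⟩
    have hca : c ∈ Subgroup.zpowers a := by
      rw [hc, mul_assoc, mul_assoc]
      refine Subgroup.mul_mem _ (Subgroup.mem_zpowers a) ?_
      rw [← mul_assoc]
      exact (hD a).conj_mem _ (Subgroup.inv_mem _ (Subgroup.mem_zpowers a)) b
    have hcb : c ∈ Subgroup.zpowers b := by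
      rw [hc]
      exact Subgroup.mul_mem _ ((hD b).conj_mem _ (Subgroup.mem_zpowers b) a)
        (Subgroup.inv_mem _ (Subgroup.mem_zpowers b))
    have hc1 : c ≠ 1 := by
      intro h
      apply hab
      rw [h] at hc
      show a * b = b * a
      rw [eq_comm, mul_inv_eq_one, mul_inv_eq_iff_eq_mul] at hc
      exact hc
    have hcca := commute_of_mem_zpowers hca
    have hccb := commute_of_mem_zpowers hcb
    have hrel : a * b = c * b * a := by rw [hc]; group
    -- Otherwise a² and b do not commute either, so b ^ 4 = 1 by induction. Then c, whose square is
    -- not 1, generates ⟨b⟩, and b lies in ⟨a⟩.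
    have hc2 : c ^ 2 = 1 := by
      by_contra h
      have hna : ¬ Commute (a ^ 2) b := by
        intro h1
        apply h
        have h2 : a ^ 2 * b = c ^ 2 * (b * a ^ 2) := by
          calc a ^ 2 * b = a * (a * b) := by rw [pow_two, mul_assoc]
            _ = (a * c) * (b * a) := by rw [hrel]; group
            _ = c * (a * b) * a := by rw [← hcca.eq]; group
            _ = c ^ 2 * (b * a ^ 2) := by rw [hrel, pow_two, pow_two]; simp only [mul_assoc]
        rw [h1.eq] at h2
        simpa using h2.symm
      have h4 := (ih' (s + 1) (t + 2) (by omega) (a ^ 2) b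
        (by rw [← pow_mul, ← pow_succ']; exact ha) hb hna).2
      have hbc := mem_zpowers_of_sq_ne_one h4 hcb h
      exact hab (commute_of_mem_zpowers ((Subgroup.zpowers_le.mpr hca) hbc)).symm
    have hea := eq_pow_of_sq_eq_one ha ha' hca hc2 hc1
    have heb := eq_pow_of_sq_eq_one hb hb' hcb hc2 hc1
    obtain ⟨r, rfl⟩ := Nat.exists_eq_add_of_le (show t ≤ s by omega)
    have hbx : ∀ k : ℕ, b * a ^ k = c ^ k * a ^ k * b := by
      intro k
      induction k with
      | zero => simp
      | succ k ihk =>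
        have h1 : b * a = c * a * b := by
          have : c * (c * b * a) = b * a := by
            rw [mul_assoc, ← mul_assoc c c, ← pow_two, hc2, one_mul]
          rw [mul_assoc, hrel, this]
        calc b * a ^ (k + 1) = (b * a ^ k) * a := by rw [pow_succ, mul_assoc]
          _ = c ^ k * a ^ k * (b * a) := by rw [ihk, mul_assoc]
          _ = c ^ k * (a ^ k * c) * a * b := by rw [h1]; group
          _ = c ^ (k + 1) * a ^ (k + 1) * b := by
            rw [← (hcca.pow_right k).eq]; group
    -- The power is c ^ (2 ^ (r + t)) times a ^ (2 ^ (t + r + 1)) times b ^ (2 ^ (t + 1)). The last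
    -- two factors are both c and cancel. The first is trivial only because r + t > 0; for elements
    -- of order 4 this breaks down, as in the quaternion group.
    have hlast : (a ^ 2 ^ r * b) ^ 2 ^ (t + 1) = 1 := by
      have h := mul_pow_two_mul (x := a ^ 2 ^ r) (b := b) (d := c ^ 2 ^ r)
        (hcca.pow_pow _ _) (hccb.pow_left _) (hbx _) (by rw [← pow_mul, mul_comm, pow_mul, hc2, one_pow]) (2 ^ t)
      rw [pow_succ', h, ← pow_succ', ← heb, ← pow_mul, ← pow_mul, ← pow_add, ← pow_add]
      have h3 : r + (t + 1) = t + r + 1 := by ring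
      rw [h3, ← hea]
      obtain ⟨q, hq⟩ := Nat.exists_eq_succ_of_ne_zero (show r + t ≠ 0 by omega)
      rw [hq, pow_succ', pow_mul, hc2, one_pow, one_mul, ← pow_two, hc2]
    have hfin := (ih' (t + r + 2) (t + 1) (by omega) a (a ^ 2 ^ r * b) ha hlast (by
      intro h1
      apply hab
      have h2 : Commute a ((a ^ 2 ^ r)⁻¹ * (a ^ 2 ^ r * b)) :=
        Commute.mul_right (((Commute.refl a).pow_right _).inv_right) h1
      simpa using h2)).1
    apply ha'
    obtain ⟨q, hq⟩ := Nat.exists_eq_succ_of_ne_zero hs0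
    rw [show t + r + 1 = 2 + q by omega, pow_add, pow_mul]
    norm_num [hfin]

/-- Two elements of a finite `2`-group with normal cyclic subgroups that do not commute have order
dividing `4`. -/
lemma pow_four_of_not_commute (hD : ∀ g : G, (Subgroup.zpowers g).Normal) (hG : IsPGroup 2 G)
    {a b : G} (hab : ¬ Commute a b) : a ^ 4 = 1 ∧ b ^ 4 = 1 := by
  obtain ⟨s, hs⟩ := hG a
  obtain ⟨t, ht⟩ := hG b
  rcases le_total t s with h | h
  · exact pow_four_of_not_commute_aux hD (s + t) s t le_rfl h a b hs ht hab
  · exact (pow_four_of_not_commute_aux hD (t + s) t s le_rfl h b a ht hs (fun h => hab h.symm)).symm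

/-- Fix a and b that do not commute. If g commutes with both, then ga and b do not commute, so (ga)
^ 4 = g ^ 4 a ^ 4 and a ^ 4 are both 1. -/
lemma pow_four_of_isPGroup_two (hD : ∀ g : G, (Subgroup.zpowers g).Normal) (hG : IsPGroup 2 G)
    (hnc : ¬ ∀ a b : G, a * b = b * a) (g : G) : g ^ 4 = 1 := by
  push Not at hnc
  obtain ⟨a, b, hab⟩ := hnc
  have hab' : ¬ Commute a b := hab
  by_cases hgb : Commute g b
  · have h1 : ¬ Commute (g * a) b := by
      intro h
      apply hab'
      have := Commute.mul_left hgb.inv_left h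
      simpa using this
    by_cases hga : Commute g a
    · have h2 := (pow_four_of_not_commute hD hG h1).1
      rwa [hga.mul_pow, (pow_four_of_not_commute hD hG hab').1, mul_one] at h2
    · exact (pow_four_of_not_commute hD hG hga).1
  · exact (pow_four_of_not_commute hD hG hgb).1

lemma eq_or_eq_inv_of_mem_zpowers {g h : G} (hg : g ^ 4 = 1) (hh : h ∈ Subgroup.zpowers g)
    (ho : orderOf h = orderOf g) : h = g ∨ h = g⁻¹ := by
  have hg' : g ^ (4 : ℤ) = 1 := by exact_mod_cast hg
  by_cases h2 : g ^ 2 = 1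
  · have hh2 : h ^ 2 = 1 := by
      rw [← orderOf_dvd_iff_pow_eq_one, ho]; exact orderOf_dvd_of_pow_eq_one h2
    by_cases h1 : g = 1
    · rw [h1, orderOf_one, orderOf_eq_one_iff] at ho
      exact Or.inl (ho.trans h1.symm)
    · left
      have h1' : h ≠ 1 := by
        intro h'
        rw [h', orderOf_one] at ho
        exact h1 (orderOf_eq_one_iff.mp ho.symm)
      have := eq_pow_of_sq_eq_one (a := g) (c := h) (s := 0) (by simpa using h2) (by simpa using h1)
        hh hh2 h1'
      simpa using this
  · obtain ⟨k, rfl⟩ := Subgroup.mem_zpowers_iff.mp hh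
    have hmod : g ^ k = g ^ (k % 4) := by
      conv_lhs => rw [← Int.emod_add_mul_ediv k 4, zpow_add, zpow_mul, hg', one_zpow, mul_one]
    have hne : (g ^ k) ^ 2 ≠ 1 := by
      intro h'
      apply h2
      rw [← orderOf_dvd_iff_pow_eq_one, ← ho]
      exact orderOf_dvd_of_pow_eq_one h'
    rw [hmod] at hne ⊢
    have h0 := Int.emod_nonneg k (show (4 : ℤ) ≠ 0 by norm_num)
    have h4 := Int.emod_lt_of_pos k (show (0 : ℤ) < 4 by norm_num)
    generalize k % 4 = j at *
    interval_cases j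
    · simp at hne
    · left; simp
    · exfalso
      apply hne
      rw [zpow_ofNat, ← pow_mul]
      exact hg
    · right
      rw [eq_inv_iff_mul_eq_one, ← zpow_add_one]
      exact_mod_cast hg

lemma hasInverseConjugates_of_pow_four (hD : ∀ g : G, (Subgroup.zpowers g).Normal)
    (h4 : ∀ g : G, g ^ 4 = 1) : HasInverseConjugates G := by
  intro g h
  apply eq_or_eq_inv_of_mem_zpowers (h4 g) ((hD g).conj_mem _ (Subgroup.mem_zpowers g) h)
  have := orderOf_injective (MulAut.conj h).toMonoidHom (MulAut.conj h).injective g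
  simpa using this

lemma hasInverseConjugates_of_comm (h : ∀ a b : G, a * b = b * a) : HasInverseConjugates G := by
  intro g x
  left
  rw [h x g, mul_inv_cancel_right]

lemma hasInverseConjugates_of_isPGroup_two (hD : ∀ g : G, (Subgroup.zpowers g).Normal)
    (hG : IsPGroup 2 G) : HasInverseConjugates G := by
  by_cases hc : ∀ a b : G, a * b = b * a
  · exact hasInverseConjugates_of_comm hc
  · exact hasInverseConjugates_of_pow_four hD (pow_four_of_isPGroup_two hD hG hc)

end Dedekind

/-! ### Higman groups -/

section Higman

variable {G : Type u} [Group G]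

lemma IsHigmanGroup.hasInverseConjugates (h : IsHigmanGroup G) : HasInverseConjugates G := by
  obtain ⟨_, ⟨hc, _⟩ | ⟨hp, _, hn⟩⟩ := h
  · exact hasInverseConjugates_of_comm hc
  · exact hasInverseConjugates_of_isPGroup_two (fun g => hn _) hp

lemma IsHigmanGroup.hasTorsionUnits (h : IsHigmanGroup G) :
    HasTorsionUnits (MonoidAlgebra ℚ G) := by
  have := h.1
  refine h.hasInverseConjugates.hasTorsionUnits ?_
  obtain ⟨_, ⟨hc, h1 | h1⟩ | ⟨hp, hnc, hn⟩⟩ := h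
  · exact Or.inl fun g => Monoid.exponent_dvd_iff_forall_pow_eq_one.mp h1 g
  · exact Or.inr fun g => Monoid.exponent_dvd_iff_forall_pow_eq_one.mp h1 g
  · exact Or.inl (pow_four_of_isPGroup_two (fun g => hn _) hp hnc)

lemma normal_of_zpowers_normal (hD : ∀ g : G, (Subgroup.zpowers g).Normal) (H : Subgroup G) :
    H.Normal :=
  ⟨fun n hn g => Subgroup.zpowers_le.mpr hn ((hD n).conj_mem _ (Subgroup.mem_zpowers n) g)⟩

/-- In a reduced algebra the elements (1 - g)xĝ of square zero vanish. -/
lemma zpowers_normal_of_isReduced [Finite G] (h : IsReduced (MonoidAlgebra ℚ G)) (g : G) :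
    (Subgroup.zpowers g).Normal := by
  rw [zpowers_normal_iff]
  intro x
  by_contra hx
  refine bicyclicElement_ne_zero hx (h.eq_zero _ ⟨2, ?_⟩)
  rw [pow_two, bicyclicElement_mul]

/-- All orders are 1, 2, 3, 4 or 6. An element of order 3 is central, so next to an element of order
4 it would produce order 12. Hence the exponent divides 4 or 6, and exponent 6 makes the group
abelian. -/
lemma isHigmanGroup_of_isReduced [Finite G] (h : IsReduced (MonoidAlgebra ℚ G))
    (ht : HasTorsionUnits (MonoidAlgebra ℚ G)) : IsHigmanGroup G := by
  have hD := zpowers_normal_of_isReduced h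
  have hord := ht.orderOf_mem
  have key : (∀ g : G, g ^ 4 = 1) ∨ ∀ g : G, g ^ 6 = 1 := by
    by_contra! hcon
    obtain ⟨⟨g, hg⟩, ⟨k, hk⟩⟩ := hcon
    have h3 : orderOf (g ^ 4) = 3 := by
      apply orderOf_eq_prime _ hg
      rw [← pow_mul, ← orderOf_dvd_iff_pow_eq_one]
      have hg' : ¬ orderOf g ∣ 4 := fun hh => hg (orderOf_dvd_iff_pow_eq_one.mp hh)
      rcases hord g with h | h | h | h | h <;> rw [h] at hg' ⊢ <;> revert hg' <;> decide
    have h4 : orderOf k = 4 := by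
      have hk' : ¬ orderOf k ∣ 6 := fun hh => hk (orderOf_dvd_iff_pow_eq_one.mp hh)
      rcases hord k with h | h | h | h | h <;> rw [h] at hk' ⊢ <;> revert hk' <;> decide
    have hcomm : Commute (g ^ 4) k :=
      commute_of_orderOf_prime hD (by rw [h3]; exact Nat.prime_three) k
    have := hord (g ^ 4 * k)
    rw [hcomm.orderOf_mul_eq_mul_orderOf_of_coprime (by rw [h3, h4]; decide), h3, h4] at this
    norm_num at this
  refine ⟨inferInstance, ?_⟩
  by_cases hc : ∀ a b : G, a * b = b * a
  · exact Or.inl ⟨hc, key.imp Monoid.exponent_dvd_of_forall_pow_eq_one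
      Monoid.exponent_dvd_of_forall_pow_eq_one⟩
  · rcases key with h4 | h6
    · exact Or.inr ⟨fun g => ⟨2, by simpa using h4 g⟩, hc, normal_of_zpowers_normal hD⟩
    · exact absurd (commute_of_pow_six hD h6) hc

end Higman


/-! ### Groups generated by an element and an element inverting it -/

section InvertingPair

/-- `G` is generated by an element `a` of order `n` and an element `b` of order `m` that inverts
`a`, and the cyclic subgroups they generate are complements. -/
def HasInvertingPair (G : Type*) [Group G] (n m : ℕ) : Prop :=
  ∃ a b : G, orderOf a = n ∧ orderOf b = m ∧ b * a * b⁻¹ = a⁻¹ ∧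
    Disjoint (Subgroup.zpowers a) (Subgroup.zpowers b) ∧ Nat.card G = n * m

lemma HasInvertingPair.of_mulEquiv {G H : Type*} [Group G] [Group H] {n m : ℕ}
    (h : HasInvertingPair G n m) (e : G ≃* H) : HasInvertingPair H n m := by
  obtain ⟨a, b, ha, hb, hab, hd, hcard⟩ := h
  refine ⟨e a, e b, ?_, ?_, ?_, ?_, ?_⟩
  · rw [← ha]; exact orderOf_injective e.toMonoidHom e.injective a
  · rw [← hb]; exact orderOf_injective e.toMonoidHom e.injective b
  · rw [← map_inv, ← map_mul, ← map_mul, hab, map_inv]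
  · have h1 := Subgroup.disjoint_map (f := e.toMonoidHom) e.injective hd
    rwa [MonoidHom.map_zpowers, MonoidHom.map_zpowers] at h1
  · rw [← hcard]; exact (Nat.card_congr e.toEquiv).symm

/-- The cyclic group of order `m` acting on the cyclic group of order `n` by inversion. -/
noncomputable def inversionHom (n m : ℕ) [NeZero m] (hm : 2 ∣ m) :
    CyclicGroup m →* MulAut (CyclicGroup n) :=
  cyclicHom m (MulEquiv.inv (CyclicGroup n)) (by
    obtain ⟨k, rfl⟩ := hm
    have : (MulEquiv.inv (CyclicGroup n) : MulAut (CyclicGroup n)) ^ 2 = 1 := by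
      ext x; simp [pow_two]
    rw [pow_mul, this, one_pow])

lemma inversionHom_ofAdd_one (n m : ℕ) [NeZero m] (hm : 2 ∣ m) (c : CyclicGroup n) :
    inversionHom n m hm (Multiplicative.ofAdd 1) c = c⁻¹ := by
  rw [inversionHom, cyclicHom_ofAdd_one]
  rfl

lemma eq_ofAdd_one_pow {n : ℕ} [NeZero n] (c : CyclicGroup n) :
    c = (Multiplicative.ofAdd (1 : ZMod n)) ^ (Multiplicative.toAdd c).val := by
  rw [← ofAdd_nsmul, nsmul_one, ZMod.natCast_zmod_val, ofAdd_toAdd]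

section Lift

variable {n m : ℕ} [NeZero n] [NeZero m] {φ : CyclicGroup m →* MulAut (CyclicGroup n)}
  {H : Type*} [Group H] {A B : H}

lemma cyclicHom_apply_inversion (hφ : ∀ c, φ (Multiplicative.ofAdd 1) c = c⁻¹)
    (hA : A ^ n = 1) (hB : B ^ m = 1) (hAB : B * A * B⁻¹ = A⁻¹)
    (g : CyclicGroup m) (c : CyclicGroup n) :
    cyclicHom n A hA (φ g c) = cyclicHom m B hB g * cyclicHom n A hA c * (cyclicHom m B hB g)⁻¹ := by
  rw [eq_ofAdd_one_pow g]
  induction (Multiplicative.toAdd g).val generalizing c with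
  | zero => simp
  | succ k ih =>
    rw [pow_succ, map_mul, MulAut.mul_apply, ih, hφ, map_mul, cyclicHom_ofAdd_one, map_inv]
    have : (cyclicHom n A hA c)⁻¹ = B * cyclicHom n A hA c * B⁻¹ := by
      rw [eq_ofAdd_one_pow c, map_pow, cyclicHom_ofAdd_one, ← conj_pow, hAB, inv_pow]
    rw [this]
    group

/-- The homomorphism from `Cₙ ⋊ Cₘ` determined by the images of the two generators. -/
noncomputable def inversionLift (hφ : ∀ c, φ (Multiplicative.ofAdd 1) c = c⁻¹)
    (hA : A ^ n = 1) (hB : B ^ m = 1) (hAB : B * A * B⁻¹ = A⁻¹) :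
    CyclicGroup n ⋊[φ] CyclicGroup m →* H :=
  SemidirectProduct.lift (cyclicHom n A hA) (cyclicHom m B hB) fun g => by
    ext c
    exact cyclicHom_apply_inversion hφ hA hB hAB g c

lemma card_cyclicGroup (n : ℕ) : Nat.card (CyclicGroup n) = n := by
  rw [Nat.card_congr Multiplicative.toAdd, Nat.card_zmod]

/-- The lift from the semidirect product is injective because the two cyclic subgroups meet
trivially, and the cardinalities agree. -/
lemma HasInvertingPair.nonempty_mulEquiv
    (hφ : ∀ c, φ (Multiplicative.ofAdd 1) c = c⁻¹)
    (h : HasInvertingPair H n m) :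
    Nonempty (H ≃* CyclicGroup n ⋊[φ] CyclicGroup m) := by
  obtain ⟨a, b, ha, hb, hab, hd, hcard⟩ := h
  have ha' : a ^ n = 1 := by rw [← ha, pow_orderOf_eq_one]
  have hb' : b ^ m = 1 := by rw [← hb, pow_orderOf_eq_one]
  have hinj : Function.Injective (inversionLift hφ ha' hb' hab) := by
    rw [injective_iff_map_eq_one]
    intro x hx
    have hx' : cyclicHom n a ha' x.left * cyclicHom m b hb' x.right = 1 := hx
    have h1 : cyclicHom n a ha' x.left ∈ Subgroup.zpowers a :=
      Subgroup.pow_mem _ (Subgroup.mem_zpowers a) _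
    have h2 : cyclicHom m b hb' x.right ∈ Subgroup.zpowers b :=
      Subgroup.pow_mem _ (Subgroup.mem_zpowers b) _
    have h3 : cyclicHom n a ha' x.left = 1 := by
      apply Subgroup.disjoint_def.mp hd h1
      rw [eq_inv_of_mul_eq_one_left hx']
      exact Subgroup.inv_mem _ h2
    rw [h3, one_mul] at hx'
    refine SemidirectProduct.ext ?_ ?_
    · exact (injective_iff_map_eq_one _).mp (cyclicHom_injective ha) _ h3
    · exact (injective_iff_map_eq_one _).mp (cyclicHom_injective hb) _ hx'
  have hcard' : Nat.card (CyclicGroup n ⋊[φ] CyclicGroup m) = Nat.card H := by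
    rw [SemidirectProduct.card, card_cyclicGroup, card_cyclicGroup, hcard]
  have : Finite H := Nat.finite_of_card_ne_zero
    (by rw [hcard]; exact mul_ne_zero (NeZero.ne n) (NeZero.ne m))
  have hbij := (Nat.bijective_iff_injective_and_card _).mpr ⟨hinj, hcard'⟩
  exact ⟨(MulEquiv.ofBijective _ hbij).symm⟩

lemma hasInvertingPair_semidirectProduct {n m : ℕ}
    {φ : CyclicGroup m →* MulAut (CyclicGroup n)} (hφ : ∀ c, φ (Multiplicative.ofAdd 1) c = c⁻¹) :
    HasInvertingPair (CyclicGroup n ⋊[φ] CyclicGroup m) n m := by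
  refine ⟨SemidirectProduct.inl (Multiplicative.ofAdd 1),
    SemidirectProduct.inr (Multiplicative.ofAdd 1), ?_, ?_, ?_, ?_, ?_⟩
  · rw [orderOf_injective _ SemidirectProduct.inl_injective, orderOf_ofAdd_eq_addOrderOf,
      ZMod.addOrderOf_one]
  · rw [orderOf_injective _ SemidirectProduct.inr_injective, orderOf_ofAdd_eq_addOrderOf,
      ZMod.addOrderOf_one]
  · rw [← map_inv SemidirectProduct.inr, ← SemidirectProduct.inl_aut, hφ, map_inv]
  · rw [Subgroup.disjoint_def]
    intro x h1 h2
    obtain ⟨i, rfl⟩ := h1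
    obtain ⟨j, hj⟩ := h2
    simp only [← map_zpow] at hj ⊢
    have := congrArg SemidirectProduct.left hj
    rw [SemidirectProduct.left_inr, SemidirectProduct.left_inl] at this
    rw [← this, map_one]
  · rw [SemidirectProduct.card, card_cyclicGroup, card_cyclicGroup]

end Lift

lemma disjoint_zpowers_of_orderOf_two {G : Type*} [Group G] {a b : G} (hb : orderOf b = 2)
    (h : b ∉ Subgroup.zpowers a) : Disjoint (Subgroup.zpowers a) (Subgroup.zpowers b) := by
  rw [Subgroup.disjoint_def]
  intro x hxa hxb
  obtain ⟨k, rfl⟩ := Subgroup.mem_zpowers_iff.mp hxb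
  have hb2 : b ^ (2 : ℤ) = 1 := by rw [zpow_ofNat, ← hb, pow_orderOf_eq_one]
  rcases Int.even_or_odd' k with ⟨r, rfl | rfl⟩
  · rw [zpow_mul, hb2, one_zpow]
  · rw [zpow_add, zpow_mul, hb2, one_zpow, one_mul, zpow_one] at hxa
    exact absurd hxa h

/-- A nontrivial subgroup of ⟨b⟩ contains the involution b². -/
lemma disjoint_zpowers_of_orderOf_four {G : Type*} [Group G] {a b : G} (hb : b ^ 4 = 1)
    (h2 : b ^ 2 ≠ 1) (h : b ^ 2 ∉ Subgroup.zpowers a) :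
    Disjoint (Subgroup.zpowers a) (Subgroup.zpowers b) := by
  rw [Subgroup.disjoint_def]
  intro x hxa hxb
  by_contra hx
  have hb2 : (b ^ 2) ^ 2 = 1 := by rw [← pow_mul]; exact hb
  have h1 : orderOf b = 2 ^ 2 := by
    have := Fact.mk Nat.prime_two
    exact orderOf_eq_prime_pow (by simpa using h2) (by simpa using hb)
  by_cases hx2 : x ^ 2 = 1
  · have := eq_pow_of_sq_eq_one (s := 1) (a := b) (by simpa using hb) (by simpa using h2) hxb hx2 hx
    rw [pow_one] at this
    exact h (this ▸ hxa)
  · exact h (Subgroup.pow_mem _ (Subgroup.zpowers_le.mpr hxa (mem_zpowers_of_sq_ne_one hb hxb hx2)) 2)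

lemma disjoint_zpowers_of_coprime {G : Type*} [Group G] {a b : G}
    (h : (orderOf a).Coprime (orderOf b)) :
    Disjoint (Subgroup.zpowers a) (Subgroup.zpowers b) := by
  apply Subgroup.disjoint_of_coprime_natCard
  rwa [Nat.card_zpowers, Nat.card_zpowers]

lemma hasInvertingPair_perm : HasInvertingPair (Equiv.Perm (Fin 3)) 3 2 := by
  have ha : orderOf (finRotate 3) = 3 := orderOf_eq_prime (by decide) (by decide)
  have hb : orderOf (Equiv.swap (0 : Fin 3) 1) = 2 := orderOf_eq_prime (by decide) (by decide)
  refine ⟨finRotate 3, Equiv.swap 0 1, ha, hb, by decide,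
    disjoint_zpowers_of_coprime (by rw [ha, hb]; decide), ?_⟩
  simp [Fintype.card_perm, Nat.factorial]

lemma hasInvertingPair_dihedral : HasInvertingPair (DihedralGroup 4) 4 2 := by
  have hb : orderOf (DihedralGroup.sr (0 : ZMod 4)) = 2 := DihedralGroup.orderOf_sr 0
  refine ⟨DihedralGroup.r 1, DihedralGroup.sr 0, DihedralGroup.orderOf_r_one, hb, by decide,
    disjoint_zpowers_of_orderOf_two hb ?_, ?_⟩
  · rintro ⟨k, hk⟩
    have hk' : DihedralGroup.r (1 : ZMod 4) ^ k = DihedralGroup.sr 0 := hk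
    rw [DihedralGroup.r_one_zpow] at hk'
    cases hk'
  · rw [DihedralGroup.nat_card]

/-- Inversion is the only nontrivial automorphism of C₄, and a nontrivial action is nontrivial on
the generator. -/
lemma inversion_of_ne_one {φ : CyclicGroup 4 →* MulAut (CyclicGroup 4)} (hφ : φ ≠ 1)
    (c : CyclicGroup 4) : φ (Multiplicative.ofAdd 1) c = c⁻¹ := by
  have hg4 : (Multiplicative.ofAdd (1 : ZMod 4)) ^ 4 = 1 := by decide
  have hmem : φ (Multiplicative.ofAdd 1) (Multiplicative.ofAdd (1 : ZMod 4)) ∈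
      Subgroup.zpowers (Multiplicative.ofAdd (1 : ZMod 4)) := by
    rw [eq_ofAdd_one_pow (φ _ _)]
    exact Subgroup.pow_mem _ (Subgroup.mem_zpowers _) _
  rcases eq_or_eq_inv_of_mem_zpowers hg4 hmem
    (orderOf_injective (φ (Multiplicative.ofAdd 1)).toMonoidHom (MulEquiv.injective _) _) with h | h
  · refine absurd ?_ hφ
    have h1 : φ (Multiplicative.ofAdd 1) = 1 := by
      ext c
      rw [eq_ofAdd_one_pow c, map_pow, h, MulAut.one_apply]
    refine MonoidHom.ext fun g => ?_
    rw [eq_ofAdd_one_pow g, map_pow, h1, one_pow, MonoidHom.one_apply]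
  · rw [eq_ofAdd_one_pow c, map_pow, h, inv_pow]

/-- The four exceptional groups are those with an inverting pair of suitable orders. -/
lemma isExceptionalGroup_iff {G : Type u} [Group G] : IsExceptionalGroup G ↔
    HasInvertingPair G 3 2 ∨ HasInvertingPair G 4 2 ∨ HasInvertingPair G 3 4 ∨
      HasInvertingPair G 4 4 := by
  constructor
  · rintro (⟨⟨e⟩⟩ | ⟨⟨e⟩⟩ | ⟨φ, hφ, ⟨e⟩⟩ | ⟨φ, hφ, ⟨e⟩⟩)
    · exact Or.inl (hasInvertingPair_perm.of_mulEquiv e.symm)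
    · exact Or.inr (Or.inl (hasInvertingPair_dihedral.of_mulEquiv e.symm))
    · exact Or.inr (Or.inr (Or.inl ((hasInvertingPair_semidirectProduct hφ).of_mulEquiv e.symm)))
    · exact Or.inr (Or.inr (Or.inr
        ((hasInvertingPair_semidirectProduct (inversion_of_ne_one hφ)).of_mulEquiv e.symm)))
  · have i32 := inversionHom_ofAdd_one 3 2 (by norm_num)
    have i42 := inversionHom_ofAdd_one 4 2 (by norm_num)
    have i34 := inversionHom_ofAdd_one 3 4 (by norm_num)
    have i44 := inversionHom_ofAdd_one 4 4 (by norm_num)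
    rintro (h | h | h | h)
    · obtain ⟨e⟩ := h.nonempty_mulEquiv i32
      obtain ⟨e'⟩ := hasInvertingPair_perm.nonempty_mulEquiv i32
      exact Or.inl ⟨e.trans e'.symm⟩
    · obtain ⟨e⟩ := h.nonempty_mulEquiv i42
      obtain ⟨e'⟩ := hasInvertingPair_dihedral.nonempty_mulEquiv i42
      exact Or.inr (Or.inl ⟨e.trans e'.symm⟩)
    · exact Or.inr (Or.inr (Or.inl ⟨_, i34, h.nonempty_mulEquiv i34⟩))
    · refine Or.inr (Or.inr (Or.inr ⟨_, fun h1 => ?_, h.nonempty_mulEquiv i44⟩))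
      have := i44 (Multiplicative.ofAdd 1)
      rw [h1, MonoidHom.one_apply, MulAut.one_apply] at this
      revert this
      decide

lemma HasInvertingPair.finite {G : Type*} [Group G] {n m : ℕ} [NeZero n] [NeZero m]
    (h : HasInvertingPair G n m) : Finite G := by
  obtain ⟨a, b, _, _, _, _, hcard⟩ := h
  exact Nat.finite_of_card_ne_zero (by rw [hcard]; exact mul_ne_zero (NeZero.ne n) (NeZero.ne m))

lemma IsExceptionalGroup.finite {G : Type u} [Group G] (h : IsExceptionalGroup G) : Finite G := by
  rcases isExceptionalGroup_iff.mp h with h | h | h | h <;> exact h.finite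

end InvertingPair


/-! ### Groups whose rational group algebra has rank one units and nilpotent elements -/

section Exceptional

open MonoidAlgebra

variable {G : Type u} [Group G]

/-- An element of square zero is fixed by every central group element of odd order. -/
lemma HasRankOneUnits.single_mul_eq [Finite G] (h : HasRankOneUnits (MonoidAlgebra ℚ G)) {z : G}
    (hz : ∀ g, Commute z g) (hodd : Odd (orderOf z)) {x : MonoidAlgebra ℚ G} (hx : x * x = 0) :
    single z 1 * x = x := by
  obtain ⟨Z, hZ⟩ : ∃ Z : MonoidAlgebra ℚ G, Z = single z 1 := ⟨_, rfl⟩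
  have hcomm : ∀ y : MonoidAlgebra ℚ G, Z * y = y * Z := by
    intro y
    ext w
    rw [hZ, coeff_single_mul_apply, coeff_mul_single_apply, one_mul, mul_one,
      ((hz w).inv_left).eq]
  rw [← hZ]
  by_cases hx0 : x = 0
  · rw [hx0, mul_zero]
  have h1 : x * (Z * x) = 0 := by rw [hcomm, ← mul_assoc, hx, zero_mul]
  have h2 : Z * x * x = 0 := by rw [mul_assoc, hx, mul_zero]
  have h3 : Z * x * (Z * x) = 0 := by rw [mul_assoc, h1, mul_zero]
  -- The elements x and z x have zero products, so z x = c x with c rational. Then c is a root of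
  -- unity of odd order, hence c = 1.
  obtain ⟨m, n, hmn, hrel⟩ := h.exists_smul_add_smul_eq_zero hx h3 h1 h2
  rw [← Int.cast_smul_eq_zsmul ℚ, ← Int.cast_smul_eq_zsmul ℚ] at hrel
  have hn : (n : ℚ) ≠ 0 := by
    intro hn
    rw [hn, zero_smul, add_zero] at hrel
    rcases smul_eq_zero.mp hrel with h' | h'
    · have h1 : m = 0 := by exact_mod_cast h'
      have h2 : n = 0 := by exact_mod_cast hn
      omega
    · exact hx0 h'
  obtain ⟨c, hc⟩ : ∃ c : ℚ, Z * x = c • x := by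
    refine ⟨-((n : ℚ)⁻¹ * m), ?_⟩
    have : (n : ℚ)⁻¹ • ((m : ℚ) • x + (n : ℚ) • (Z * x)) = 0 := by rw [hrel, smul_zero]
    rw [smul_add, smul_smul, smul_smul, inv_mul_cancel₀ hn, one_smul] at this
    rw [neg_smul]
    exact eq_neg_of_add_eq_zero_right this
  have hpow : ∀ k : ℕ, Z ^ k * x = c ^ k • x := by
    intro k
    induction k with
    | zero => simp
    | succ k ih => rw [pow_succ, mul_assoc, hc, mul_smul_comm, ih, smul_smul, ← pow_succ']
  have hc1 : c ^ orderOf z = 1 := by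
    have h4 := hpow (orderOf z)
    rw [hZ, single_pow, pow_orderOf_eq_one, one_pow, ← one_def, one_mul] at h4
    have h5 : (c ^ orderOf z - 1) • x = 0 := by rw [sub_smul, ← h4, one_smul, sub_self]
    rcases smul_eq_zero.mp h5 with h' | h'
    · exact sub_eq_zero.mp h'
    · exact absurd h' hx0
  have : c = 1 := by
    have h6 : c ^ orderOf z = 1 ^ orderOf z := by rw [hc1, one_pow]
    exact (Odd.strictMono_pow hodd).injective h6
  rw [hc, this, one_smul]

/-- If all cyclic subgroups were normal, the algebra would be reduced. For a 2-group this is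
`HasInverseConjugates.isReduced`. Otherwise elements of odd prime order are central and fix every
nilpotent of square zero, so by `orderOf_mem` the prime is 3, the exponent divides 6, and the group
is abelian. -/
lemma HasRankOneUnits.exists_not_normal [Finite G] (h : HasRankOneUnits (MonoidAlgebra ℚ G))
    (hred : ¬ IsReduced (MonoidAlgebra ℚ G)) : ∃ g : G, ¬ (Subgroup.zpowers g).Normal := by
  by_contra! hD
  have hex : ∃ x : MonoidAlgebra ℚ G, x * x = 0 ∧ x ≠ 0 := by
    by_contra! hcon
    apply hred
    rw [isReduced_iff_pow_one_lt 2 one_lt_two]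
    intro x hx
    exact hcon x (by rwa [← pow_two])
  obtain ⟨x, hx, hx0⟩ := hex
  by_cases hp : ∃ p : ℕ, p.Prime ∧ p ∣ Nat.card G ∧ p ≠ 2
  · obtain ⟨p, hp, hdvd, hp2⟩ := hp
    have hfix : ∀ z : G, (orderOf z).Prime → orderOf z ≠ 2 →
        ∀ (g : G) (j : ℕ), g ^ j = z → orderOf g ∈ ({1, 2, 3, 4, 6} : Set ℕ) := by
      intro z hz hz2 g j hgj
      have hcomm := commute_of_orderOf_prime hD hz
      have hodd := hz.odd_of_ne_two hz2
      have h1 := h.single_mul_eq hcomm hodd hx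
      have h2 : x * single z 1 = x := by
        conv_rhs => rw [← h1]
        ext w
        rw [coeff_single_mul_apply, coeff_mul_single_apply, one_mul, mul_one,
          ((hcomm w).inv_left).eq]
      have hz1 : z ≠ 1 := by
        rintro rfl
        rw [orderOf_one] at hz
        exact Nat.not_prime_one hz
      subst hgj
      exact h.orderOf_mem hz1 hx hx0 h1 h2
    have := Fact.mk hp
    obtain ⟨z, hz⟩ := exists_prime_orderOf_dvd_card' p hdvd
    have hz3 : orderOf z = 3 := by
      have := hfix z (by rwa [hz]) (by rwa [hz]) z 1 (pow_one z)
      rw [hz] at this ⊢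
      rcases this with h | h | h | h | h
      · rw [h] at hp; exact absurd hp (by norm_num)
      · exact absurd h hp2
      · exact h
      · rw [h] at hp; exact absurd hp (by norm_num)
      · rw [Set.mem_singleton_iff.mp h] at hp; exact absurd hp (by norm_num)
    have h6 : ∀ g : G, g ^ 6 = 1 := by
      intro g
      rw [← orderOf_dvd_iff_pow_eq_one]
      by_cases h3 : 3 ∣ orderOf g
      · obtain ⟨k, hk⟩ := h3
        have hk0 : 0 < k := by
          have := orderOf_pos g
          omega
        have h1 : orderOf (g ^ k) = 3 := by
          rw [orderOf_pow, hk, Nat.gcd_eq_right (dvd_mul_left k 3), Nat.mul_div_cancel _ hk0]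
        have := hfix (g ^ k) (by rw [h1]; norm_num) (by rw [h1]; norm_num) g k rfl
        rcases this with h | h | h | h | h
        · omega
        · omega
        · rw [h]; decide
        · omega
        · rw [Set.mem_singleton_iff.mp h]
      -- When 3 does not divide the order of g, the bound is applied to z g, whose order is three
      -- times as large.
      · have hcop : (orderOf z).Coprime (orderOf g) := by
          rw [hz3]
          exact (Nat.Prime.coprime_iff_not_dvd Nat.prime_three).mpr h3
        have hcomm : Commute z g :=
          commute_of_orderOf_prime hD (by rw [hz3]; exact Nat.prime_three) g
        have hord := hcomm.orderOf_mul_eq_mul_orderOf_of_coprime hcop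
        have hz' : orderOf ((z * g) ^ orderOf g) = 3 := by
          rw [hcomm.mul_pow, pow_orderOf_eq_one, mul_one,
            Nat.Coprime.orderOf_pow (by rwa [Nat.coprime_comm] at hcop ⊢), hz3]
        have := hfix ((z * g) ^ orderOf g) (by rw [hz']; norm_num) (by rw [hz']; norm_num) (z * g)
          (orderOf g) rfl
        rw [hord, hz3] at this
        have hmem : orderOf g = 1 ∨ orderOf g = 2 := by
          simp only [Set.mem_insert_iff, Set.mem_singleton_iff] at this
          omega
        rcases hmem with h | h <;> rw [h] <;> decide
    exact hred (hasInverseConjugates_of_comm (commute_of_pow_six hD h6)).isReduced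
  · push Not at hp
    apply hred
    have hG : IsPGroup 2 G := by
      have := Nat.eq_prime_pow_of_unique_prime_dvd (n := Nat.card G) (p := 2)
        Nat.card_pos.ne' (fun {d} hd hdvd => hp d hd hdvd)
      exact IsPGroup.of_card this
    exact (hasInverseConjugates_of_isPGroup_two hD hG).isReduced

lemma zpowers_normal_of_comm (h : ∀ a b : G, a * b = b * a) (g : G) :
    (Subgroup.zpowers g).Normal := by
  rw [zpowers_normal_iff]
  intro x
  rw [h x⁻¹ g, inv_mul_cancel_right]
  exact Subgroup.mem_zpowers g

lemma comm_of_orderOf_eq_card [Finite G] {c : G} (hc : orderOf c = Nat.card G) (a b : G) :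
    a * b = b * a := by
  have : Subgroup.zpowers c = ⊤ := by
    rw [← Subgroup.card_eq_iff_eq_top, Nat.card_zpowers, hc]
  have ha : a ∈ Subgroup.zpowers c := by rw [this]; trivial
  have hb : b ∈ Subgroup.zpowers c := by rw [this]; trivial
  obtain ⟨i, rfl⟩ := ha
  obtain ⟨j, rfl⟩ := hb
  exact ((Commute.refl c).zpow_zpow i j).eq

/-- The case of a group of order `3 m` with a cyclic subgroup of order `m` that is not normal. -/
lemma hasInvertingPair_three [Finite G] (hnorm : ∀ a : G, orderOf a = 3 → (Subgroup.zpowers a).Normal)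
    {g : G} (hg : ¬ (Subgroup.zpowers g).Normal) {m : ℕ} (hm : orderOf g = m)
    (hcop : Nat.Coprime 3 m) (hcard : Nat.card G = 3 * m) : HasInvertingPair G 3 m := by
  classical
  have := Fact.mk Nat.prime_three
  obtain ⟨a, ha⟩ := exists_prime_orderOf_dvd_card' (G := G) 3 (by rw [hcard]; exact dvd_mul_right 3 m)
  refine ⟨a, g, ha, hm, ?_, disjoint_zpowers_of_coprime (by rwa [ha, hm]), hcard⟩
  have ha3 : a ^ 3 = 1 := by rw [← ha, pow_orderOf_eq_one]
  have hmem := (hnorm a ha).conj_mem a (Subgroup.mem_zpowers a) g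
  rw [← mem_powers_iff_mem_zpowers, mem_powers_iff_mem_range_orderOf, ha] at hmem
  simp only [Finset.mem_image, Finset.mem_range] at hmem
  obtain ⟨k, hk, hgk⟩ := hmem
  have h1 : g * a * g⁻¹ ≠ 1 := by
    intro h
    rw [mul_inv_eq_one, mul_eq_left] at h
    rw [h, orderOf_one] at ha
    norm_num at ha
  -- Otherwise a g generates a cyclic group of order 3m, and ⟨g⟩ would be normal.
  have h2 : g * a * g⁻¹ ≠ a := by
    intro h
    have hcomm : Commute a g := by
      show a * g = g * a
      rw [mul_inv_eq_iff_eq_mul] at h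
      exact h.symm
    refine hg (zpowers_normal_of_comm (comm_of_orderOf_eq_card (c := a * g) ?_) g)
    rw [hcomm.orderOf_mul_eq_mul_orderOf_of_coprime (by rwa [ha, hm]), ha, hm, hcard]
  interval_cases k
  · exact absurd hgk.symm (by simpa using h1)
  · exact absurd hgk.symm (by simpa using h2)
  · rw [← hgk, eq_inv_iff_mul_eq_one, ← pow_succ, ha3]

/-- A nonnormal subgroup of order two in a group of order eight has a cyclic normal complement. -/
lemma hasInvertingPair_four_two [Finite G]
    (hnorm : ∀ a : G, orderOf a = 4 → (Subgroup.zpowers a).Normal)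
    {g : G} (hg : ¬ (Subgroup.zpowers g).Normal) (hm : orderOf g = 2)
    (hcard : Nat.card G = 8) : HasInvertingPair G 4 2 := by
  have hdvd : ∀ a : G, orderOf a ∣ 8 := fun a => hcard ▸ orderOf_dvd_natCard a
  -- Without elements of order 4 the group is cyclic or of exponent 2, hence abelian.
  obtain ⟨a, ha⟩ : ∃ a : G, orderOf a = 4 := by
    by_contra! hcon
    have h2 : ∀ a : G, a ^ 2 = 1 := by
      intro a
      rw [← orderOf_dvd_iff_pow_eq_one]
      have h8 : orderOf a ≠ 8 := by
        intro h8
        exact hg (zpowers_normal_of_comm (comm_of_orderOf_eq_card (c := a) (by rw [h8, hcard])) g)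
      have h4 := hcon a
      obtain ⟨k, hk, hk'⟩ := (Nat.dvd_prime_pow Nat.prime_two (m := 3)).mp (hdvd a)
      rw [hk'] at h8 h4 ⊢
      interval_cases k <;> simp_all
    refine hg (zpowers_normal_of_comm (fun a b => ?_) g)
    exact (mul_comm_of_exponent_two (G := G) (by
      have h3 : Monoid.exponent G ∣ 2 := Monoid.exponent_dvd_of_forall_pow_eq_one h2
      rcases (Nat.dvd_prime Nat.prime_two).mp h3 with h | h
      · have h5 := Monoid.exp_eq_one_iff.mp h
        rw [Subsingleton.elim g 1, orderOf_one] at hm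
        omega
      · exact h)) a b
  have hN := hnorm a ha
  have ha4 : a ^ 4 = 1 := by rw [← ha, pow_orderOf_eq_one]
  -- Subgroups of a normal cyclic subgroup are normal.
  have hga : g ∉ Subgroup.zpowers a := by
    intro hmem
    apply hg
    rw [zpowers_normal_iff]
    intro x
    obtain ⟨k, rfl⟩ := Subgroup.mem_zpowers_iff.mp hmem
    have h1 := hN.conj_mem a (Subgroup.mem_zpowers a) x⁻¹
    obtain ⟨l, hl⟩ := Subgroup.mem_zpowers_iff.mp h1
    rw [inv_inv] at hl
    have h2 : x⁻¹ * a ^ k * x = (a ^ k) ^ l := by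
      have := conj_zpow (a := x⁻¹) (b := a) (i := k)
      rw [inv_inv] at this
      rw [← this, ← hl, ← zpow_mul, ← zpow_mul, mul_comm]
    rw [h2]
    exact Subgroup.zpow_mem _ (Subgroup.mem_zpowers _) l
  have hd := disjoint_zpowers_of_orderOf_two hm hga
  have hcard' : Nat.card G = 4 * 2 := hcard
  refine ⟨a, g, ha, hm, ?_, hd, hcard'⟩
  have hmem := hN.conj_mem a (Subgroup.mem_zpowers a) g
  have hord : orderOf (g * a * g⁻¹) = orderOf a := by
    have := orderOf_injective (MulAut.conj g).toMonoidHom (MulAut.conj g).injective a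
    simpa using this
  rcases eq_or_eq_inv_of_mem_zpowers ha4 hmem hord with h | h
  -- If g commuted with a, it would be central, since a and g generate the group.
  · exfalso
    have hcomm : Commute g a := by
      show g * a = a * g
      rwa [mul_inv_eq_iff_eq_mul] at h
    have hcompl := Subgroup.isComplement'_of_card_mul_and_disjoint
      (H := Subgroup.zpowers a) (K := Subgroup.zpowers g)
      (by rw [Nat.card_zpowers, Nat.card_zpowers, ha, hm, hcard]) hd
    apply hg
    rw [zpowers_normal_iff]
    intro x
    have hx : x ∈ Subgroup.zpowers a ⊔ Subgroup.zpowers g := by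
      rw [hcompl.sup_eq_top]; trivial
    have hle : Subgroup.zpowers a ⊔ Subgroup.zpowers g ≤ Subgroup.centralizer {g} := by
      rw [sup_le_iff, Subgroup.zpowers_le, Subgroup.zpowers_le, Subgroup.mem_centralizer_singleton_iff,
        Subgroup.mem_centralizer_singleton_iff]
      exact ⟨hcomm.symm.eq, rfl⟩
    have h3 := Subgroup.mem_centralizer_singleton_iff.mp (hle hx)
    rw [mul_assoc, ← h3, inv_mul_cancel_left]
    exact Subgroup.mem_zpowers g
  · exact h

/-- The case of a group of order sixteen. -/
lemma hasInvertingPair_four_four [Finite G] (h2c : ∀ y : G, y ^ 2 = 1 → ∀ x, Commute y x)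
    (h4 : ∀ y : G, y ^ 4 = 1) {g : G} (hg : ¬ (Subgroup.zpowers g).Normal) (hm : orderOf g = 4)
    (hcard : Nat.card G = 16) : HasInvertingPair G 4 4 := by
  obtain ⟨x, hx⟩ : ∃ x : G, x * g * x⁻¹ ∉ Subgroup.zpowers g := by
    rw [zpowers_normal_iff] at hg
    push Not at hg
    obtain ⟨x, hx⟩ := hg
    exact ⟨x⁻¹, by simpa using hx⟩
  obtain ⟨t, ht⟩ : ∃ t, t = x * g * x⁻¹ * g⁻¹ := ⟨_, rfl⟩
  have htg : t ∉ Subgroup.zpowers g := by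
    rw [ht, Subgroup.mul_mem_cancel_right _ (Subgroup.inv_mem _ (Subgroup.mem_zpowers g))]
    exact hx
  have hxg : x * g = t * g * x := by rw [ht]; group
  have ht1 : t ≠ 1 := by rintro rfl; exact htg (Subgroup.one_mem _)
  have hsq : ∀ y z : G, Commute (y ^ 2) z := by
    intro y z
    exact h2c _ (by rw [← pow_mul]; exact h4 y) z
  have hncomm : ¬ Commute x g := by
    intro h
    apply ht1
    rw [ht, h.eq]
    group
  -- Squares are central, being of exponent 2. The same formula shows that the commutator t has t² =
  -- 1, so t is central.
  have hxgsq : (x * g) ^ 2 = t * g ^ 2 * x ^ 2 := by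
    calc (x * g) ^ 2 = (x * g) * x * g := by rw [pow_two]; group
      _ = t * g * (x ^ 2 * g) := by rw [hxg, pow_two]; group
      _ = t * g ^ 2 * x ^ 2 := by rw [(hsq x g).eq]; simp only [pow_two, mul_assoc]
  have ht2 : t ^ 2 = 1 := by
    have h1 := h4 (x * g)
    rw [show 4 = 2 * 2 from rfl, pow_mul, hxgsq] at h1
    have hc1 : Commute (t * g ^ 2) (x ^ 2) := (hsq x _).symm
    have hc2 : Commute t (g ^ 2) := (hsq g t).symm
    rw [hc1.mul_pow, hc2.mul_pow, ← pow_mul, ← pow_mul, h4, h4, mul_one, mul_one] at h1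
    exact h1
  have htc := h2c t ht2
  have hg2 : g ^ 2 ≠ 1 := by
    intro h
    have := orderOf_dvd_of_pow_eq_one h
    rw [hm] at this
    norm_num at this
  have hconj : g * x * g⁻¹ = t * x := by
    have h1 : t * (t * g * x) = g * x := by
      rw [mul_assoc t g x, ← mul_assoc, ← pow_two, ht2, one_mul]
    rw [mul_inv_eq_iff_eq_mul, ← h1, ← hxg, mul_assoc]
  -- If a² = t, then conjugation by g maps a to t a = a³ = a⁻¹, and ⟨a⟩ meets ⟨g⟩ trivially because
  -- t is not in ⟨g⟩. The suitable a is x or x g, according to the value of x² among 1, t, g², t g².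
  have hpair : ∀ a : G, a ^ 2 = t → g * a * g⁻¹ = t * a → HasInvertingPair G 4 4 := by
    intro a ha hga
    have ha2 : a ^ 2 ≠ 1 := by rw [ha]; exact ht1
    have := Fact.mk Nat.prime_two
    refine ⟨a, g, orderOf_eq_prime_pow (p := 2) (n := 1) (by simpa using ha2) (by simpa using h4 a),
      hm, ?_, ?_, hcard⟩
    · rw [hga, ← ha, eq_inv_iff_mul_eq_one, ← pow_succ, ← pow_succ, h4]
    · exact (disjoint_zpowers_of_orderOf_four (h4 a) ha2 (by rwa [ha])).symm
  by_cases h1 : x ^ 2 = 1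
  · exact absurd (h2c x h1 g) hncomm
  by_cases hxt : x ^ 2 = t
  · exact hpair x hxt hconj
  by_cases hxz : x ^ 2 = g ^ 2
  · refine hpair (x * g) ?_ ?_
    · rw [hxgsq, hxz, mul_assoc, ← pow_add, h4, mul_one]
    · have hgx : g * x = t * x * g := mul_inv_eq_iff_eq_mul.mp hconj
      rw [mul_inv_eq_iff_eq_mul, ← mul_assoc g, hgx, mul_assoc t x g]
  by_cases hxtz : x ^ 2 = t * g ^ 2
  · have h5 : (x * g) ^ 2 = 1 := by rw [hxgsq, hxtz, ← pow_two, ((hsq g t).symm).mul_pow, ht2,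
      ← pow_mul, h4, mul_one]
    have h6 := h2c _ h5 g
    refine absurd ?_ hncomm
    have := Commute.mul_left h6 ((Commute.refl g).inv_left)
    rwa [mul_inv_cancel_right] at this
  -- If x² is a fifth element, the centre has more than 4 elements and hence index 2. The noncentral
  -- x and g would have a central product and so commute.
  exfalso
  classical
  have hZ : ∀ y : G, y ^ 2 = 1 → y ∈ Subgroup.center G := fun y hy =>
    Subgroup.mem_center_iff.mpr fun z => (h2c y hy z).symm.eq
  have hz2 : (g ^ 2) ^ 2 = 1 := by rw [← pow_mul]; exact h4 g
  have hx2 : (x ^ 2) ^ 2 = 1 := by rw [← pow_mul]; exact h4 x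
  have htz2 : (t * g ^ 2) ^ 2 = 1 := by
    rw [((hsq g t).symm).mul_pow, ht2, hz2, one_mul]
  have htz : t ≠ g ^ 2 := by
    rintro rfl
    exact htg (Subgroup.pow_mem _ (Subgroup.mem_zpowers g) 2)
  have h5 : 5 ≤ Nat.card (Subgroup.center G) := by
    have hsub : (({1, t, g ^ 2, t * g ^ 2, x ^ 2} : Finset G) : Set G) ⊆ Subgroup.center G := by
      intro y hy
      simp only [Finset.coe_insert, Finset.coe_singleton, Set.mem_insert_iff,
        Set.mem_singleton_iff] at hy
      rcases hy with rfl | rfl | rfl | rfl | rfl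
      · exact Subgroup.one_mem _
      · exact hZ _ ht2
      · exact hZ _ hz2
      · exact hZ _ htz2
      · exact hZ _ hx2
    have hle := Set.ncard_le_ncard hsub (Set.toFinite _)
    rw [Set.ncard_coe_finset] at hle
    have hc5 : ({1, t, g ^ 2, t * g ^ 2, x ^ 2} : Finset G).card = 5 := by
      have htz' : t * g ^ 2 ≠ 1 := by
        intro h
        apply htz
        rw [eq_comm, ← mul_right_inj t, h, ← pow_two, ht2]
      rw [Finset.card_insert_of_notMem, Finset.card_insert_of_notMem, Finset.card_insert_of_notMem,
        Finset.card_insert_of_notMem, Finset.card_singleton]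
      · simpa using fun h => hxtz h.symm
      · simp only [Finset.mem_insert, Finset.mem_singleton, not_or]
        exact ⟨by simpa using ht1, fun h => hxz h.symm⟩
      · simp only [Finset.mem_insert, Finset.mem_singleton, not_or]
        exact ⟨htz, by simpa using hg2, fun h => hxt h.symm⟩
      · simp only [Finset.mem_insert, Finset.mem_singleton, not_or]
        exact ⟨fun h => ht1 h.symm, fun h => hg2 h.symm, fun h => htz' h.symm, fun h => h1 h.symm⟩
    rw [hc5] at hle
    exact hle
  have hxZ : ∀ y : G, ¬ Commute x y → x ∉ Subgroup.center G := fun y hy h =>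
    hy (Subgroup.mem_center_iff.mp h y).symm
  have hxn := hxZ g hncomm
  have hgn : g ∉ Subgroup.center G := fun h => hncomm (Subgroup.mem_center_iff.mp h x)
  have hidx := (Subgroup.center G).card_mul_index
  rw [hcard] at hidx
  have hi2 : (Subgroup.center G).index = 2 := by
    have hi1 : (Subgroup.center G).index ≠ 1 := by
      intro h
      rw [Subgroup.index_eq_one] at h
      exact hgn (h ▸ Subgroup.mem_top g)
    have hi3 : (Subgroup.center G).index ≤ 3 := by nlinarith
    have hi0 : (Subgroup.center G).index ≠ 0 := by
      intro h
      rw [h] at hidx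
      omega
    have : (Subgroup.center G).index ∣ 16 := Dvd.intro_left _ hidx
    generalize (Subgroup.center G).index = i at *
    interval_cases i <;> omega
  have h7 := (Subgroup.mul_mem_iff_of_index_two hi2 (a := x) (b := g)).mpr (by tauto)
  have h8 : Commute (x * g) g := (Subgroup.mem_center_iff.mp h7 g).symm
  refine hncomm ?_
  have := Commute.mul_left h8 ((Commute.refl g).inv_left)
  rwa [mul_inv_cancel_right] at this

/-- A subgroup of order 2 that is not normal would force 6 or 8 elements; a normal one is central.
-/
lemma HasRankOneUnits.commute_of_sq [Finite G] (h : HasRankOneUnits (MonoidAlgebra ℚ G))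
    (hcard : Nat.card G = 16) {y : G} (hy : y ^ 2 = 1) (x : G) : Commute y x := by
  by_cases hy1 : y = 1
  · rw [hy1]; exact Commute.one_left x
  have ho : orderOf y = 2 := orderOf_eq_prime hy hy1
  have hN : (Subgroup.zpowers y).Normal := by
    by_contra hN
    have := h.index_zpowers hN
    omega
  rw [zpowers_normal_iff] at hN
  rcases eq_or_eq_inv_of_mem_zpowers (g := y) (by rw [show 4 = 2 * 2 from rfl, pow_mul, hy, one_pow])
    (hN x) (by
      have := orderOf_injective (MulAut.conj x⁻¹).toMonoidHom (MulAut.conj x⁻¹).injective y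
      simpa using this) with h1 | h1
  · show y * x = x * y
    conv_rhs => rw [← h1]
    group
  · have hinv : y⁻¹ = y := by rw [inv_eq_iff_mul_eq_one, ← pow_two, hy]
    rw [hinv] at h1
    show y * x = x * y
    conv_rhs => rw [← h1]
    group

/-- An element y of order 8 would have ⟨y⟩ ∩ ⟨g⟩ nontrivial, since 8 · 4 > 16, hence y ^ 4 = g².
This power fixes the bicyclic element of g, and `orderOf_mem` excludes order 8. -/
lemma HasRankOneUnits.pow_four_eq_one [Finite G] (h : HasRankOneUnits (MonoidAlgebra ℚ G))
    (hcard : Nat.card G = 16) {g : G} (hg : ¬ (Subgroup.zpowers g).Normal) (y : G) : y ^ 4 = 1 := by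
  have ho : orderOf g = 4 := by
    have := h.index_zpowers hg
    have := h.orderOf_of_not_normal hg
    omega
  have hg4 : g ^ 4 = 1 := by rw [← ho, pow_orderOf_eq_one]
  have hg2 : g ^ 2 ≠ 1 := by
    intro h
    have := orderOf_dvd_of_pow_eq_one h
    rw [ho] at this
    norm_num at this
  by_contra hy
  have hdvd : orderOf y ∣ 2 ^ 4 := by
    have := orderOf_dvd_natCard y
    rwa [hcard] at this
  obtain ⟨k, hk, hyk⟩ := (Nat.dvd_prime_pow Nat.prime_two).mp hdvd
  have hk3 : k = 3 := by
    have h4 : k ≠ 4 := by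
      rintro rfl
      exact hg (zpowers_normal_of_comm (comm_of_orderOf_eq_card (c := y) (by rw [hyk, hcard]; norm_num)) g)
    have h2 : ¬ k ≤ 2 := by
      intro hk2
      apply hy
      rw [← orderOf_dvd_iff_pow_eq_one, hyk]
      exact pow_dvd_pow 2 hk2
    omega
  subst hk3
  have hy8 : y ^ 8 = 1 := by
    rw [← orderOf_dvd_iff_pow_eq_one, hyk]
    norm_num
  have hnd : ¬ Disjoint (Subgroup.zpowers y) (Subgroup.zpowers g) := by
    intro hd
    have hle := Nat.card_le_card_of_injective _ (Subgroup.mul_injective_of_disjoint hd)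
    rw [Nat.card_prod, Nat.card_zpowers, Nat.card_zpowers, hyk, ho, hcard] at hle
    norm_num at hle
  have hmem : g ^ 2 ∈ Subgroup.zpowers y := by
    by_contra hcon
    exact hnd (disjoint_zpowers_of_orderOf_four hg4 hg2 hcon)
  have heq := eq_pow_of_sq_eq_one (a := y) (c := g ^ 2) (s := 2) (by simpa using hy8)
    (by simpa using hy) hmem (by rw [← pow_mul]; exact hg4) hg2
  norm_num at heq
  obtain ⟨x, hx⟩ : ∃ x : G, x⁻¹ * g * x ∉ Subgroup.zpowers g := by
    rw [zpowers_normal_iff] at hg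
    push Not at hg
    exact hg
  obtain ⟨h3, h4⟩ := bicyclicElement_fixed h g x
  rw [heq] at h3 h4
  have := h.orderOf_mem hy (bicyclicElement_mul g x x) (bicyclicElement_ne_zero hx) h3 h4
  rw [hyk] at this
  norm_num at this

/-- A finite group whose rational group algebra has nonzero nilpotent elements, but no unit group
of rank two, is one of the four exceptional groups. -/
lemma isExceptionalGroup_of_hasRankOneUnits [Finite G] (h : HasRankOneUnits (MonoidAlgebra ℚ G))
    (hred : ¬ IsReduced (MonoidAlgebra ℚ G)) : IsExceptionalGroup G := by
  obtain ⟨g, hg⟩ := h.exists_not_normal hred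
  have h1 := h.orderOf_of_not_normal hg
  have h2 := h.index_zpowers hg
  rw [isExceptionalGroup_iff]
  have h3 : ∀ a : G, orderOf a = 3 → (Subgroup.zpowers a).Normal := fun a ha =>
    h.zpowers_normal_of_odd (by rw [ha]; decide)
  rcases h1 with h1 | h1 <;> rw [h1] at h2 <;> rcases h2 with h2 | h2
  · exact Or.inl (hasInvertingPair_three h3 hg h1 (by decide) h2)
  · refine Or.inr (Or.inl (hasInvertingPair_four_two (fun a ha => ?_) hg h1 h2))
    by_contra hN
    have := h.index_zpowers hN
    omega
  · exact Or.inr (Or.inr (Or.inl (hasInvertingPair_three h3 hg h1 (by decide) h2)))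
  · exact Or.inr (Or.inr (Or.inr (hasInvertingPair_four_four (fun y hy => h.commute_of_sq h2 hy)
      (h.pow_four_eq_one h2 hg) hg h1 h2)))

end Exceptional


/-! ### The rational group algebras of the exceptional groups -/

section ExceptionalAlgebra

open MonoidAlgebra

variable {n m : ℕ} [NeZero n] [NeZero m] {φ : CyclicGroup m →* MulAut (CyclicGroup n)}
  {R : Type*} [Ring R] [Algebra ℚ R]

/-- The ring homomorphism from the group algebra of `Cₙ ⋊ Cₘ` determined by the images `A`, `B` of
the two generators. -/
noncomputable def inversionRingHom (hφ : ∀ c, φ (Multiplicative.ofAdd 1) c = c⁻¹) {A B : R}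
    (hA : A ^ n = 1) (hB : B ^ m = 1) (hAB : A * B * A = B) :
    MonoidAlgebra ℚ (CyclicGroup n ⋊[φ] CyclicGroup m) →+* R :=
  (MonoidAlgebra.lift ℚ R (CyclicGroup n ⋊[φ] CyclicGroup m)
    ((Units.coeHom R).comp (inversionLift hφ (A := Units.ofPowEqOne A n hA (NeZero.ne n))
      (B := Units.ofPowEqOne B m hB (NeZero.ne m)) (Units.pow_ofPowEqOne hA _)
      (Units.pow_ofPowEqOne hB _) (by
        -- The relation A B A = B is B A B⁻¹ = A⁻¹ written without inverses.
        rw [mul_inv_eq_iff_eq_mul, eq_inv_mul_iff_mul_eq, ← mul_assoc]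
        exact Units.ext hAB)))).toRingHom

lemma inversionRingHom_apply (hφ : ∀ c, φ (Multiplicative.ofAdd 1) c = c⁻¹) {A B : R}
    (hA : A ^ n = 1) (hB : B ^ m = 1) (hAB : A * B * A = B)
    (x : MonoidAlgebra ℚ (CyclicGroup n ⋊[φ] CyclicGroup m)) :
    inversionRingHom hφ hA hB hAB x = ∑ i : ZMod n, ∑ j : ZMod m,
      x.coeff ⟨Multiplicative.ofAdd i, Multiplicative.ofAdd j⟩ • (A ^ i.val * B ^ j.val) := by
  classical
  have := Fintype.ofEquiv _ (SemidirectProduct.equivProd (φ := φ)).symm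
  rw [← Fintype.sum_prod_type' (f := fun (i : ZMod n) (j : ZMod m) =>
    x.coeff ⟨Multiplicative.ofAdd i, Multiplicative.ofAdd j⟩ • (A ^ i.val * B ^ j.val))]
  show MonoidAlgebra.lift ℚ R _ _ x = _
  rw [MonoidAlgebra.lift_apply, Finsupp.sum_fintype _ _ (by simp),
    ← (SemidirectProduct.equivProd (φ := φ)).symm.sum_comp]
  exact Fintype.sum_equiv (Equiv.prodCongr Multiplicative.toAdd Multiplicative.toAdd) _ _
    fun i => rfl

lemma eq_zero_of_coeff {n m : ℕ} {φ : CyclicGroup m →* MulAut (CyclicGroup n)}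
    {x : MonoidAlgebra ℚ (CyclicGroup n ⋊[φ] CyclicGroup m)}
    (h : ∀ (i : ZMod n) (j : ZMod m),
      x.coeff ⟨Multiplicative.ofAdd i, Multiplicative.ofAdd j⟩ = 0) : x = 0 := by
  ext g
  exact h _ _

open Quaternion Matrix

/-- A criterion in terms of one matrix representation and several quaternion representations. -/
lemma hasRankOneUnits_of_representations (hφ : ∀ c, φ (Multiplicative.ofAdd 1) c = c⁻¹)
    {b : ℚ} (hb : b ^ 2 < 4) {A B : Matrix (Fin 2) (Fin 2) ℚ} (hA : A ^ n = 1) (hB : B ^ m = 1)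
    (hAB : A * B * A = B) {r : ℕ} (P Q : Fin r → ℍ[ℚ,-1,b,-1]) (hP : ∀ k, P k ^ n = 1)
    (hQ : ∀ k, Q k ^ m = 1) (hPQ : ∀ k, P k * Q k * P k = Q k)
    (hinj : ∀ c : ZMod n → ZMod m → ℚ,
      ∑ i : ZMod n, ∑ j : ZMod m, c i j • (A ^ i.val * B ^ j.val) = 0 →
      (∀ k, ∑ i : ZMod n, ∑ j : ZMod m, c i j • (P k ^ i.val * Q k ^ j.val) = 0) →
      ∀ i j, c i j = 0) :
    HasRankOneUnits (MonoidAlgebra ℚ (CyclicGroup n ⋊[φ] CyclicGroup m)) := by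
  refine hasRankOneUnits_of_injective (inversionRingHom hφ hA hB hAB)
    (fun k => inversionRingHom hφ (hP k) (hQ k) (hPQ k)) hasRankOneUnits_matrix
    (fun _ => hasTorsionUnits_quaternion (by linarith) (by norm_num)) ?_
  intro x hx hy
  apply eq_zero_of_coeff
  refine hinj (fun i j => x.coeff ⟨Multiplicative.ofAdd i, Multiplicative.ofAdd j⟩) ?_ ?_
  · rw [← hx, inversionRingHom_apply]
  · intro k
    rw [← hy k, inversionRingHom_apply]

/-- The algebra is ℚ ⊕ ℚ ⊕ M₂(ℚ). The pairs (1, ±1) are the two linear characters, with values in ℚ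
inside the quaternions. -/
lemma hasRankOneUnits_three_two {φ : CyclicGroup 2 →* MulAut (CyclicGroup 3)}
    (hφ : ∀ c, φ (Multiplicative.ofAdd 1) c = c⁻¹) :
    HasRankOneUnits (MonoidAlgebra ℚ (CyclicGroup 3 ⋊[φ] CyclicGroup 2)) := by
  refine hasRankOneUnits_of_representations hφ (b := 0) (by norm_num)
    (A := !![0, -1; 1, -1]) (B := !![0, 1; 1, 0])
    (by simp [pow_succ, Matrix.one_fin_two]) (by simp [pow_succ, Matrix.one_fin_two]) (by simp)
    ![1, 1] ![1, -1]
    (by simp [Fin.forall_fin_succ]) (by simp [Fin.forall_fin_succ]) (by simp [Fin.forall_fin_succ])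
    ?_
  intro c hx hy
  -- Writing `ZMod` as `Fin` lets the sums unfold into a linear system, whose only solution is zero.
  change ∑ i : Fin 3, ∑ j : Fin 2, c i j • (_ ^ (i : ℕ) * _ ^ (j : ℕ)) = 0 at hx
  change ∀ k, ∑ i : Fin 3, ∑ j : Fin 2, c i j • (_ ^ (i : ℕ) * _ ^ (j : ℕ)) = 0 at hy
  simp [Fin.sum_univ_succ, pow_succ, ← Matrix.ext_iff, Fin.forall_fin_succ,
    QuaternionAlgebra.ext_iff] at hx hy
  intro (i : Fin 3) (j : Fin 2)
  fin_cases i <;> fin_cases j <;> simp <;> linarith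

lemma hasRankOneUnits_four_two {φ : CyclicGroup 2 →* MulAut (CyclicGroup 4)}
    (hφ : ∀ c, φ (Multiplicative.ofAdd 1) c = c⁻¹) :
    HasRankOneUnits (MonoidAlgebra ℚ (CyclicGroup 4 ⋊[φ] CyclicGroup 2)) := by
  refine hasRankOneUnits_of_representations hφ (b := 0) (by norm_num)
    (A := !![0, -1; 1, 0]) (B := !![0, 1; 1, 0])
    (by simp [pow_succ, Matrix.one_fin_two]) (by simp [pow_succ, Matrix.one_fin_two]) (by simp)
    ![1, 1, -1, -1] ![1, -1, 1, -1]
    (by simp [Fin.forall_fin_succ, pow_succ]) (by simp [Fin.forall_fin_succ])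
    (by simp [Fin.forall_fin_succ]) ?_
  intro c hx hy
  change ∑ i : Fin 4, ∑ j : Fin 2, c i j • (_ ^ (i : ℕ) * _ ^ (j : ℕ)) = 0 at hx
  change ∀ k, ∑ i : Fin 4, ∑ j : Fin 2, c i j • (_ ^ (i : ℕ) * _ ^ (j : ℕ)) = 0 at hy
  simp [Fin.sum_univ_succ, pow_succ, ← Matrix.ext_iff, Fin.forall_fin_succ,
    QuaternionAlgebra.ext_iff] at hx hy
  intro (i : Fin 4) (j : Fin 2)
  fin_cases i <;> fin_cases j <;> simp <;> linarith

-- With b = -1 the quaternion i satisfies i² = -1 - i, so it has order 3 and j inverts it. The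
-- algebra is 2ℚ ⊕ ℚ(√-1) ⊕ M₂(ℚ) plus this quaternion algebra, and the pair (1, j) yields the
-- quadratic field.
set_option maxHeartbeats 2000000 in
lemma hasRankOneUnits_three_four {φ : CyclicGroup 4 →* MulAut (CyclicGroup 3)}
    (hφ : ∀ c, φ (Multiplicative.ofAdd 1) c = c⁻¹) :
    HasRankOneUnits (MonoidAlgebra ℚ (CyclicGroup 3 ⋊[φ] CyclicGroup 4)) := by
  refine hasRankOneUnits_of_representations hφ (b := -1) (by norm_num)
    (A := !![0, -1; 1, -1]) (B := !![0, 1; 1, 0])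
    (by simp [pow_succ, Matrix.one_fin_two]) (by simp [pow_succ, Matrix.one_fin_two]) (by simp)
    ![1, 1, 1, ⟨0, 1, 0, 0⟩] ![1, -1, ⟨0, 0, 1, 0⟩, ⟨0, 0, 1, 0⟩]
    (by simp [Fin.forall_fin_succ, pow_succ, QuaternionAlgebra.ext_iff])
    (by simp [Fin.forall_fin_succ, pow_succ, QuaternionAlgebra.ext_iff])
    (by simp [Fin.forall_fin_succ]) ?_
  intro c hx hy
  change ∑ i : Fin 3, ∑ j : Fin 4, c i j • (_ ^ (i : ℕ) * _ ^ (j : ℕ)) = 0 at hx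
  change ∀ k, ∑ i : Fin 3, ∑ j : Fin 4, c i j • (_ ^ (i : ℕ) * _ ^ (j : ℕ)) = 0 at hy
  simp [Fin.sum_univ_succ, pow_succ, ← Matrix.ext_iff, Fin.forall_fin_succ,
    QuaternionAlgebra.ext_iff] at hx hy
  intro (i : Fin 3) (j : Fin 4)
  fin_cases i <;> fin_cases j <;> simp <;> linarith

-- The algebra is 4ℚ ⊕ 2ℚ(√-1) ⊕ M₂(ℚ) plus the Hamilton quaternions, given in turn by the pairs
-- (±1, ±1), (±1, j), the matrices, and (i, j).
set_option maxHeartbeats 2000000 in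
lemma hasRankOneUnits_four_four {φ : CyclicGroup 4 →* MulAut (CyclicGroup 4)}
    (hφ : ∀ c, φ (Multiplicative.ofAdd 1) c = c⁻¹) :
    HasRankOneUnits (MonoidAlgebra ℚ (CyclicGroup 4 ⋊[φ] CyclicGroup 4)) := by
  refine hasRankOneUnits_of_representations hφ (b := 0) (by norm_num)
    (A := !![0, -1; 1, 0]) (B := !![0, 1; 1, 0])
    (by simp [pow_succ, Matrix.one_fin_two]) (by simp [pow_succ, Matrix.one_fin_two]) (by simp)
    ![1, 1, 1, -1, -1, -1, ⟨0, 1, 0, 0⟩]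
    ![1, -1, ⟨0, 0, 1, 0⟩, 1, -1, ⟨0, 0, 1, 0⟩, ⟨0, 0, 1, 0⟩]
    (by simp [Fin.forall_fin_succ, pow_succ, QuaternionAlgebra.ext_iff])
    (by simp [Fin.forall_fin_succ, pow_succ, QuaternionAlgebra.ext_iff])
    (by simp [Fin.forall_fin_succ]) ?_
  intro c hx hy
  change ∑ i : Fin 4, ∑ j : Fin 4, c i j • (_ ^ (i : ℕ) * _ ^ (j : ℕ)) = 0 at hx
  change ∀ k, ∑ i : Fin 4, ∑ j : Fin 4, c i j • (_ ^ (i : ℕ) * _ ^ (j : ℕ)) = 0 at hy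
  simp [Fin.sum_univ_succ, pow_succ, ← Matrix.ext_iff, Fin.forall_fin_succ,
    QuaternionAlgebra.ext_iff] at hx hy
  intro (i : Fin 4) (j : Fin 4)
  fin_cases i <;> fin_cases j <;> simp <;> linarith

lemma HasRankOneUnits.of_mulEquiv {G H : Type*} [Group G] [Group H] (e : G ≃* H)
    (h : HasRankOneUnits (MonoidAlgebra ℚ H)) : HasRankOneUnits (MonoidAlgebra ℚ G) :=
  hasRankOneUnits_of_injective' (f := MonoidAlgebra.mapDomainRingHom ℚ e.toMonoidHom)
    (MonoidAlgebra.mapDomain_injective e.injective) h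

lemma IsExceptionalGroup.hasRankOneUnits {G : Type u} [Group G] (h : IsExceptionalGroup G) :
    HasRankOneUnits (MonoidAlgebra ℚ G) := by
  have i32 := inversionHom_ofAdd_one 3 2 (by norm_num)
  have i42 := inversionHom_ofAdd_one 4 2 (by norm_num)
  have i34 := inversionHom_ofAdd_one 3 4 (by norm_num)
  have i44 := inversionHom_ofAdd_one 4 4 (by norm_num)
  rcases isExceptionalGroup_iff.mp h with h | h | h | h
  · obtain ⟨e⟩ := h.nonempty_mulEquiv i32
    exact (hasRankOneUnits_three_two i32).of_mulEquiv e
  · obtain ⟨e⟩ := h.nonempty_mulEquiv i42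
    exact (hasRankOneUnits_four_two i42).of_mulEquiv e
  · obtain ⟨e⟩ := h.nonempty_mulEquiv i34
    exact (hasRankOneUnits_three_four i34).of_mulEquiv e
  · obtain ⟨e⟩ := h.nonempty_mulEquiv i44
    exact (hasRankOneUnits_four_four i44).of_mulEquiv e

end ExceptionalAlgebra


/-! ### Ideals of semisimple rings -/

section Semisimple

variable {A : Type*} [Ring A]

/-- The component of 1 in L along a complement of L is a right identity. -/
lemma exists_right_identity [IsSemisimpleRing A] (L : Ideal A) : ∃ f ∈ L, ∀ x ∈ L, x * f = x := by
  obtain ⟨W, hW⟩ := exists_isCompl L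
  have h1 : (1 : A) ∈ L ⊔ W := by rw [hW.sup_eq_top]; trivial
  obtain ⟨f, hf, w, hw, hfw⟩ := Submodule.mem_sup.mp h1
  refine ⟨f, hf, fun x hx => ?_⟩
  have h2 : x * w = x - x * f := by rw [eq_sub_iff_add_eq', ← mul_add, hfw, mul_one]
  have h3 : x * w ∈ L := by rw [h2]; exact L.sub_mem hx (L.mul_mem_left x hf)
  have h4 : x * w = 0 := Submodule.disjoint_def.mp hW.disjoint _ h3 (W.smul_mem x hw)
  rw [h4] at h2
  exact (sub_eq_zero.mp h2.symm).symm

/-- A two-sided ideal of a semisimple ring is generated by a central idempotent. -/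
lemma exists_central_identity [IsSemisimpleRing A] (L : Ideal A)
    (hL : ∀ x ∈ L, ∀ a : A, x * a ∈ L) :
    ∃ z ∈ L, (∀ x ∈ L, z * x = x) ∧ ∀ a, a * z = z * a := by
  obtain ⟨z, hz, hzr⟩ := exists_right_identity L
  have hzl : ∀ x ∈ L, z * x = x := by
    intro x hx
    -- The defect n lies in L and L n = 0. The left ideal A n has a right identity a n, so n = (n a)
    -- n with n a in L, whence n = 0.
    obtain ⟨n, hn⟩ : ∃ n, n = z * x - x := ⟨_, rfl⟩
    have hnL : n ∈ L := by rw [hn]; exact L.sub_mem (L.mul_mem_left z hx) hx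
    have hLn : ∀ y ∈ L, y * n = 0 := by
      intro y hy
      rw [hn, mul_sub, ← mul_assoc, hzr y hy, sub_self]
    obtain ⟨f, hf, hfr⟩ := exists_right_identity (Ideal.span {n})
    obtain ⟨a, rfl⟩ := Ideal.mem_span_singleton'.mp hf
    have h1 := hfr n (Ideal.mem_span_singleton_self n)
    rw [← mul_assoc, hLn _ (hL n hnL a)] at h1
    rw [← h1] at hn
    exact sub_eq_zero.mp hn.symm
  refine ⟨z, hz, hzl, fun a => ?_⟩
  rw [← hzl (a * z) (L.mul_mem_left a hz), ← mul_assoc, hzr _ (hL z hz a)]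

end Semisimple

/-! ### Algebras with a multiplicative basis -/

/-- `β` is a basis of the algebra `A` that is closed under multiplication. -/
structure IsSemigroupBasis {S A : Type*} [Semigroup S] [Ring A] [Algebra ℚ A] (β : S → A) :
    Prop where
  map_mul : ∀ s t, β (s * t) = β s * β t
  linearIndependent : LinearIndependent ℚ β
  span_eq_top : Submodule.span ℚ (Set.range β) = ⊤

section Basis

variable {S A : Type*} [Semigroup S] [Ring A] [Algebra ℚ A] {β : S → A}

/-- The finite set β(S) ∪ {1} is closed under multiplication, so it spans an order. The identity is
added because it need not be an integral combination of β(S). -/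
lemma IsSemigroupBasis.exists_isZOrder [Finite S] (h : IsSemigroupBasis β) :
    ∃ Γ : Subring A, IsZOrder Γ := by
  have hclosure : (Submonoid.closure (Set.range β) : Set A) ⊆ insert 1 (Set.range β) := by
    intro x hx
    induction hx using Submonoid.closure_induction with
    | mem x hx => exact Or.inr hx
    | one => exact Or.inl rfl
    | mul x y _ _ hx hy =>
      rcases hx with rfl | ⟨s, rfl⟩
      · rwa [one_mul]
      · rcases hy with rfl | ⟨t, rfl⟩
        · rw [mul_one]; exact Or.inr ⟨s, rfl⟩
        · exact Or.inr ⟨s * t, h.map_mul s t⟩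
  have hfin : (Submonoid.closure (Set.range β) : Set A).Finite :=
    ((Set.finite_range β).insert 1).subset hclosure
  refine ⟨(Algebra.adjoin ℤ (Set.range β)).toSubring, ?_, ?_⟩
  · have hfg : (Subalgebra.toSubmodule (Algebra.adjoin ℤ (Set.range β))).FG := by
      rw [Algebra.adjoin_eq_span]
      exact Submodule.fg_span hfin
    exact Module.Finite.iff_fg.mpr hfg
  · rw [eq_top_iff, ← h.span_eq_top]
    exact Submodule.span_mono Algebra.subset_adjoin

/-- The span of a set of basis elements. -/
def IsSemigroupBasis.ideal (h : IsSemigroupBasis β) {I : Set S} (hI : IsSemigroupIdeal I) : Ideal A where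
  carrier := Submodule.span ℚ (β '' I)
  zero_mem' := Submodule.zero_mem _
  add_mem' := Submodule.add_mem _
  smul_mem' := by
    intro a x hx
    have ha : a ∈ Submodule.span ℚ (Set.range β) := by rw [h.span_eq_top]; trivial
    have := Submodule.mul_mem_mul ha hx
    rw [Submodule.span_mul_span] at this
    refine Submodule.span_mono ?_ this
    rintro _ ⟨_, ⟨s, rfl⟩, _, ⟨t, ht, rfl⟩, rfl⟩
    exact ⟨s * t, (hI s t ht).1, h.map_mul s t⟩

lemma IsSemigroupBasis.mem_ideal (h : IsSemigroupBasis β) {I : Set S} (hI : IsSemigroupIdeal I)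
    {x : A} : x ∈ h.ideal hI ↔ x ∈ Submodule.span ℚ (β '' I) := Iff.rfl

lemma IsSemigroupBasis.mul_mem_span (h : IsSemigroupBasis β) {I : Set S} (hI : IsSemigroupIdeal I)
    {x : A} (hx : x ∈ Submodule.span ℚ (β '' I)) (a : A) : x * a ∈ Submodule.span ℚ (β '' I) := by
  have ha : a ∈ Submodule.span ℚ (Set.range β) := by rw [h.span_eq_top]; trivial
  have := Submodule.mul_mem_mul hx ha
  rw [Submodule.span_mul_span] at this
  refine Submodule.span_mono ?_ this
  rintro _ ⟨_, ⟨t, ht, rfl⟩, _, ⟨s, rfl⟩, rfl⟩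
  exact ⟨t * s, (hI s t ht).2, h.map_mul t s⟩

lemma IsSemigroupBasis.exists_central_idempotent [IsSemisimpleRing A] (h : IsSemigroupBasis β)
    {I : Set S} (hI : IsSemigroupIdeal I) : ∃ z ∈ Submodule.span ℚ (β '' I),
      (∀ x ∈ Submodule.span ℚ (β '' I), z * x = x) ∧ ∀ a, a * z = z * a :=
  exists_central_identity (h.ideal hI) fun _ hx a => h.mul_mem_span hI hx a

lemma IsSemigroupBasis.mem_of_mem_span (h : IsSemigroupBasis β) {I : Set S} {s : S}
    (hs : β s ∈ Submodule.span ℚ (β '' I)) : s ∈ I := by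
  by_contra hcon
  exact h.linearIndependent.notMem_span_image hcon hs

/-- Over a semisimple algebra, ideals of ideals are ideals. -/
lemma IsSemigroupBasis.isSemigroupIdeal_of_subset [IsSemisimpleRing A] (h : IsSemigroupBasis β)
    {I J : Set S} (hI : IsSemigroupIdeal I) (hJI : J ⊆ I)
    (hJ : ∀ t ∈ I, ∀ a ∈ J, t * a ∈ J ∧ a * t ∈ J) : IsSemigroupIdeal J := by
  obtain ⟨z, hz, hzx, hzc⟩ := h.exists_central_idempotent hI
  intro s a ha
  have haI : β a ∈ Submodule.span ℚ (β '' I) := Submodule.subset_span ⟨a, hJI ha, rfl⟩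
  have haJ : β a ∈ Submodule.span ℚ (β '' J) := Submodule.subset_span ⟨a, ha, rfl⟩
  have hsz : β s * z ∈ Submodule.span ℚ (β '' I) := by
    rw [hzc]; exact h.mul_mem_span hI hz _
  constructor
  -- Since z acts as the identity on a ∈ I, the element s may be replaced by s z, which lies in the
  -- span of I. So s a lies in the span of J, and β being a basis puts it in J.
  · apply h.mem_of_mem_span
    rw [h.map_mul, ← hzx _ haI, ← mul_assoc]
    have := Submodule.mul_mem_mul hsz haJ
    rw [Submodule.span_mul_span] at this
    refine Submodule.span_mono ?_ this
    rintro _ ⟨_, ⟨t, ht, rfl⟩, _, ⟨a, ha, rfl⟩, rfl⟩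
    exact ⟨t * a, (hJ t ht a ha).1, h.map_mul t a⟩
  · apply h.mem_of_mem_span
    rw [h.map_mul, ← hzx _ haI, ← hzc, mul_assoc, ← hzc]
    have := Submodule.mul_mem_mul haJ hsz
    rw [Submodule.span_mul_span] at this
    refine Submodule.span_mono ?_ this
    rintro _ ⟨_, ⟨a, ha, rfl⟩, _, ⟨t, ht, rfl⟩, rfl⟩
    exact ⟨a * t, (hJ t ht a ha).2, h.map_mul a t⟩

end Basis

/-! ### Existence of principal series -/

section PrincipalSeries

variable {S : Type u} [Semigroup S]

/-- An ideal, considered as a subsemigroup. -/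
def IsSemigroupIdeal.subsemigroup {I : Set S} (hI : IsSemigroupIdeal I) : Subsemigroup S where
  carrier := I
  mul_mem' := fun {a _} _ hb => (hI a _ hb).1

/-- The next term is maximal among the ideals of S strictly inside T. By `hS` ideals of T are ideals
of S, so it is also maximal as an ideal of T. -/
lemma exists_chain_of_ideal [Finite S]
    (hS : ∀ I J : Set S, IsSemigroupIdeal I → J ⊆ I → (∀ t ∈ I, ∀ a ∈ J, t * a ∈ J ∧ a * t ∈ J) →
      IsSemigroupIdeal J) (N : ℕ) : ∀ T : Subsemigroup S, IsSemigroupIdeal (T : Set S) →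
      (T : Set S).ncard ≤ N → ∃ (n : ℕ) (t : ℕ → Subsemigroup S), t 0 = T ∧ t n = ⊥ ∧
        (∀ i, IsSemigroupIdeal (t i : Set S)) ∧ (∀ i < n, t (i + 1) ≤ t i ∧
          IsMaximalSemigroupIdeal {x : t i | (x : S) ∈ t (i + 1)}) := by
  induction N with
  | zero =>
    intro T hT hN
    have h0 : (T : Set S) = ∅ := (Set.ncard_eq_zero (Set.toFinite _)).mp (Nat.le_zero.mp hN)
    refine ⟨0, fun _ => T, rfl, SetLike.coe_injective (h0.trans Subsemigroup.coe_bot.symm),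
      fun _ => hT, fun i hi => absurd hi (Nat.not_lt_zero i)⟩
  | succ N ih =>
    intro T hT hN
    by_cases hT0 : T = ⊥
    · exact ⟨0, fun _ => T, rfl, hT0, fun _ => hT, fun i hi => absurd hi (Nat.not_lt_zero i)⟩
    have hne : ({J : Set S | IsSemigroupIdeal J ∧ J ⊂ T}).Nonempty := by
      refine ⟨∅, fun _ _ h => absurd h (Set.notMem_empty _), ?_⟩
      rw [Set.empty_ssubset, Set.nonempty_iff_ne_empty]
      intro h
      exact hT0 (SetLike.coe_injective (h.trans Subsemigroup.coe_bot.symm))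
    obtain ⟨J, ⟨hJ, hJT⟩, hmax⟩ := (Set.toFinite _).exists_maximal hne
    have hlt : J.ncard < (T : Set S).ncard := Set.ncard_lt_ncard hJT (Set.toFinite _)
    obtain ⟨n, t, ht0, htn, hid, hstep⟩ := ih hJ.subsemigroup hJ (by
      show J.ncard ≤ N
      omega)
    refine ⟨n + 1, fun i => Nat.casesOn i T t, rfl, htn, ?_, ?_⟩
    · rintro (_ | i)
      · exact hT
      · exact hid i
    · rintro (_ | i) hi
      · have h0 : ∀ x : S, x ∈ t 0 ↔ x ∈ J := fun x => by rw [ht0]; exact Iff.rfl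
        refine ⟨fun x hx => hJT.1 ((h0 x).mp hx), ?_, ?_, ?_⟩
        · intro x a ha
          have ha' : (a : S) ∈ J := (h0 _).mp ha
          exact ⟨(h0 _).mpr (hJ x _ ha').1, (h0 _).mpr (hJ x _ ha').2⟩
        · intro huniv
          obtain ⟨y, hyT, hyJ⟩ := Set.exists_of_ssubset hJT
          have : (⟨y, hyT⟩ : T) ∈ {x : T | (x : S) ∈ t 0} := by
            have h2 : {x : T | (x : S) ∈ t 0} = Set.univ := huniv
            rw [h2]; trivial
          exact hyJ ((h0 y).mp this)
        · intro K hK hJK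
          have hK' : IsSemigroupIdeal ((fun x : T => (x : S)) '' K) := by
            apply hS T _ hT
            · rintro _ ⟨x, _, rfl⟩; exact x.2
            · rintro y hy _ ⟨x, hx, rfl⟩
              exact ⟨⟨⟨y, hy⟩ * x, (hK ⟨y, hy⟩ x hx).1, rfl⟩,
                ⟨x * ⟨y, hy⟩, (hK ⟨y, hy⟩ x hx).2, rfl⟩⟩
          have hJK' : J ⊆ (fun x : T => (x : S)) '' K := fun y hy =>
            ⟨⟨y, hJT.1 hy⟩, hJK ((h0 y).mpr hy), rfl⟩
          by_cases hKT : (fun x : T => (x : S)) '' K ⊂ T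
          · left
            have h3 := hmax ⟨hK', hKT⟩ hJK'
            apply Set.Subset.antisymm _ hJK
            intro x hx
            exact (h0 _).mpr (h3 ⟨x, hx, rfl⟩)
          · right
            have hsub : (fun x : T => (x : S)) '' K ⊆ T := by rintro _ ⟨x, _, rfl⟩; exact x.2
            have h4 : (T : Set S) ⊆ (fun x : T => (x : S)) '' K := by
              by_contra h5
              exact hKT ⟨hsub, h5⟩
            rw [Set.eq_univ_iff_forall]
            intro x
            obtain ⟨y, hy, hyx⟩ := h4 x.2
            rwa [Subtype.ext hyx] at hy
      · exact hstep i (by omega)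

lemma exists_principalSeries [Finite S]
    (hS : ∀ I J : Set S, IsSemigroupIdeal I → J ⊆ I → (∀ t ∈ I, ∀ a ∈ J, t * a ∈ J ∧ a * t ∈ J) →
      IsSemigroupIdeal J) : Nonempty (PrincipalSeries S) := by
  obtain ⟨n, t, ht0, htn, hid, hstep⟩ := exists_chain_of_ideal hS _ (⊤ : Subsemigroup S)
    (fun _ _ _ => ⟨trivial, trivial⟩) le_rfl
  exact ⟨{
    length := n
    term := fun i => t i
    term_zero := ht0
    term_last := htn
    isIdeal := fun i => hid i
    le := fun i => (hstep i i.2).1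
    isMaximal := fun i => (hstep i i.2).2 }⟩

end PrincipalSeries


/-! ### Simple semigroups that are bases of algebras with rank one units -/

section ReesMatrix

variable {F : Type*} [SemigroupWithZero F]

open Classical in
lemma ReesMatrix.entry_mul_entry {G : Type u} [Group G] {I Λ : Type v}
    (P : Matrix Λ I (WithZero G)) (i j : I) (a b : G) (l k : Λ) :
    (ReesMatrix.entry i a l : ReesMatrix P) * ReesMatrix.entry j b k =
      if h : P l j = 0 then .zero else .entry i (a * WithZero.unzero h * b) k := by
  rfl

/-- Coordinates of a Rees matrix semigroup over the trivial group. -/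
lemma nonempty_mulEquiv_reesMatrix {P : Matrix (Fin 2) (Fin 2) (WithZero Unit)} {e : F}
    {r l : Fin 2 → F} (hr : ∀ i, r i * e = r i)
    (hP : ∀ j i, (P j i = 0 ∧ l j * r i = 0) ∨ (P j i ≠ 0 ∧ l j * r i = e))
    (h0 : ∀ i j, r i * l j ≠ 0) (hinj : ∀ i j i' j', r i * l j = r i' * l j' → i = i' ∧ j = j')
    (hsurj : ∀ f, f ≠ 0 → ∃ i j, f = r i * l j) : Nonempty (F ≃* ReesMatrix P) := by
  classical
  let φ : ReesMatrix P → F := fun x => match x with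
    | .zero => 0
    | .entry i _ j => r i * l j
  have hbij : Function.Bijective φ := by
    constructor
    · rintro (_ | ⟨i, a, j⟩) (_ | ⟨i', a', j'⟩) h
      · rfl
      · exact absurd h.symm (h0 _ _)
      · exact absurd h (h0 _ _)
      · obtain ⟨rfl, rfl⟩ := hinj _ _ _ _ h
        rfl
    · intro f
      by_cases hf : f = 0
      · exact ⟨.zero, hf.symm⟩
      · obtain ⟨i, j, h⟩ := hsurj f hf
        exact ⟨.entry i () j, h.symm⟩
  refine ⟨(MulEquiv.mk (Equiv.ofBijective φ hbij) ?_).symm⟩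
  rintro (_ | ⟨i, a, j⟩) y
  · exact (zero_mul _).symm
  rcases y with _ | ⟨i', a', j'⟩
  · exact (mul_zero _).symm
  show φ (ReesMatrix.entry i a j * ReesMatrix.entry i' a' j') = (r i * l j) * (r i' * l j')
  have e1 : (r i * l j) * (r i' * l j') = r i * (l j * r i') * l j' := by simp only [mul_assoc]
  rw [ReesMatrix.entry_mul_entry, e1]
  rcases hP j i' with ⟨h1, h2⟩ | ⟨h1, h2⟩
  · rw [dif_pos h1, h2, mul_zero, zero_mul]
  · rw [dif_neg h1, h2, hr]

end ReesMatrix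

/-! ### Idempotents, inverses and one-sided ideals of a factor -/

section Factor

variable {F A : Type*} [SemigroupWithZero F] [Ring A] [Algebra ℚ A]

/-- The nonzero elements of the semigroup `F` without proper ideals form a basis of the block of
`A` with identity `ε`. -/
structure IsFactorBasis (κ : F → A) (ε : A) : Prop where
  map_zero : κ 0 = 0
  map_mul : ∀ f g, κ (f * g) = κ f * κ g
  notMem_span : ∀ {f : F} {T : Set F}, f ≠ 0 → f ∉ T → κ f ∉ Submodule.span ℚ (κ '' T)
  mem_span : ε ∈ Submodule.span ℚ (Set.range κ)
  left_id : ∀ f, ε * κ f = κ f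
  right_id : ∀ f, κ f * ε = κ f
  exists_mul_mul : ∀ f g : F, f ≠ 0 → ∃ a b, a * f * b = g
  exists_ne_zero : ∃ f : F, f ≠ 0

variable {κ : F → A} {ε : A}

lemma IsFactorBasis.map_eq_zero (h : IsFactorBasis κ ε) {f : F} (hf : κ f = 0) : f = 0 := by
  by_contra h0
  apply h.notMem_span h0 (Set.notMem_empty f)
  rw [hf]
  exact Submodule.zero_mem _

lemma IsFactorBasis.injective (h : IsFactorBasis κ ε) {f g : F} (hfg : κ f = κ g) : f = g := by
  by_cases hf : f = 0
  · rw [hf, h.map_zero] at hfg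
    rw [hf, h.map_eq_zero hfg.symm]
  by_contra hne
  apply h.notMem_span (T := {g}) hf hne
  rw [hfg]
  exact Submodule.subset_span ⟨g, rfl, rfl⟩

lemma IsFactorBasis.eq_zero_of_left (h : IsFactorBasis κ ε) {x : A} (hx : ∀ f, κ f * x = 0) :
    ε * x = 0 := by
  have := h.mem_span
  clear h
  induction this using Submodule.span_induction with
  | mem y hy => obtain ⟨f, rfl⟩ := hy; exact hx f
  | zero => exact zero_mul x
  | add y z _ _ hy hz => rw [add_mul, hy, hz, add_zero]
  | smul c y _ hy => rw [smul_mul_assoc, hy, smul_zero]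

lemma IsFactorBasis.eq_zero_of_right (h : IsFactorBasis κ ε) {x : A} (hx : ∀ f, x * κ f = 0) :
    x * ε = 0 := by
  have := h.mem_span
  clear h
  induction this using Submodule.span_induction with
  | mem y hy => obtain ⟨f, rfl⟩ := hy; exact hx f
  | zero => exact mul_zero x
  | add y z _ _ hy hz => rw [mul_add, hy, hz, add_zero]
  | smul c y _ hy => rw [mul_smul_comm, hy, smul_zero]

lemma IsFactorBasis.map_pow (h : IsFactorBasis κ ε) (a : F) (n : ℕ) :
    ∃ b, κ b = κ a ^ (n + 1) := by
  induction n with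
  | zero => exact ⟨a, by rw [zero_add, pow_one]⟩
  | succ n ih =>
    obtain ⟨b, hb⟩ := ih
    exact ⟨b * a, by rw [h.map_mul, hb, ← pow_succ]⟩

lemma exists_idempotent_pow {M : Type*} [Monoid M] {a : M} {i p : ℕ} (hp : 0 < p)
    (h : a ^ (i + p) = a ^ i) : ∃ n, a ^ (n + 1) * a ^ (n + 1) = a ^ (n + 1) := by
  have h1 : ∀ k m, a ^ (i + m + k * p) = a ^ (i + m) := by
    intro k
    induction k with
    | zero => intro m; rw [zero_mul, add_zero]
    | succ k ih =>
      intro m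
      have e : i + m + (k + 1) * p = (i + p) + (m + k * p) := by ring
      rw [e, pow_add, h, ← pow_add, ← add_assoc, ih]
  -- The exponent (i + 1) p is a multiple of the period and lies beyond the preperiod i.
  refine ⟨(i + 1) * p - 1, ?_⟩
  have h2 : (i + 1) * p - 1 + 1 = (i + 1) * p := Nat.sub_add_cancel (Nat.mul_pos i.succ_pos hp)
  rw [h2, ← pow_add]
  have h3 : i ≤ (i + 1) * p := by nlinarith
  obtain ⟨m, hm⟩ := Nat.exists_eq_add_of_le h3
  have h4 := h1 (i + 1) m
  rwa [← hm] at h4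

/-- From f = a f b follows f = aⁿ f bⁿ, so no power of a is zero, and some power of a is idempotent.
-/
lemma IsFactorBasis.exists_idempotent [Finite F] (h : IsFactorBasis κ ε) :
    ∃ e : F, e ≠ 0 ∧ e * e = e := by
  obtain ⟨f, hf⟩ := h.exists_ne_zero
  obtain ⟨a, b, hab⟩ := h.exists_mul_mul f f hf
  have hpow : ∀ n, κ a ^ n * κ f * κ b ^ n = κ f := by
    intro n
    induction n with
    | zero => simp
    | succ n ih =>
      calc κ a ^ (n + 1) * κ f * κ b ^ (n + 1) = κ a ^ n * (κ a * κ f * κ b) * κ b ^ n := by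
            rw [pow_succ, pow_succ']; simp only [mul_assoc]
        _ = κ f := by rw [← h.map_mul, ← h.map_mul, hab, ih]
  obtain ⟨i, j, hij, heq⟩ : ∃ i j : ℕ, i < j ∧ κ a ^ (i + 1) = κ a ^ (j + 1) := by
    choose c hc using h.map_pow a
    obtain ⟨i, j, hij, h1⟩ := Finite.exists_ne_map_eq_of_infinite c
    rcases lt_or_gt_of_ne hij with h2 | h2
    · exact ⟨i, j, h2, by rw [← hc, ← hc, h1]⟩
    · exact ⟨j, i, h2, by rw [← hc, ← hc, h1]⟩
  obtain ⟨n, hn⟩ := exists_idempotent_pow (a := κ a) (i := i + 1) (p := j - i)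
    (by omega) (by rw [heq]; congr 1; omega)
  obtain ⟨e, he⟩ := h.map_pow a n
  refine ⟨e, ?_, h.injective (by rw [h.map_mul, he, hn])⟩
  rintro rfl
  have h2 := hpow (n + 1)
  rw [← he, h.map_zero, zero_mul, zero_mul] at h2
  exact hf (h.map_eq_zero h2.symm)

/-- Nonzero elements of `e F e` are invertible. -/
lemma IsFactorBasis.exists_inverse [Finite F] (h : IsFactorBasis κ ε) {e x : F} (he : e * e = e)
    (hx0 : x ≠ 0) (hex : e * x = x) (hxe : x * e = x) :
    ∃ y, e * y = y ∧ y * e = y ∧ x * y = e ∧ y * x = e := by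
  -- One-sided inverses in the finite monoid e F e are two-sided.
  have key : ∀ u v : F, e * u = u → u * e = u → e * v = v → v * e = v → u * v = e → v * u = e := by
    intro u v hu1 hu2 hv1 hv2 huv
    let M := {z : F // e * z = z ∧ z * e = z}
    let f : M → M := fun z => ⟨v * z, by rw [← mul_assoc, hv1], by rw [mul_assoc, z.2.2]⟩
    have hf : Function.Injective f := by
      intro z w hzw
      have h1 : v * (z : F) = v * w := congrArg Subtype.val hzw
      have h2 : u * (v * (z : F)) = u * (v * w) := by rw [h1]
      rw [← mul_assoc, ← mul_assoc, huv, z.2.1, w.2.1] at h2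
      exact Subtype.ext h2
    obtain ⟨w, hw⟩ := Finite.surjective_of_injective hf ⟨e, he, he⟩
    have hw' : v * (w : F) = e := congrArg Subtype.val hw
    have h3 : u * (v * (w : F)) = u * e := by rw [hw']
    rw [← mul_assoc, huv, w.2.1, hu2] at h3
    rw [← h3, hw']
  obtain ⟨a, b, hab⟩ := h.exists_mul_mul x e hx0
  obtain ⟨a', ha'⟩ : ∃ a', a' = e * a * e := ⟨_, rfl⟩
  obtain ⟨b', hb'⟩ : ∃ b', b' = e * b * e := ⟨_, rfl⟩
  have ha1 : e * a' = a' := by rw [ha', ← mul_assoc, ← mul_assoc, he]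
  have ha2 : a' * e = a' := by rw [ha', mul_assoc, he]
  have hb1 : e * b' = b' := by rw [hb', ← mul_assoc, ← mul_assoc, he]
  have hb2 : b' * e = b' := by rw [hb', mul_assoc, he]
  have hab' : a' * x * b' = e := by
    calc a' * x * b' = e * (a * (e * x * e) * b) * e := by rw [ha', hb']; simp only [mul_assoc]
      _ = e := by rw [hex, hxe, hab, he, he]
  have h1 : x * b' * a' = e := key a' (x * b') ha1 ha2 (by rw [← mul_assoc, hex])
    (by rw [mul_assoc, hb2]) (by rw [← mul_assoc, hab'])
  have h2 : b' * (a' * x) = e := key (a' * x) b' (by rw [← mul_assoc, ha1])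
    (by rw [mul_assoc, hxe]) hb1 hb2 hab'
  exact ⟨b' * a', by rw [← mul_assoc, hb1], by rw [mul_assoc, ha2], by rw [← mul_assoc, h1],
    by rw [mul_assoc, h2]⟩

lemma IsFactorBasis.eq_of_dependent (h : IsFactorBasis κ ε) {r s r' s' : F} (hr : r ≠ 0)
    (hs : s ≠ 0) (h1 : r ≠ r') (h2 : r ≠ s') (h3 : s ≠ r') (h4 : s ≠ s') {m n : ℤ}
    (hmn : m ≠ 0 ∨ n ≠ 0) (hrel : m • (κ r - κ r') + n • (κ s - κ s') = 0) : r = s := by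
  by_contra hrs
  rw [← Int.cast_smul_eq_zsmul ℚ, ← Int.cast_smul_eq_zsmul ℚ] at hrel
  rcases hmn with hm | hn
  · have hm' : (m : ℚ) ≠ 0 := by exact_mod_cast hm
    apply h.notMem_span (f := r) (T := {s, r', s'}) hr (by simp [hrs, h1, h2])
    have hmem : ∀ y ∈ ({s, r', s'} : Set F), κ y ∈ Submodule.span ℚ (κ '' {s, r', s'}) :=
      fun y hy => Submodule.subset_span ⟨y, hy, rfl⟩
    have e : κ r = κ r' - (m : ℚ)⁻¹ • (n : ℚ) • (κ s - κ s') := by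
      have : (m : ℚ)⁻¹ • ((m : ℚ) • (κ r - κ r') + (n : ℚ) • (κ s - κ s')) = 0 := by
        rw [hrel, smul_zero]
      rw [smul_add, smul_smul, inv_mul_cancel₀ hm', one_smul] at this
      rw [eq_sub_iff_add_eq, ← sub_eq_zero, ← this]
      abel
    rw [e]
    exact Submodule.sub_mem _ (hmem _ (by simp)) (Submodule.smul_mem _ _ (Submodule.smul_mem _ _
      (Submodule.sub_mem _ (hmem _ (by simp)) (hmem _ (by simp)))))
  · have hn' : (n : ℚ) ≠ 0 := by exact_mod_cast hn
    apply h.notMem_span (f := s) (T := {r, r', s'}) hs (by simp [Ne.symm hrs, h3, h4])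
    have hmem : ∀ y ∈ ({r, r', s'} : Set F), κ y ∈ Submodule.span ℚ (κ '' {r, r', s'}) :=
      fun y hy => Submodule.subset_span ⟨y, hy, rfl⟩
    have e : κ s = κ s' - (n : ℚ)⁻¹ • (m : ℚ) • (κ r - κ r') := by
      have : (n : ℚ)⁻¹ • ((m : ℚ) • (κ r - κ r') + (n : ℚ) • (κ s - κ s')) = 0 := by
        rw [hrel, smul_zero]
      rw [smul_add, smul_smul (n : ℚ)⁻¹ (n : ℚ), inv_mul_cancel₀ hn', one_smul] at this
      rw [eq_sub_iff_add_eq, ← sub_eq_zero, ← this]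
      abel
    rw [e]
    exact Submodule.sub_mem _ (hmem _ (by simp)) (Submodule.smul_mem _ _ (Submodule.smul_mem _ _
      (Submodule.sub_mem _ (hmem _ (by simp)) (hmem _ (by simp)))))

/-- There is at most one element of `F e` outside `e F e`. -/
lemma IsFactorBasis.right_unique (h : IsFactorBasis κ ε) (hA : HasRankOneUnits A) {e r s : F}
    (he : e * e = e) (hr : r * e = r) (hs : s * e = s) (hr' : e * r ≠ r) (hs' : e * s ≠ s) :
    r = s := by
  -- An element x - e x with x e = x is killed by e from the left and fixed by e from the right.
  -- Hence all such products vanish and rank one applies.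
  have key : ∀ x y : F, x * e = x → (κ x - κ (e * x)) * (κ y - κ (e * y)) = 0 := by
    intro x y hx
    have h1 : κ e * (κ y - κ (e * y)) = 0 := by
      rw [mul_sub, ← h.map_mul, ← h.map_mul, ← mul_assoc, he, sub_self]
    have h2 : (κ x - κ (e * x)) * κ e = κ x - κ (e * x) := by
      rw [sub_mul, ← h.map_mul, ← h.map_mul, mul_assoc, hx]
    rw [← h2, mul_assoc, h1, mul_zero]
  obtain ⟨m, n, hmn, hrel⟩ := hA.exists_smul_add_smul_eq_zero (key r r hr) (key s s hs)
    (key r s hr) (key s r hs)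
  have hfix : ∀ x y : F, e * y ≠ y → y ≠ e * x := by
    rintro x _ hy rfl
    rw [← mul_assoc, he] at hy
    exact hy rfl
  have hne : ∀ x : F, e * x ≠ x → x ≠ 0 := by
    rintro _ hx rfl
    rw [mul_zero] at hx
    exact hx rfl
  exact h.eq_of_dependent (hne r hr') (hne s hs') (hfix _ _ hr') (hfix _ _ hr') (hfix _ _ hs')
    (hfix _ _ hs') hmn hrel

/-- There is at most one element of `e F` outside `e F e`. -/
lemma IsFactorBasis.left_unique (h : IsFactorBasis κ ε) (hA : HasRankOneUnits A) {e r s : F}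
    (he : e * e = e) (hr : e * r = r) (hs : e * s = s) (hr' : r * e ≠ r) (hs' : s * e ≠ s) :
    r = s := by
  have key : ∀ x y : F, e * y = y → (κ x - κ (x * e)) * (κ y - κ (y * e)) = 0 := by
    intro x y hy
    have h1 : (κ x - κ (x * e)) * κ e = 0 := by
      rw [sub_mul, ← h.map_mul, ← h.map_mul, mul_assoc, he, sub_self]
    have h2 : κ e * (κ y - κ (y * e)) = κ y - κ (y * e) := by
      rw [mul_sub, ← h.map_mul, ← h.map_mul, ← mul_assoc, hy]
    rw [← h2, ← mul_assoc, h1, zero_mul]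
  obtain ⟨m, n, hmn, hrel⟩ := hA.exists_smul_add_smul_eq_zero (key r r hr) (key s s hs)
    (key r s hs) (key s r hr)
  have hfix : ∀ x y : F, y * e ≠ y → y ≠ x * e := by
    rintro x _ hy rfl
    rw [mul_assoc, he] at hy
    exact hy rfl
  have hne : ∀ x : F, x * e ≠ x → x ≠ 0 := by
    rintro _ hx rfl
    rw [zero_mul] at hx
    exact hx rfl
  exact h.eq_of_dependent (hne r hr') (hne s hs') (hfix _ _ hr') (hfix _ _ hr') (hfix _ _ hs')
    (hfix _ _ hs') hmn hrel

lemma IsFactorBasis.eq_mul_of_idempotent (h : IsFactorBasis κ ε) {e : F} (he0 : e ≠ 0)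
    (he : e * e = e) (g : F) : ∃ a b, a * e = a ∧ e * b = b ∧ g = a * b := by
  obtain ⟨a, b, hab⟩ := h.exists_mul_mul e g he0
  refine ⟨a * e, e * b, by rw [mul_assoc, he], by rw [← mul_assoc, he], ?_⟩
  rw [mul_assoc, ← mul_assoc e, he, ← mul_assoc, hab]

lemma IsFactorBasis.eq_mul_left_of_forall (h : IsFactorBasis κ ε) {r r' : F}
    (hr : ∀ f, f * r = f * r') : r = r' := by
  apply h.injective
  have h1 := h.eq_zero_of_left (x := κ r - κ r') fun f => by
    rw [mul_sub, ← h.map_mul, ← h.map_mul, hr, sub_self]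
  rwa [mul_sub, h.left_id, h.left_id, sub_eq_zero] at h1

lemma IsFactorBasis.eq_mul_right_of_forall (h : IsFactorBasis κ ε) {r r' : F}
    (hr : ∀ f, r * f = r' * f) : r = r' := by
  apply h.injective
  have h1 := h.eq_zero_of_right (x := κ r - κ r') fun f => by
    rw [sub_mul, ← h.map_mul, ← h.map_mul, hr, sub_self]
  rwa [sub_mul, h.right_id, h.right_id, sub_eq_zero] at h1

end Factor


/-! ### Classification of the factors -/

section Classification

variable {F A : Type*} [SemigroupWithZero F] [Ring A] [Algebra ℚ A] {κ : F → A} {ε : A}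

/-- Since F = (F e)(e F), the hypothesis makes e a right identity. Then g (e f) = g f for all g, and
such an f is determined by these products because ε lies in the span. -/
lemma IsFactorBasis.identity_of_left (h : IsFactorBasis κ ε) {e : F} (he0 : e ≠ 0)
    (he : e * e = e) (hl : ∀ l, e * l = l → l * e = l) (f : F) : e * f = f ∧ f * e = f := by
  have h1 : ∀ g, g * e = g := by
    intro g
    obtain ⟨a, b, -, hb, rfl⟩ := h.eq_mul_of_idempotent he0 he g
    rw [mul_assoc, hl b hb]
  exact ⟨h.eq_mul_left_of_forall fun g => by rw [← mul_assoc, h1], h1 f⟩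

lemma IsFactorBasis.identity_of_right (h : IsFactorBasis κ ε) {e : F} (he0 : e ≠ 0)
    (he : e * e = e) (hr : ∀ r, r * e = r → e * r = r) (f : F) : e * f = f ∧ f * e = f := by
  have h1 : ∀ g, e * g = g := by
    intro g
    obtain ⟨a, b, ha, -, rfl⟩ := h.eq_mul_of_idempotent he0 he g
    rw [← mul_assoc, hr a ha]
  exact ⟨h1 f, h.eq_mul_right_of_forall fun g => by rw [mul_assoc, h1]⟩

/-- If `e F e ≠ F e` then the maximal subgroup at `e` is trivial. -/
lemma IsFactorBasis.eq_of_exists_right [Finite F] (h : IsFactorBasis κ ε) (hA : HasRankOneUnits A)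
    {e r : F} (he0 : e ≠ 0) (he : e * e = e) (hr : r * e = r) (hr' : e * r ≠ r) {g : F}
    (hg0 : g ≠ 0) (hg : e * g = g) (hg' : g * e = g) : g = e := by
  have hr0 : r ≠ 0 := by rintro rfl; exact hr' (mul_zero e)
  obtain ⟨y, hy1, hy2, hgy, hyg⟩ := h.exists_inverse he hg0 hg hg'
  -- The element r g lies in F e outside e F e, as r does, so uniqueness applies. As e a r has a
  -- left inverse z in e F e, multiplying r g = r by z e a gives g = e.
  have hrg : r * g = r := by
    refine h.right_unique hA he (by rw [mul_assoc, hg']) hr (fun h1 => hr' ?_) hr'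
    have h2 : e * (r * g) * y = r * g * y := by rw [h1]
    rw [mul_assoc, mul_assoc, hgy, hr] at h2
    exact h2
  obtain ⟨a, b, hab⟩ := h.exists_mul_mul r e hr0
  have hx0 : e * a * r ≠ 0 := by
    intro h1
    apply he0
    rw [← he]
    nth_rewrite 2 [← hab]
    rw [← mul_assoc, ← mul_assoc, h1, zero_mul]
  obtain ⟨z, -, -, -, hz⟩ := h.exists_inverse he hx0 (by rw [← mul_assoc, ← mul_assoc, he])
    (by rw [mul_assoc, hr])
  rw [← hg, ← hz]
  simp only [mul_assoc]
  rw [hrg]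

/-- A finite semigroup without proper ideals that is a basis of an algebra with rank one units is
a group with zero or one of two Rees matrix semigroups. -/
theorem IsFactorBasis.classification [Finite F] (h : IsFactorBasis κ ε) (hA : HasRankOneUnits A) :
    (∃ e : F, e ≠ 0 ∧ (∀ f, e * f = f ∧ f * e = f) ∧ ∀ x, x ≠ 0 → ∃ y, x * y = e) ∨
    ((Nonempty (F ≃* ReesMatrix (!![1, 0; 0, 1] : Matrix (Fin 2) (Fin 2) (WithZero Unit))) ∨
      Nonempty (F ≃* ReesMatrix (!![1, 1; 0, 1] : Matrix (Fin 2) (Fin 2) (WithZero Unit)))) ∧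
      ∃ n : A, n ≠ 0 ∧ n * n = 0 ∧ ε * n = n) := by
  obtain ⟨e, he0, he⟩ := h.exists_idempotent
  by_cases hid : ∀ f, e * f = f ∧ f * e = f
  · left
    refine ⟨e, he0, hid, fun x hx => ?_⟩
    obtain ⟨y, -, -, hy, -⟩ := h.exists_inverse he hx (hid x).1 (hid x).2
    exact ⟨y, hy⟩
  right
  obtain ⟨r, hr, hr'⟩ : ∃ r, r * e = r ∧ e * r ≠ r := by
    by_contra! hcon
    exact hid (h.identity_of_right he0 he hcon)
  obtain ⟨l, hl, hl'⟩ : ∃ l, e * l = l ∧ l * e ≠ l := by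
    by_contra! hcon
    exact hid (h.identity_of_left he0 he hcon)
  have htriv : ∀ g, e * g = g → g * e = g → g = 0 ∨ g = e := by
    intro g h1 h2
    by_cases hg0 : g = 0
    · exact Or.inl hg0
    · exact Or.inr (h.eq_of_exists_right hA he0 he hr hr' hg0 h1 h2)
  have hr0 : r ≠ 0 := by rintro rfl; exact hr' (mul_zero e)
  have hl0 : l ≠ 0 := by rintro rfl; exact hl' (zero_mul e)
  have hre : r ≠ e := by rintro rfl; exact hr' he
  have hle : l ≠ e := by rintro rfl; exact hl' he
  -- Now e F e = {0, e}, F e = {0, e, r} and e F = {0, e, l}, so the nonzero elements of F are e, r,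
  -- l and r l.
  have hFe : ∀ a, a * e = a → a ≠ 0 → a = e ∨ a = r := by
    intro a ha ha0
    by_cases h1 : e * a = a
    · exact Or.inl ((htriv a h1 ha).resolve_left ha0)
    · exact Or.inr (h.right_unique hA he ha hr h1 hr')
  have heF : ∀ a, e * a = a → a ≠ 0 → a = e ∨ a = l := by
    intro a ha ha0
    by_cases h1 : a * e = a
    · exact Or.inl ((htriv a ha h1).resolve_left ha0)
    · exact Or.inr (h.left_unique hA he ha hl h1 hl')
  have hfac : ∀ f, f ≠ 0 → ∃ a b, (a = e ∨ a = r) ∧ (b = e ∨ b = l) ∧ f = a * b := by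
    intro f hf
    obtain ⟨a, b, ha, hb, rfl⟩ := h.eq_mul_of_idempotent he0 he f
    refine ⟨a, b, hFe a ha ?_, heF b hb ?_, rfl⟩
    · rintro rfl; exact hf (zero_mul _)
    · rintro rfl; exact hf (mul_zero _)
  obtain ⟨x, hxr⟩ : ∃ x, x * r = e := by
    obtain ⟨a, b, hab⟩ := h.exists_mul_mul r e hr0
    refine ⟨e * a, (htriv (e * a * r) (by rw [← mul_assoc, ← mul_assoc, he])
      (by rw [mul_assoc, hr])).resolve_left fun h1 => he0 ?_⟩
    rw [← he]
    nth_rewrite 2 [← hab]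
    rw [← mul_assoc, ← mul_assoc, h1, zero_mul]
  obtain ⟨y, hye, hly⟩ : ∃ y, y * e = y ∧ l * y = e := by
    obtain ⟨c, d, hcd⟩ := h.exists_mul_mul l e hl0
    refine ⟨d * e, by rw [mul_assoc, he], (htriv (l * (d * e)) (by rw [← mul_assoc, hl])
      (by rw [mul_assoc, mul_assoc, he])).resolve_left fun h1 => he0 ?_⟩
    rw [← he]
    nth_rewrite 1 [← hcd]
    rw [mul_assoc, mul_assoc, h1, mul_zero]
  have hrl : r * l ≠ 0 := by
    intro h1
    apply he0
    rw [← he]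
    nth_rewrite 1 [← hxr]
    rw [← hly, mul_assoc, ← mul_assoc r, h1, zero_mul, mul_zero]
  -- The sandwich matrix with rows e, er and le, lr is nonsingular; otherwise r and e r would have
  -- equal products with everything from the left.
  have hdet : l * r ≠ l * e * r := by
    intro h1
    apply hr'
    refine (h.eq_mul_left_of_forall fun f => ?_).symm
    by_cases hf : f = 0
    · rw [hf, zero_mul, zero_mul]
    obtain ⟨a, b, -, rfl | rfl, rfl⟩ := hfac f hf
    · rw [mul_assoc, mul_assoc, ← mul_assoc b b, he]
    · rw [mul_assoc, mul_assoc, h1, mul_assoc b e r]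
  refine ⟨?_, κ r - κ (e * r), ?_, ?_, ?_⟩
  · obtain ⟨r', hr'0, hr'1⟩ : ∃ r' : Fin 2 → F, r' 0 = e ∧ r' 1 = r := ⟨![e, r], rfl, rfl⟩
    obtain ⟨l', hl'0, hl'1⟩ : ∃ l' : Fin 2 → F, l' 0 = e ∧ l' 1 = l := ⟨![e, l], rfl, rfl⟩
    have hre' : ∀ i, r' i * e = r' i := by
      simp [Fin.forall_fin_two, hr'0, hr'1, he, hr]
    have h0 : ∀ i j, r' i * l' j ≠ 0 := by
      simp [Fin.forall_fin_two, hr'0, hr'1, hl'0, hl'1, he, hr, hl, he0, hr0, hl0, hrl]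
    have hel' : ∀ j, e * l' j = l' j := by
      simp [Fin.forall_fin_two, hl'0, hl'1, he, hl]
    have hinj : ∀ i j i' j', r' i * l' j = r' i' * l' j' → i = i' ∧ j = j' := by
      have hy' : ∀ j, ∃ y, y * e = y ∧ l' j * y = e := by
        simp only [Fin.forall_fin_two, hl'0, hl'1]
        exact ⟨⟨e, he, he⟩, ⟨y, hye, hly⟩⟩
      have hx' : ∀ i, ∃ x, e * x = x ∧ x * r' i = e := by
        simp only [Fin.forall_fin_two, hr'0, hr'1]
        exact ⟨⟨e, he, he⟩, ⟨e * x, by rw [← mul_assoc, he], by rw [mul_assoc, hxr, he]⟩⟩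
      intro i j i' j' heq
      have e1 : r' i = r' i' := by
        obtain ⟨y, hy1, hy2⟩ := hy' j
        have h1 : r' i * l' j * y = r' i' * l' j' * y := by rw [heq]
        rw [mul_assoc, hy2, hre', mul_assoc] at h1
        rcases htriv (l' j' * y) (by rw [← mul_assoc, hel']) (by rw [mul_assoc, hy1]) with h2 | h2
        · rw [h2, mul_zero] at h1
          exact absurd (by rw [h1, zero_mul]) (h0 i j)
        · rwa [h2, hre'] at h1
      have e2 : l' j = l' j' := by
        obtain ⟨x, hx1, hx2⟩ := hx' i
        have h1 : x * (r' i * l' j) = x * (r' i' * l' j') := by rw [heq]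
        rw [← mul_assoc, hx2, hel', ← mul_assoc] at h1
        rcases htriv (x * r' i') (by rw [← mul_assoc, hx1]) (by rw [mul_assoc, hre']) with h2 | h2
        · rw [h2, zero_mul] at h1
          exact absurd (by rw [h1, mul_zero]) (h0 i j)
        · rwa [h2, hel'] at h1
      revert e1 e2
      fin_cases i <;> fin_cases i' <;> fin_cases j <;> fin_cases j' <;>
        simp [hr'0, hr'1, hl'0, hl'1, hre, hle, hre.symm, hle.symm]
    have hsurj : ∀ f, f ≠ 0 → ∃ i j, f = r' i * l' j := by
      intro f hf
      obtain ⟨a, b, ha, hb, rfl⟩ := hfac f hf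
      have ha' : ∃ i, r' i = a := by
        rcases ha with rfl | rfl
        · exact ⟨0, hr'0⟩
        · exact ⟨1, hr'1⟩
      have hb' : ∃ j, l' j = b := by
        rcases hb with rfl | rfl
        · exact ⟨0, hl'0⟩
        · exact ⟨1, hl'1⟩
      obtain ⟨i, rfl⟩ := ha'
      obtain ⟨j, rfl⟩ := hb'
      exact ⟨i, j, rfl⟩
    -- Permuting rows and columns normalises the sandwich matrix. Of the eight zero-one patterns
    -- with upper left entry e, four are singular, one is the identity, and three become the
    -- triangular matrix.
    have key : ∀ (σ τ : Equiv.Perm (Fin 2)) (P : Matrix (Fin 2) (Fin 2) (WithZero Unit)),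
        (∀ j i, (P j i = 0 ∧ l' (τ j) * r' (σ i) = 0) ∨ (P j i ≠ 0 ∧ l' (τ j) * r' (σ i) = e)) →
        Nonempty (F ≃* ReesMatrix P) := by
      intro σ τ P hP
      refine nonempty_mulEquiv_reesMatrix (r := r' ∘ σ) (l := l' ∘ τ) (fun i => hre' _) hP
        (fun i j => h0 _ _) ?_ ?_
      · intro i j i' j' hij
        obtain ⟨h1, h2⟩ := hinj _ _ _ _ hij
        exact ⟨σ.injective h1, τ.injective h2⟩
      · intro f hf
        obtain ⟨i, j, hij⟩ := hsurj f hf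
        exact ⟨σ.symm i, τ.symm j, by simpa using hij⟩
    have her : e * r = 0 ∨ e * r = e := htriv _ (by rw [← mul_assoc, he]) (by rw [mul_assoc, hr])
    have hle' : l * e = 0 ∨ l * e = e := htriv _ (by rw [← mul_assoc, hl]) (by rw [mul_assoc, he])
    have hlr : l * r = 0 ∨ l * r = e := htriv _ (by rw [← mul_assoc, hl]) (by rw [mul_assoc, hr])
    rcases her with her | her <;> rcases hle' with hle' | hle' <;> rcases hlr with hlr | hlr
    · exact absurd (by rw [hlr, hle', zero_mul]) hdet
    · left
      refine key 1 1 _ ?_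
      simp [Fin.forall_fin_two, hr'0, hr'1, hl'0, hl'1, he, her, hle', hlr]
    · exact absurd (by rw [hlr, mul_assoc, her, mul_zero]) hdet
    · right
      refine key (Equiv.swap 0 1) (Equiv.swap 0 1) _ ?_
      simp [Fin.forall_fin_two, hr'0, hr'1, hl'0, hl'1, he, her, hle', hlr]
    · exact absurd (by rw [hlr, hle', zero_mul]) hdet
    · right
      refine key 1 1 _ ?_
      simp [Fin.forall_fin_two, hr'0, hr'1, hl'0, hl'1, he, her, hle', hlr]
    · right
      refine key (Equiv.swap 0 1) 1 _ ?_
      simp [Fin.forall_fin_two, hr'0, hr'1, hl'0, hl'1, he, her, hle', hlr]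
    · exact absurd (by rw [hlr, hle', her]) hdet
  · intro h1
    exact hr' (h.injective (sub_eq_zero.mp h1)).symm
  · have h1 : κ e * (κ r - κ (e * r)) = 0 := by
      rw [mul_sub, ← h.map_mul, ← h.map_mul, ← mul_assoc, he, sub_self]
    have h2 : (κ r - κ (e * r)) * κ e = κ r - κ (e * r) := by
      rw [sub_mul, ← h.map_mul, ← h.map_mul, mul_assoc, hr]
    rw [← h2, mul_assoc, ← mul_assoc (κ e), h1, zero_mul, mul_zero]
  · rw [mul_sub, h.left_id, h.left_id]

end Classification

/-- A semigroup with zero whose nonzero elements are invertible is a group with zero adjoined. -/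
lemma exists_mulEquiv_withZero {F : Type u} [SemigroupWithZero F] {e : F} (he0 : e ≠ 0)
    (he : ∀ f, e * f = f ∧ f * e = f) (hinv : ∀ x, x ≠ 0 → ∃ y, x * y = e) :
    ∃ (G : Type u) (_ : Group G), Nonempty (F ≃* WithZero G) := by
  classical
  let inst : GroupWithZero F :=
    { (inferInstance : SemigroupWithZero F) with
      one := e
      one_mul := fun f => (he f).1
      mul_one := fun f => (he f).2
      exists_pair_ne := ⟨e, 0, he0⟩
      inv := fun x => if hx : x = 0 then 0 else (hinv x hx).choose
      inv_zero := dif_pos rfl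
      mul_inv_cancel := fun x hx => by
        show x * (if hx : x = 0 then 0 else (hinv x hx).choose) = e
        rw [dif_neg hx]
        exact (hinv x hx).choose_spec }
  exact ⟨Fˣ, inferInstance, ⟨(WithZero.withZeroUnitsEquiv (G := F)).symm⟩⟩


/-! ### Rees factors -/

section ReesFactor

variable {T : Type u} [Semigroup T] {I : Set T}

open Classical in
lemma ReesFactor.of_mul_of (s t : T) (hs : s ∉ I) (ht : t ∉ I) :
    (ReesFactor.of s hs : ReesFactor T I) * .of t ht =
      if h : s * t ∈ I then .zero else .of (s * t) h := rfl

lemma ReesFactor.zero_mul' (x : ReesFactor T I) : ReesFactor.zero * x = .zero := rfl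

lemma ReesFactor.mul_zero' (x : ReesFactor T I) : x * ReesFactor.zero = .zero := by
  cases x <;> rfl

/-- The Rees factor by an ideal is a semigroup with zero. -/
noncomputable abbrev ReesFactor.semigroupWithZero (hI : IsSemigroupIdeal I) :
    SemigroupWithZero (ReesFactor T I) :=
  { ReesFactor.instMul T I with
    zero := .zero
    zero_mul := ReesFactor.zero_mul'
    mul_zero := ReesFactor.mul_zero'
    mul_assoc := by
      rintro (_ | ⟨a, ha⟩) y z
      · rfl
      rcases y with _ | ⟨b, hb⟩
      · rfl
      rcases z with _ | ⟨c, hc⟩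
      · rw [ReesFactor.mul_zero', ReesFactor.mul_zero', ReesFactor.mul_zero']
      rw [ReesFactor.of_mul_of, ReesFactor.of_mul_of]
      by_cases h1 : a * b ∈ I
      · rw [dif_pos h1, ReesFactor.zero_mul']
        by_cases h2 : b * c ∈ I
        · rw [dif_pos h2, ReesFactor.mul_zero']
        · rw [dif_neg h2, ReesFactor.of_mul_of, dif_pos]
          rw [← mul_assoc]
          exact (hI c _ h1).2
      · rw [dif_neg h1, ReesFactor.of_mul_of]
        by_cases h2 : b * c ∈ I
        · rw [dif_pos h2, ReesFactor.mul_zero', dif_pos]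
          rw [mul_assoc]
          exact (hI a _ h2).1
        · rw [dif_neg h2, ReesFactor.of_mul_of]
          by_cases h3 : a * (b * c) ∈ I
          · rw [dif_pos h3, dif_pos (by rwa [mul_assoc])]
          · rw [dif_neg h3, dif_neg (by rwa [mul_assoc])]
            simp only [mul_assoc] }

instance ReesFactor.instFinite [Finite T] : Finite (ReesFactor T I) := by
  let f : Option {t : T // t ∉ I} → ReesFactor T I := fun x => match x with
    | none => .zero
    | some t => .of t.1 t.2
  refine Finite.of_surjective f ?_
  rintro (_ | ⟨t, ht⟩)
  · exact ⟨none, rfl⟩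
  · exact ⟨some ⟨t, ht⟩, rfl⟩

end ReesFactor

/-! ### The blocks of a semigroup algebra -/

section Block

variable {S A : Type*} [Semigroup S] [Ring A] [Algebra ℚ A] {β : S → A}

/-- `z` is the central idempotent identity of the span of `I`. -/
structure IsBlockIdentity (β : S → A) (I : Set S) (z : A) : Prop where
  mem : z ∈ Submodule.span ℚ (β '' I)
  mul_eq : ∀ x ∈ Submodule.span ℚ (β '' I), z * x = x
  comm : ∀ a, a * z = z * a

lemma IsSemigroupBasis.exists_isBlockIdentity [IsSemisimpleRing A] (h : IsSemigroupBasis β)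
    {I : Set S} (hI : IsSemigroupIdeal I) : ∃ z, IsBlockIdentity β I z := by
  obtain ⟨z, h1, h2, h3⟩ := h.exists_central_idempotent hI
  exact ⟨z, h1, h2, h3⟩

/-- The image of a Rees factor in the algebra. -/
def factorMap (β : S → A) (I : Subsemigroup S) (J : Set I) (z : A) : ReesFactor I J → A
  | .zero => 0
  | .of t _ => β t * (1 - z)

variable {I : Subsemigroup S} {J : Set S} {zI zJ : A}

omit [Semigroup S] in
lemma IsBlockIdentity.mul_one_sub (hz : IsBlockIdentity β J zJ) {s : S} (hs : s ∈ J) :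
    β s * (1 - zJ) = 0 := by
  rw [mul_sub, mul_one, hz.comm, hz.mul_eq _ (Submodule.subset_span ⟨s, hs, rfl⟩), sub_self]

lemma IsSemigroupBasis.mul_one_sub_mem (hz : IsBlockIdentity β J zJ) {x : A}
    (hx : x ∈ Submodule.span ℚ (β '' (I : Set S))) : x * (1 - zJ) ∈
      Submodule.span ℚ (Set.range (factorMap β I {t : I | (t : S) ∈ J} zJ)) := by
  induction hx using Submodule.span_induction with
  | mem x hx =>
    obtain ⟨s, hs, rfl⟩ := hx
    by_cases hsJ : s ∈ J
    · rw [hz.mul_one_sub hsJ]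
      exact Submodule.zero_mem _
    · exact Submodule.subset_span ⟨.of ⟨s, hs⟩ hsJ, rfl⟩
  | zero => rw [zero_mul]; exact Submodule.zero_mem _
  | add x y _ _ hx hy => rw [add_mul]; exact Submodule.add_mem _ hx hy
  | smul c x _ hx => rw [smul_mul_assoc]; exact Submodule.smul_mem _ _ hx

/-- The ideal J ∪ I t I of I is J or I. If it were J, then t = zI t zI, expanded over I, would lie
in the span of J. So a factor cannot have zero multiplication. -/
lemma IsSemigroupBasis.exists_mul_mul_of_isMaximal (h : IsSemigroupBasis β)
    (hzI : IsBlockIdentity β (I : Set S) zI)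
    (hmax : IsMaximalSemigroupIdeal {t : I | (t : S) ∈ J})
    {t : I} (ht : (t : S) ∉ J) {s : I} (hs : (s : S) ∉ J) : ∃ a b : I, s = a * t * b := by
  have hK : IsSemigroupIdeal ({t : I | (t : S) ∈ J} ∪ {x : I | ∃ a b : I, x = a * t * b}) := by
    rintro x y (hy | ⟨a, b, rfl⟩)
    · exact ⟨Or.inl (hmax.1 x y hy).1, Or.inl (hmax.1 x y hy).2⟩
    · exact ⟨Or.inr ⟨x * a, b, by simp only [mul_assoc]⟩,
        Or.inr ⟨a, b * x, by simp only [mul_assoc]⟩⟩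
  rcases hmax.2.2 _ hK Set.subset_union_left with h1 | h1
  · exfalso
    apply ht
    apply h.mem_of_mem_span (I := J)
    have htI : β t ∈ Submodule.span ℚ (β '' (I : Set S)) := Submodule.subset_span ⟨t, t.2, rfl⟩
    have h2 : β t = zI * β t * zI := by rw [hzI.mul_eq _ htI, hzI.comm, hzI.mul_eq _ htI]
    rw [h2]
    have h3 := Submodule.mul_mem_mul (Submodule.mul_mem_mul hzI.mem
      (Submodule.subset_span (Set.mem_singleton (β t)) : β t ∈ Submodule.span ℚ {β t})) hzI.mem
    rw [Submodule.span_mul_span, Submodule.span_mul_span] at h3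
    refine Submodule.span_mono ?_ h3
    rintro _ ⟨_, ⟨_, ⟨a, ha, rfl⟩, _, rfl, rfl⟩, _, ⟨b, hb, rfl⟩, rfl⟩
    refine ⟨a * t * b, ?_, by rw [h.map_mul, h.map_mul]⟩
    have h4 : (⟨a, ha⟩ * t * ⟨b, hb⟩ : I) ∈ {t : I | (t : S) ∈ J} := by
      rw [← h1]; exact Or.inr ⟨_, _, rfl⟩
    exact h4
  · have h5 : s ∈ {t : I | (t : S) ∈ J} ∪ {x : I | ∃ a b : I, x = a * t * b} := by
      rw [h1]; trivial
    exact h5.resolve_left hs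

/-- Multiplication by 1 - zJ projects onto the block between J and I. Independence survives because
β t (1 - zJ) differs from β t by an element of the span of J. -/
lemma IsSemigroupBasis.isFactorBasis (h : IsSemigroupBasis β)
    (hJ : IsSemigroupIdeal J) (hzI : IsBlockIdentity β (I : Set S) zI)
    (hzJ : IsBlockIdentity β J zJ) (hmax : IsMaximalSemigroupIdeal {t : I | (t : S) ∈ J}) :
    letI := ReesFactor.semigroupWithZero hmax.1
    IsFactorBasis (factorMap β I {t : I | (t : S) ∈ J} zJ) (zI * (1 - zJ)) := by
  let _ := ReesFactor.semigroupWithZero hmax.1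
  have hcomm : ∀ a, a * (1 - zJ) = (1 - zJ) * a := fun a => by
    rw [mul_sub, sub_mul, mul_one, one_mul, hzJ.comm]
  have hidem : (1 - zJ) * (1 - zJ) = 1 - zJ := by
    have := hzJ.mul_eq _ hzJ.mem
    rw [mul_sub, sub_mul, sub_mul, this, one_mul, one_mul, mul_one, sub_self, sub_zero]
  have hin : ∀ t : I, zI * β t = β t := fun t =>
    hzI.mul_eq _ (Submodule.subset_span ⟨t, t.2, rfl⟩)
  have hleft : ∀ f, zI * (1 - zJ) * factorMap β I {t : I | (t : S) ∈ J} zJ f =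
      factorMap β I {t : I | (t : S) ∈ J} zJ f := by
    rintro (_ | ⟨t, ht⟩)
    · exact mul_zero _
    · show zI * (1 - zJ) * (β t * (1 - zJ)) = β t * (1 - zJ)
      rw [hcomm (β t), mul_assoc, ← mul_assoc (1 - zJ), hidem, ← hcomm, ← mul_assoc, hin]
  constructor
  · rfl
  · rintro (_ | ⟨s, hs⟩) g
    · exact (zero_mul _).symm
    rcases g with _ | ⟨t, ht⟩
    · exact (mul_zero _).symm
    show factorMap β I _ zJ (ReesFactor.of s hs * ReesFactor.of t ht) =
      β s * (1 - zJ) * (β t * (1 - zJ))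
    have e : β s * (1 - zJ) * (β t * (1 - zJ)) = β ((s * t : I) : S) * (1 - zJ) := by
      rw [mul_assoc, hcomm (β t), ← mul_assoc (1 - zJ), hidem, ← hcomm, ← mul_assoc,
        ← h.map_mul]
      rfl
    rw [e, ReesFactor.of_mul_of]
    by_cases hst : s * t ∈ {t : I | (t : S) ∈ J}
    · rw [dif_pos hst, hzJ.mul_one_sub hst]
      rfl
    · rw [dif_neg hst]
      rfl
  · rintro (_ | ⟨t, ht⟩) T hf hT hspan
    · exact hf rfl
    obtain ⟨V, hV⟩ : ∃ V : Set S, V = J ∪ {s | ∃ (hs : s ∈ I) (hsJ : s ∉ J),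
        (ReesFactor.of ⟨s, hs⟩ hsJ : ReesFactor I {t : I | (t : S) ∈ J}) ∈ T} := ⟨_, rfl⟩
    have hzV : ∀ s, β s * zJ ∈ Submodule.span ℚ (β '' V) := by
      intro s
      rw [hzJ.comm]
      refine Submodule.span_mono (Set.image_mono ?_) (h.mul_mem_span hJ hzJ.mem (β s))
      rw [hV]
      exact Set.subset_union_left
    have hsub : Submodule.span ℚ (factorMap β I {t : I | (t : S) ∈ J} zJ '' T) ≤
        Submodule.span ℚ (β '' V) := by
      rw [Submodule.span_le]
      rintro _ ⟨_ | ⟨s, hs⟩, hsT, rfl⟩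
      · exact Submodule.zero_mem _
      · show β s * (1 - zJ) ∈ Submodule.span ℚ (β '' V)
        rw [mul_sub, mul_one]
        refine Submodule.sub_mem _ (Submodule.subset_span ⟨s, ?_, rfl⟩) (hzV s)
        rw [hV]
        exact Or.inr ⟨s.2, hs, hsT⟩
    have ht' : β t ∈ Submodule.span ℚ (β '' V) := by
      have e : β t = β t * (1 - zJ) + β t * zJ := by rw [mul_sub, mul_one, sub_add_cancel]
      rw [e]
      exact Submodule.add_mem _ (hsub hspan) (hzV t)
    have ht'' := h.mem_of_mem_span ht'
    rw [hV] at ht''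
    rcases ht'' with h1 | ⟨_, _, h1⟩
    · exact ht h1
    · exact hT h1
  · exact IsSemigroupBasis.mul_one_sub_mem hzJ hzI.mem
  · exact hleft
  · intro f
    conv_rhs => rw [← hleft f]
    rw [← mul_assoc, hzI.comm, mul_assoc, hcomm, ← mul_assoc]
  · rintro (_ | ⟨t, ht⟩) g hf
    · exact absurd rfl hf
    rcases g with _ | ⟨s, hs⟩
    · exact ⟨.zero, .zero, rfl⟩
    obtain ⟨a, b, hab⟩ := h.exists_mul_mul_of_isMaximal hzI hmax ht hs
    have hat : a * t ∉ {t : I | (t : S) ∈ J} := fun hcon => hs (by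
      rw [hab]; exact (hmax.1 b _ hcon).2)
    have ha : a ∉ {t : I | (t : S) ∈ J} := fun hcon => hat (hmax.1 t _ hcon).2
    have hb : b ∉ {t : I | (t : S) ∈ J} := fun hcon => hs (by
      rw [hab]; exact (hmax.1 (a * t) _ hcon).1)
    refine ⟨.of a ha, .of b hb, ?_⟩
    have h1 : a * t * b ∉ {t : I | (t : S) ∈ J} := by rw [← hab]; exact hs
    show ReesFactor.of a ha * ReesFactor.of t ht * ReesFactor.of b hb = ReesFactor.of s hs
    rw [ReesFactor.of_mul_of, dif_neg hat, ReesFactor.of_mul_of, dif_neg h1]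
    subst hab
    rfl
  · obtain ⟨t, ht⟩ := (Set.ne_univ_iff_exists_notMem _).mp hmax.2.1
    exact ⟨.of t ht, fun h => by cases h⟩

/-- A group with zero among the factors spans a copy of the rational group algebra. -/
lemma IsFactorBasis.exists_groupAlgebra {F : Type*} [SemigroupWithZero F] {κ : F → A} {ε : A}
    (h : IsFactorBasis κ ε) {G : Type*} [Group G] (e : F ≃* WithZero G) :
    ∃ ι : MonoidAlgebra ℚ G →ₙ+* A, Function.Injective ι ∧ ι 1 = ε ∧
      ∀ x ∈ Submodule.span ℚ (Set.range κ), ∃ y, ι y = x := by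
  have hz : e.symm 0 = 0 := by
    have h1 : e.symm 0 = e.symm (e 0 * 0) := by rw [mul_zero]
    rw [h1, _root_.map_mul, MulEquiv.symm_apply_apply, zero_mul]
  let b : G →ₙ* A :=
    { toFun := fun g => κ (e.symm (g : WithZero G))
      map_mul' := fun g g' => by rw [WithZero.coe_mul, _root_.map_mul, h.map_mul] }
  have hb : LinearIndependent ℚ b := by
    rw [linearIndependent_iff_notMem_span]
    intro g hg
    have hne : e.symm (g : WithZero G) ≠ 0 := by
      intro h1
      rw [← hz] at h1
      exact WithZero.coe_ne_zero (e.symm.injective h1)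
    refine h.notMem_span (T := (fun g' : G => e.symm (g' : WithZero G)) '' (Set.univ \ {g})) hne ?_ ?_
    · rintro ⟨g', hg', h1⟩
      exact hg'.2 (WithZero.coe_injective (e.symm.injective h1))
    · rw [Set.image_image]
      exact hg
  let ι := MonoidAlgebra.liftMagma ℚ b
  have hι : ∀ x, ι x = Finsupp.linearCombination ℚ b x.coeff := fun x => rfl
  have hsingle : ∀ g : G, ι (MonoidAlgebra.single g 1) = κ (e.symm (g : WithZero G)) := by
    intro g
    rw [hι]
    simp [b]
  have hsurj : ∀ x ∈ Submodule.span ℚ (Set.range κ), ∃ y, ι y = x := by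
    intro x hx
    induction hx using Submodule.span_induction with
    | mem x hx =>
      obtain ⟨f, rfl⟩ := hx
      cases hf : e f with
      | zero =>
        refine ⟨0, ?_⟩
        have : f = 0 := by rw [← e.symm_apply_apply f, hf]; exact hz
        rw [this, h.map_zero, _root_.map_zero]
      | coe g =>
        refine ⟨MonoidAlgebra.single g 1, ?_⟩
        rw [hsingle, ← hf, e.symm_apply_apply]
    | zero => exact ⟨0, _root_.map_zero ι⟩
    | add x y _ _ hx hy =>
      obtain ⟨x', rfl⟩ := hx
      obtain ⟨y', rfl⟩ := hy
      exact ⟨x' + y', map_add ι x' y'⟩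
    | smul c x _ hx =>
      obtain ⟨x', rfl⟩ := hx
      exact ⟨c • x', map_smul ι c x'⟩
  refine ⟨(ι : MonoidAlgebra ℚ G →ₙ+* A), ?_, ?_, hsurj⟩
  · intro x y hxy
    have h1 : Finsupp.linearCombination ℚ b x.coeff = Finsupp.linearCombination ℚ b y.coeff := hxy
    exact MonoidAlgebra.coeff_injective (hb h1)
  · obtain ⟨y, hy⟩ := hsurj ε h.mem_span
    have h1 : ι 1 * ε = ε := by rw [← hy, ← _root_.map_mul, one_mul]
    have h2 : ι 1 * ε = ι 1 := by
      rw [MonoidAlgebra.one_def, hsingle, h.right_id]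
    exact h2.symm.trans h1

end Block

/-- If 1 + x has order k and x² = 0, then k x = 0. -/
lemma HasTorsionUnits.isReduced {A : Type*} [Ring A] [IsAddTorsionFree A]
    (h : HasTorsionUnits A) : IsReduced A := by
  rw [isReduced_iff_pow_one_lt 2 one_lt_two]
  intro x hx
  rw [pow_two] at hx
  obtain ⟨k, hk, hk1⟩ := h (oneAddUnit x hx) (isIntegralUnit_oneAddUnit hx)
  have h1 := oneAddUnit_zpow hx k
  rw [zpow_natCast, hk1, Units.val_one, left_eq_add, natCast_zsmul] at h1
  exact (smul_eq_zero_iff_right hk.ne').mp h1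

/-! ### Semisimple semigroup algebras with rank one units -/

section Forward

variable {S : Type u} [Semigroup S] [Finite S] {A : Type*} [Ring A] [Algebra ℚ A] {β : S → A}

/-- The central idempotents ε i are orthogonal, and some component w of a nilpotent x is nonzero. In
that block a group must have a nonreduced algebra with rank one units; in the others w is an
orthogonal nilpotent and forces torsion. -/
theorem IsSemigroupBasis.exists_series (h : IsSemigroupBasis β) [IsSemisimpleRing A]
    (hA : HasRankOneUnits A) (hnil : ¬ IsReduced A) :
    ∃ (P : PrincipalSeries S) (i₀ : Fin P.length),
      IsExceptionalFactor (P.Factor i₀) ∧ ∀ i, i ≠ i₀ → IsHigmanFactor (P.Factor i) := by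
  have : IsAddTorsionFree A := IsAddTorsionFree.of_module_rat A
  obtain ⟨P⟩ := exists_principalSeries fun I J hI hJI hJ => h.isSemigroupIdeal_of_subset hI hJI hJ
  have hex : ∃ x : A, x * x = 0 ∧ x ≠ 0 := by
    by_contra! hcon
    apply hnil
    rw [isReduced_iff_pow_one_lt 2 one_lt_two]
    intro x hx
    exact hcon x (by rwa [← pow_two])
  obtain ⟨x, hx, hx0⟩ := hex
  choose z hz using fun i => h.exists_isBlockIdentity (P.isIdeal i)
  obtain ⟨ε, hε⟩ : ∃ ε : Fin P.length → A, ∀ i, ε i = z i.castSucc * (1 - z i.succ) := ⟨_, fun _ => rfl⟩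
  have hεc : ∀ i a, a * ε i = ε i * a := by
    intro i a
    have h1 : a * (1 - z i.succ) = (1 - z i.succ) * a := by
      rw [mul_sub, sub_mul, mul_one, one_mul, (hz _).comm]
    rw [hε, ← mul_assoc, (hz _).comm, mul_assoc, h1, ← mul_assoc]
  have hle : ∀ i j : Fin (P.length + 1), i ≤ j → z i * z j = z j := by
    have hanti : Antitone P.term := Fin.antitone_iff_succ_le.mpr P.le
    intro i j hij
    exact (hz i).mul_eq _ (Submodule.span_mono (Set.image_mono (hanti hij)) (hz j).mem)
  have hεε : ∀ i j, i ≠ j → ε i * ε j = 0 := by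
    have key : ∀ i j, i < j → ε i * ε j = 0 := by
      intro i j hij
      have h1 : (1 - z i.succ) * z j.castSucc = 0 := by
        rw [sub_mul, one_mul, hle, sub_self]
        rw [Fin.succ_le_castSucc_iff]
        exact hij
      rw [hε, hε, mul_assoc, ← mul_assoc (1 - z i.succ), h1, zero_mul, mul_zero]
    intro i j hij
    rcases lt_or_gt_of_ne hij with h1 | h1
    · exact key i j h1
    · rw [hεc]
      exact key j i h1
  obtain ⟨i₀, hi₀⟩ : ∃ i, ε i * x ≠ 0 := by
    by_contra! hcon
    -- If all components vanish, z i x = x propagates down the series to the empty ideal, where z i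
    -- = 0.
    have h1 : ∀ i, z i * x = x := by
      intro i
      induction i using Fin.induction with
      | zero =>
        apply (hz 0).mul_eq
        rw [P.term_zero, Subsemigroup.coe_top, Set.image_univ, h.span_eq_top]
        trivial
      | succ i ih =>
        have h2 := hcon i
        rw [hε, mul_sub, mul_one, hle _ _ (Fin.castSucc_le_succ i), sub_mul, ih, sub_eq_zero] at h2
        exact h2.symm
    have h2 := (hz (Fin.last _)).mem
    rw [P.term_last, Subsemigroup.coe_bot, Set.image_empty, Submodule.span_empty,
      Submodule.mem_bot] at h2
    apply hx0
    rw [← h1 (Fin.last _), h2, zero_mul]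
  obtain ⟨w, hw⟩ : ∃ w, w = ε i₀ * x := ⟨_, rfl⟩
  rw [← hw] at hi₀
  have hww : w * w = 0 := by
    rw [hw, mul_assoc, ← mul_assoc x, hεc, mul_assoc, hx, mul_zero, mul_zero]
  have hfactor : ∀ i : Fin P.length, letI := ReesFactor.semigroupWithZero (P.isMaximal i).1
      IsFactorBasis (factorMap β (P.term i.castSucc) {t : P.term i.castSucc | (t : S) ∈ P.term i.succ}
        (z i.succ)) (ε i) := by
    intro i
    rw [hε]
    exact h.isFactorBasis (P.isIdeal i.succ) (hz _) (hz _) (P.isMaximal i)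
  have hw' : w ∈ Submodule.span ℚ (Set.range (factorMap β (P.term i₀.castSucc)
      {t : P.term i₀.castSucc | (t : S) ∈ P.term i₀.succ} (z i₀.succ))) := by
    have e : w = z i₀.castSucc * x * (1 - z i₀.succ) := by
      rw [hw, hε, mul_assoc, mul_assoc, mul_sub, sub_mul, one_mul, mul_one, (hz _).comm]
    rw [e]
    exact IsSemigroupBasis.mul_one_sub_mem (hz _) (h.mul_mem_span (P.isIdeal _) (hz _).mem x)
  refine ⟨P, i₀, ?_, ?_⟩
  · let _ := ReesFactor.semigroupWithZero (P.isMaximal i₀).1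
    rcases (hfactor i₀).classification hA with ⟨e, he0, he, hinv⟩ | ⟨hR, -⟩
    · obtain ⟨G, _, ⟨f⟩⟩ := exists_mulEquiv_withZero he0 he hinv
      have : Finite G := Finite.of_injective (fun g : G => f.symm g) fun a b hab =>
        WithZero.coe_injective (f.symm.injective hab)
      obtain ⟨ι, hι, -, hsurj⟩ := (hfactor i₀).exists_groupAlgebra f
      refine Or.inl ⟨G, _, isExceptionalGroup_of_hasRankOneUnits (hA.of_nonUnital hι) ?_, ⟨f⟩⟩
      intro hred
      obtain ⟨v, rfl⟩ := hsurj w hw'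
      apply hi₀
      rw [hred.eq_zero v ⟨2, hι (by rw [pow_two, _root_.map_mul, hww, map_zero])⟩, map_zero]
    · exact Or.inr hR
  · intro i hi
    have hεw : ε i * w = 0 := by rw [hw, ← mul_assoc, hεε i i₀ hi, zero_mul]
    let _ := ReesFactor.semigroupWithZero (P.isMaximal i).1
    rcases (hfactor i).classification hA with ⟨e, he0, he, hinv⟩ | ⟨-, n, hn0, hnn, hεn⟩
    · obtain ⟨G, _, ⟨f⟩⟩ := exists_mulEquiv_withZero he0 he hinv
      have : Finite G := Finite.of_injective (fun g : G => f.symm g) fun a b hab =>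
        WithZero.coe_injective (f.symm.injective hab)
      obtain ⟨ι, hι, hι1, -⟩ := (hfactor i).exists_groupAlgebra f
      have htor := hA.hasTorsionUnits_of_nonUnital hι hww hi₀ (by rw [hι1, hεw])
        (by rw [hι1, hεc, hεw])
      exact ⟨G, _, isHigmanGroup_of_isReduced htor.isReduced htor, ⟨f⟩⟩
    -- A Rees block other than i₀ has its own nilpotent n, orthogonal to w and independent of it.
    · exfalso
      have hnw : n * w = 0 := by rw [← hεn, ← hεc, mul_assoc, hεw, mul_zero]
      have hwn : w * n = 0 := by rw [← hεn, ← mul_assoc, hεc, hεw, zero_mul]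
      obtain ⟨a, b, hab, hrel⟩ := hA.exists_smul_add_smul_eq_zero hnn hww hnw hwn
      have ha : a = 0 := by
        have h1 : ε i * (a • n + b • w) = 0 := by rw [hrel, mul_zero]
        rw [mul_add, mul_smul_comm, mul_smul_comm, hεn, hεw, smul_zero, add_zero] at h1
        by_contra ha
        exact hn0 ((smul_eq_zero_iff_right ha).mp h1)
      rw [ha, zero_smul, zero_add] at hrel
      have hb : b ≠ 0 := by tauto
      exact hi₀ ((smul_eq_zero_iff_right hb).mp hrel)

end Forward


/-! ### Algebras with a chain of ideals whose quotients are unital -/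

section BlockModel

variable {A : Type*} [Ring A] [Algebra ℚ A]

/-- The quotient `V / W` of ideals is identified with the algebra `B`. -/
structure IsBlockModel {B : Type*} [Ring B] [Algebra ℚ B] (V W : Ideal A) (φ : A →ₗ[ℚ] B)
    (σ : B →ₗ[ℚ] A) : Prop where
  apply_section : ∀ b, φ (σ b) = b
  section_mem : ∀ b, σ b ∈ V
  sub_mem : ∀ v ∈ V, v - σ (φ v) ∈ W
  apply_eq_zero : ∀ v ∈ W, φ v = 0
  map_mul : ∀ u ∈ V, ∀ v ∈ V, φ (u * v) = φ u * φ v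

variable {B : Type*} [Ring B] [Algebra ℚ B] {V W : Ideal A} {φ : A →ₗ[ℚ] B} {σ : B →ₗ[ℚ] A}

lemma IsBlockModel.mem_of_apply_eq (h : IsBlockModel V W φ σ) {u v : A} (hu : u ∈ V) (hv : v ∈ V)
    (huv : φ u = φ v) : u - v ∈ W := by
  have h1 := h.sub_mem (u - v) (V.sub_mem hu hv)
  rwa [map_sub, huv, sub_self, map_zero, sub_zero] at h1

/-- The homomorphism given by the action on the quotient. -/
def IsBlockModel.ringHom (h : IsBlockModel V W φ σ) (hV : ∀ x ∈ V, ∀ a : A, x * a ∈ V) : A →+* B where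
  toFun a := φ (a * σ 1)
  map_zero' := by rw [zero_mul, map_zero]
  map_one' := by rw [one_mul, h.apply_section]
  map_add' a b := by rw [add_mul, map_add]
  map_mul' a b := by
    have ha := V.mul_mem_left a (h.section_mem 1)
    have hb := V.mul_mem_left b (h.section_mem 1)
    rw [← h.map_mul _ ha _ hb, ← sub_eq_zero, ← map_sub]
    apply h.apply_eq_zero
    have h1 : b * σ 1 - σ 1 * (b * σ 1) ∈ W := by
      refine h.mem_of_apply_eq hb (hV _ (h.section_mem 1) _) ?_
      rw [h.map_mul _ (h.section_mem 1) _ hb, h.apply_section, one_mul]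
    have h2 := W.mul_mem_left a h1
    rwa [mul_sub, ← mul_assoc, ← mul_assoc] at h2

/-- If z is the identity of W and σ 1 lifts the identity of V / W, then z + σ 1 (1 - z) is the
identity of V. Climbing the series this way needs no semisimplicity. -/
lemma IsBlockModel.exists_identity (h : IsBlockModel V W φ σ) (hV : ∀ x ∈ V, ∀ a : A, x * a ∈ V)
    (hW : ∀ x ∈ W, ∀ a : A, x * a ∈ W) (hWV : W ≤ V) {z : A} (hz : z ∈ W)
    (hzW : ∀ w ∈ W, z * w = w ∧ w * z = w) : ∃ z' ∈ V, ∀ v ∈ V, z' * v = v ∧ v * z' = v := by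
  have hzc : ∀ a, a * z = z * a := fun a => by
    rw [← (hzW (a * z) (W.mul_mem_left a hz)).1, ← mul_assoc, (hzW _ (hW z hz a)).2]
  have hx := h.section_mem 1
  refine ⟨z + σ 1 * (1 - z), V.add_mem (hWV hz) (hV _ hx _), fun v hv => ⟨?_, ?_⟩⟩
  · have h1 : σ 1 * v - v ∈ W := by
      refine h.mem_of_apply_eq (hV _ hx v) hv ?_
      rw [h.map_mul _ hx _ hv, h.apply_section, one_mul]
    have h2 : (σ 1 * v - v) * (1 - z) = 0 := by rw [mul_sub, mul_one, (hzW _ h1).2, sub_self]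
    have h3 : (1 - z) * v = v * (1 - z) := by rw [sub_mul, mul_sub, one_mul, mul_one, hzc]
    rw [sub_mul, sub_eq_zero] at h2
    rw [add_mul, mul_assoc, h3, ← mul_assoc, h2, mul_sub, mul_one, hzc]
    abel
  · have h1 : v * σ 1 - v ∈ W := by
      refine h.mem_of_apply_eq (hV _ hv _) hv ?_
      rw [h.map_mul _ hv _ hx, h.apply_section, mul_one]
    have h2 : (v * σ 1 - v) * (1 - z) = 0 := by rw [mul_sub, mul_one, (hzW _ h1).2, sub_self]
    rw [sub_mul, sub_eq_zero] at h2
    rw [mul_add, ← mul_assoc, h2, mul_sub, mul_one]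
    abel

/-- An algebra with a chain of ideals whose quotients are unital is their product. -/
theorem nonempty_ringEquiv_pi_of_isBlockModel {n : ℕ} {B : Fin n → Type*} [∀ i, Ring (B i)]
    [∀ i, Algebra ℚ (B i)] {V : Fin (n + 1) → Ideal A} (hV : ∀ i, ∀ x ∈ V i, ∀ a : A, x * a ∈ V i)
    (h0 : V 0 = ⊤) (hlast : V (Fin.last n) = ⊥) (hle : ∀ i : Fin n, V i.succ ≤ V i.castSucc)
    {φ : ∀ i, A →ₗ[ℚ] B i} {σ : ∀ i, B i →ₗ[ℚ] A}
    (h : ∀ i : Fin n, IsBlockModel (V i.castSucc) (V i.succ) (φ i) (σ i)) :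
    Nonempty (A ≃+* ∀ i, B i) := by
  have hanti : Antitone V := Fin.antitone_iff_succ_le.mpr hle
  have hz : ∀ i, ∃ z ∈ V i, ∀ v ∈ V i, z * v = v ∧ v * z = v := by
    intro i
    induction i using Fin.reverseInduction with
    | last =>
      refine ⟨0, (V _).zero_mem, fun v hv => ?_⟩
      rw [hlast, Ideal.mem_bot] at hv
      rw [hv, mul_zero]
      exact ⟨rfl, rfl⟩
    | cast i ih =>
      obtain ⟨z, hz, hzW⟩ := ih
      exact (h i).exists_identity (hV _) (hV _) (hle i) hz hzW
  choose z hzmem hzid using hz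
  let Φ : A →+* ∀ i, B i := RingHom.pi fun i => (h i).ringHom (hV i.castSucc)
  have hΦ : ∀ a i, Φ a i = φ i (a * σ i 1) := fun _ _ => rfl
  have hinj : Function.Injective Φ := by
    rw [injective_iff_map_eq_zero]
    intro a ha
    -- If a acts as zero on every quotient, then a = a z i for all i down to the zero ideal.
    have key : ∀ i, a * z i = a := by
      intro i
      induction i using Fin.induction with
      | zero => exact (hzid 0 a (by rw [h0]; trivial)).2
      | succ i ih =>
        have hx := (h i).section_mem 1
        have h1 : φ i (a * σ i 1) = 0 := by rw [← hΦ, ha]; rfl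
        have h2 : a * σ i 1 ∈ V i.succ := by
          have := (h i).mem_of_apply_eq ((V _).mul_mem_left a hx) (V _).zero_mem
            (h1.trans (map_zero _).symm)
          rwa [sub_zero] at this
        have h3 : φ i (z i.castSucc) = φ i (σ i 1) := by
          have h4 := (h i).map_mul _ hx _ (hzmem i.castSucc)
          rw [(hzid _ _ hx).2, (h i).apply_section, one_mul] at h4
          rw [← h4, (h i).apply_section]
        have h5 := (V i.succ).add_mem
          ((V i.succ).mul_mem_left a ((h i).mem_of_apply_eq (hzmem _) hx h3)) h2
        rw [mul_sub, sub_add_cancel, ih] at h5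
        exact (hzid _ a h5).2
    have h6 := hzmem (Fin.last n)
    rw [hlast, Ideal.mem_bot] at h6
    rw [← key (Fin.last n), h6, mul_zero]
  have hsurj : Function.Surjective Φ := by
    have hsingle : ∀ i (b : B i), ∃ a, Φ a = Pi.single i b := by
      intro i b
      have hv := (h i).section_mem b
      -- The lift vanishes in the earlier quotients since it lies deeper, and the factor 1 - z
      -- i.succ kills the later ones.
      refine ⟨σ i b * (1 - z i.succ), ?_⟩
      ext j
      rw [hΦ]
      rcases lt_trichotomy j i with hij | rfl | hij
      · rw [Pi.single_eq_of_ne hij.ne]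
        apply (h j).apply_eq_zero
        exact hV _ _ (hV _ _ (hanti (Fin.succ_le_castSucc_iff.mpr hij) hv) _) _
      · rw [Pi.single_eq_same]
        have hx := (h j).section_mem 1
        have h1 : φ j (σ j b * z j.succ * σ j 1) = 0 :=
          (h j).apply_eq_zero _ (hV _ _ ((V _).mul_mem_left _ (hzmem _)) _)
        rw [mul_sub, mul_one, sub_mul, map_sub, h1, sub_zero, (h j).map_mul _ hv _ hx,
          (h j).apply_section, (h j).apply_section, mul_one]
      · rw [Pi.single_eq_of_ne hij.ne']
        have hx := hanti (Fin.succ_le_castSucc_iff.mpr hij) ((h j).section_mem 1)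
        have h1 : (1 - z i.succ) * σ j 1 = 0 := by
          rw [sub_mul, one_mul, (hzid _ _ hx).1, sub_self]
        rw [mul_assoc, h1, mul_zero, map_zero]
    intro b
    choose a ha using fun i => hsingle i (b i)
    refine ⟨∑ i, a i, ?_⟩
    rw [map_sum]
    simp only [ha]
    exact Finset.univ_sum_single b
  exact ⟨RingEquiv.ofBijective Φ ⟨hinj, hsurj⟩⟩

end BlockModel

/-! ### Semigroups with zero that are bases of algebras -/

section FactorModel

/-- The elements of `F` other than its zero `z` form a basis of the algebra `B`. -/
def HasFactorModel {F : Type u} [Mul F] (z : F) (B : Type u) [Ring B] [Algebra ℚ B] : Prop :=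
  ∃ (ι : Type u) (b : Module.Basis ι ℚ B) (ν : ι → F) (θ : F → B), θ z = 0 ∧
    (∀ f g, θ (f * g) = θ f * θ g) ∧ (∀ k, θ (ν k) = b k) ∧ ∀ f, f = z ∨ ∃ k, f = ν k

lemma map_absorbing {F F' : Type*} [Mul F] [Mul F'] (e : F ≃* F') {z : F} {z' : F'}
    (hz : ∀ x, z * x = z) (hz' : ∀ x, x * z' = z') : e z = z' := by
  have h1 : e z * z' = e z := by
    obtain ⟨x, hx⟩ := e.surjective z'
    rw [← hx, ← map_mul, hz]
  rw [← h1, hz']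

lemma HasFactorModel.of_mulEquiv {F F' : Type u} [Mul F] [Mul F'] {z : F} {z' : F'} {B : Type u}
    [Ring B] [Algebra ℚ B] (h : HasFactorModel z' B) (e : F ≃* F') (he : e z = z') :
    HasFactorModel z B := by
  obtain ⟨ι, b, ν, θ, h0, hmul, hν, hsurj⟩ := h
  refine ⟨ι, b, fun k => e.symm (ν k), fun f => θ (e f), ?_, fun f g => ?_, fun k => ?_, fun f => ?_⟩
  · show θ (e z) = 0
    rw [he, h0]
  · show θ (e (f * g)) = θ (e f) * θ (e g)
    rw [map_mul, hmul]
  · show θ (e (e.symm (ν k))) = b k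
    rw [e.apply_symm_apply, hν]
  · rcases hsurj (e f) with h1 | ⟨k, hk⟩
    · left
      rw [← he] at h1
      exact e.injective h1
    · right
      refine ⟨k, ?_⟩
      show f = e.symm (ν k)
      rw [← hk, e.symm_apply_apply]

lemma hasFactorModel_withZero (G : Type u) [Group G] :
    HasFactorModel (0 : WithZero G) (MonoidAlgebra ℚ G) := by
  refine ⟨G, MonoidAlgebra.basis G ℚ, fun g => g,
    fun f => WithZero.recZeroCoe 0 (fun g => MonoidAlgebra.single g 1) f, rfl, ?_, ?_, ?_⟩
  · intro f g
    cases f with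
    | zero => rw [zero_mul]; exact (zero_mul _).symm
    | coe f =>
      cases g with
      | zero => rw [mul_zero]; exact (mul_zero _).symm
      | coe g =>
        rw [← WithZero.coe_mul]
        show MonoidAlgebra.single (f * g) (1 : ℚ) = .single f 1 * .single g 1
        rw [MonoidAlgebra.single_mul_single, mul_one]
  · intro g
    show MonoidAlgebra.single g (1 : ℚ) = _
    simp
  · intro f
    cases f with
    | zero => exact Or.inl rfl
    | coe g => exact Or.inr ⟨g, rfl⟩

-- The map M ↦ M Q turns the sandwich product into the ordinary one, (M Q)(N Q) = (M Q N) Q, and it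
-- is bijective because Q is invertible. The `ULift` only adjusts the universe.
open Matrix in
lemma hasFactorModel_reesMatrix {F : Type u} [Mul F] {z : F} (hz : ∀ x, z * x = z)
    {P : Matrix (Fin 2) (Fin 2) (WithZero Unit)} (e : F ≃* ReesMatrix P)
    {Q Q' : Matrix (Fin 2) (Fin 2) ℚ} (hQ : Q * Q' = 1) (hQ' : Q' * Q = 1)
    (hPQ : ∀ i j, (P i j = 0 ∧ Q i j = 0) ∨ (P i j ≠ 0 ∧ Q i j = 1)) :
    HasFactorModel z (ULift.{u} (Matrix (Fin 2) (Fin 2) ℚ)) := by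
  have hez : e z = .zero := map_absorbing e hz fun x => by cases x <;> rfl
  let R : Matrix (Fin 2) (Fin 2) ℚ ≃ₗ[ℚ] ULift.{u} (Matrix (Fin 2) (Fin 2) ℚ) :=
    { toFun := fun M => ⟨M * Q⟩
      invFun := fun M => M.down * Q'
      map_add' := fun M N => by rw [add_mul]; rfl
      map_smul' := fun c M => by rw [smul_mul_assoc]; rfl
      left_inv := fun M => by
        show M * Q * Q' = M
        rw [mul_assoc, hQ, mul_one]
      right_inv := fun M => by
        apply ULift.ext
        show M.down * Q' * Q = M.down
        rw [mul_assoc, hQ', mul_one] }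
  let θ : ReesMatrix P → ULift.{u} (Matrix (Fin 2) (Fin 2) ℚ) := fun x => match x with
    | .zero => 0
    | .entry i _ j => R (single i j 1)
  refine ⟨ULift (Fin 2 × Fin 2), ((Matrix.stdBasis ℚ (Fin 2) (Fin 2)).map R).reindex Equiv.ulift.symm,
    fun k => e.symm (.entry k.down.1 () k.down.2), fun f => θ (e f), ?_, ?_, ?_, ?_⟩
  · show θ (e z) = 0
    rw [hez]
  · intro f g
    show θ (e (f * g)) = θ (e f) * θ (e g)
    rw [map_mul]
    rcases e f with _ | ⟨i, a, j⟩
    · exact (zero_mul (θ (e g))).symm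
    rcases e g with _ | ⟨k, b, l⟩
    · exact (mul_zero (θ (.entry i a j))).symm
    have e1 : θ (ReesMatrix.entry i a j) * θ (ReesMatrix.entry k b l) =
        Q j k • R (single i l 1) := by
      apply ULift.ext
      show single i j 1 * Q * (single k l 1 * Q) = Q j k • (single i l 1 * Q)
      rw [← mul_assoc, Matrix.single_mul_mul_single, ← smul_mul_assoc, Matrix.smul_single]
      simp
    rw [e1, ReesMatrix.entry_mul_entry]
    rcases hPQ j k with ⟨h1, h2⟩ | ⟨h1, h2⟩
    · rw [dif_pos h1, h2, zero_smul]
    · rw [dif_neg h1, h2, one_smul]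
  · intro k
    show θ (e (e.symm (.entry k.down.1 () k.down.2))) = _
    rw [e.apply_symm_apply, Module.Basis.reindex_apply, Module.Basis.map_apply]
    show R (single _ _ 1) = R (Matrix.stdBasis ℚ (Fin 2) (Fin 2) (k.down.1, k.down.2))
    rw [Matrix.stdBasis_eq_single]
  · intro f
    cases hf : e f with
    | zero => exact Or.inl (e.injective (hf.trans hez.symm))
    | entry i a j => exact Or.inr ⟨⟨(i, j)⟩, by rw [← e.symm_apply_apply f, hf]⟩

end FactorModel

/-! ### From models of Rees factors to quotients of ideals -/

section BlockOfFactor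

variable {S : Type u} [Semigroup S] {A : Type*} [Ring A] [Algebra ℚ A] {β : S → A}

/-- A model of a Rees factor of `S` is a model of the corresponding quotient of ideals. -/
lemma IsSemigroupBasis.exists_isBlockModel (h : IsSemigroupBasis β) {I : Subsemigroup S} {J : Set S}
    (hI : IsSemigroupIdeal (I : Set S)) (hJ : IsSemigroupIdeal J) {B : Type u} [Ring B]
    [Algebra ℚ B] (hB : HasFactorModel (ReesFactor.zero : ReesFactor I {t : I | (t : S) ∈ J}) B) :
    ∃ (φ : A →ₗ[ℚ] B) (σ : B →ₗ[ℚ] A), IsBlockModel (h.ideal hI) (h.ideal hJ) φ σ := by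
  classical
  obtain ⟨ι, b, ν, θ, h0, hmul, hν, hsurj⟩ := hB
  let bA : Module.Basis S ℚ A := Module.Basis.mk h.linearIndependent h.span_eq_top.ge
  have hbA : ∀ s, bA s = β s := fun s => Module.Basis.mk_apply _ _ s
  let cls : I → ReesFactor I {t : I | (t : S) ∈ J} := fun s =>
    if hs : s ∈ {t : I | (t : S) ∈ J} then .zero else .of s hs
  have hcls0 : ∀ s : I, (s : S) ∈ J → cls s = .zero := fun s hs => dif_pos hs
  have hcls1 : ∀ (s : I) (hs : (s : S) ∉ J), cls s = .of s hs := fun s hs => dif_neg hs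
  have hclsmul : ∀ s t : I, cls (s * t) = cls s * cls t := by
    intro s t
    by_cases hs : (s : S) ∈ J
    · rw [hcls0 s hs, hcls0 (s * t) (hJ t s hs).2]
      rfl
    by_cases ht : (t : S) ∈ J
    · rw [hcls0 t ht, hcls0 (s * t) (hJ s t ht).1, ReesFactor.mul_zero']
    rw [hcls1 s hs, hcls1 t ht, ReesFactor.of_mul_of]
  have hrep : ∀ k, ∃ s : I, ∃ hs : (s : S) ∉ J, ν k = .of s hs := by
    intro k
    cases hk : ν k with
    | zero =>
      have := hν k
      rw [hk, h0] at this
      exact absurd this.symm (b.ne_zero k)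
    | of s hs => exact ⟨s, hs, rfl⟩
  choose rep hrepJ hrepν using hrep
  -- The value 0 off I is a default; φ only has to be multiplicative on the span of I.
  let φ : A →ₗ[ℚ] B := bA.constr ℚ fun s => if hs : s ∈ I then θ (cls ⟨s, hs⟩) else 0
  let σ : B →ₗ[ℚ] A := b.constr ℚ fun k => β (rep k)
  have hφ : ∀ s : I, φ (β s) = θ (cls s) := by
    intro s
    rw [← hbA]
    show bA.constr ℚ _ (bA s) = _
    rw [Module.Basis.constr_basis, dif_pos s.2]
  have hσ : ∀ k, σ (b k) = β (rep k) := fun k => by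
    show b.constr ℚ _ (b k) = _
    rw [Module.Basis.constr_basis]
  have hφσ : ∀ k, φ (β (rep k)) = b k := fun k => by
    rw [hφ, hcls1 _ (hrepJ k), ← hrepν, hν]
  refine ⟨φ, σ, ?_, ?_, ?_, ?_, ?_⟩
  · intro x
    have : φ ∘ₗ σ = LinearMap.id := b.ext fun k => by
      rw [LinearMap.comp_apply, hσ, hφσ, LinearMap.id_apply]
    exact LinearMap.congr_fun this x
  · intro x
    rw [h.mem_ideal]
    have hx := b.mem_span x
    induction hx using Submodule.span_induction with
    | mem x hx =>
      obtain ⟨k, rfl⟩ := hx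
      rw [hσ]
      exact Submodule.subset_span ⟨rep k, (rep k).2, rfl⟩
    | zero => rw [map_zero]; exact Submodule.zero_mem _
    | add x y _ _ hx hy => rw [map_add]; exact Submodule.add_mem _ hx hy
    | smul c x _ hx => rw [map_smul]; exact Submodule.smul_mem _ _ hx
  · intro v hv
    rw [h.mem_ideal] at hv ⊢
    induction hv using Submodule.span_induction with
    | mem x hx =>
      obtain ⟨s, hs, rfl⟩ := hx
      rw [hφ ⟨s, hs⟩]
      by_cases hsJ : s ∈ J
      · rw [hcls0 _ hsJ, h0, map_zero, sub_zero]
        exact Submodule.subset_span ⟨s, hsJ, rfl⟩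
      · rw [hcls1 _ hsJ]
        rcases hsurj (.of ⟨s, hs⟩ hsJ) with h1 | ⟨k, hk⟩
        · cases h1
        · have h2 : rep k = ⟨s, hs⟩ := by
            have h3 := (hrepν k).symm.trans hk.symm
            injection h3
          rw [hk, hν, hσ, h2, sub_self]
          exact Submodule.zero_mem _
    | zero => rw [map_zero, map_zero, sub_zero]; exact Submodule.zero_mem _
    | add x y _ _ hx hy =>
      rw [map_add, map_add, add_sub_add_comm]
      exact Submodule.add_mem _ hx hy
    | smul c x _ hx =>
      rw [map_smul, map_smul, ← smul_sub]
      exact Submodule.smul_mem _ _ hx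
  · intro v hv
    rw [h.mem_ideal] at hv
    induction hv using Submodule.span_induction with
    | mem x hx =>
      obtain ⟨s, hs, rfl⟩ := hx
      by_cases hsI : s ∈ I
      · rw [hφ ⟨s, hsI⟩, hcls0 _ hs, h0]
      · rw [← hbA]
        show bA.constr ℚ _ (bA s) = _
        rw [Module.Basis.constr_basis, dif_neg hsI]
    | zero => exact map_zero _
    | add x y _ _ hx hy => rw [map_add, hx, hy, add_zero]
    | smul c x _ hx => rw [map_smul, hx, smul_zero]
  · intro x hx y hy
    rw [h.mem_ideal] at hx hy
    induction hx using Submodule.span_induction with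
    | mem x hx =>
      obtain ⟨s, hs, rfl⟩ := hx
      induction hy using Submodule.span_induction with
      | mem y hy =>
        obtain ⟨t, ht, rfl⟩ := hy
        rw [hφ ⟨s, hs⟩, hφ ⟨t, ht⟩, ← hmul, ← hclsmul, ← hφ, ← h.map_mul]
        rfl
      | zero => rw [mul_zero, map_zero, mul_zero]
      | add y z _ _ hy hz => rw [mul_add, map_add, map_add, hy, hz, mul_add]
      | smul c y _ hy => rw [mul_smul_comm, map_smul, map_smul, hy, mul_smul_comm]
    | zero => rw [zero_mul, map_zero, zero_mul]
    | add x z _ _ hx hz => rw [add_mul, map_add, map_add, hx, hz, add_mul]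
    | smul c x _ hx => rw [smul_mul_assoc, map_smul, map_smul, hx, smul_mul_assoc]

end BlockOfFactor


/-! ### Semigroup algebras with a series of Higman factors and one exceptional factor -/

section Backward

lemma HasRankOneUnits.ulift {B : Type*} [Ring B] (h : HasRankOneUnits B) :
    HasRankOneUnits (ULift.{u} B) :=
  hasRankOneUnits_of_injective' (f := (ULift.ringEquiv (R := B)).toRingHom)
    ULift.ringEquiv.injective h

lemma IsHigmanFactor.exists_model {F : Type u} [Mul F] {z : F} (hz : ∀ x, z * x = z)
    (h : IsHigmanFactor F) : ∃ (B : Type u) (_ : Ring B) (_ : Algebra ℚ B), HasFactorModel z B ∧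
      IsSemisimpleRing B ∧ HasTorsionUnits B := by
  obtain ⟨G, _, hG, ⟨e⟩⟩ := h
  have := hG.1
  exact ⟨MonoidAlgebra ℚ G, inferInstance, inferInstance,
    (hasFactorModel_withZero G).of_mulEquiv e (map_absorbing e hz mul_zero), inferInstance,
    hG.hasTorsionUnits⟩

lemma IsExceptionalFactor.exists_model {F : Type u} [Mul F] {z : F} (hz : ∀ x, z * x = z)
    (h : IsExceptionalFactor F) : ∃ (B : Type u) (_ : Ring B) (_ : Algebra ℚ B),
      HasFactorModel z B ∧ IsSemisimpleRing B ∧ HasRankOneUnits B := by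
  rcases h with ⟨G, _, hG, ⟨e⟩⟩ | ⟨⟨e⟩⟩ | ⟨⟨e⟩⟩
  · have := hG.finite
    exact ⟨MonoidAlgebra ℚ G, inferInstance, inferInstance,
      (hasFactorModel_withZero G).of_mulEquiv e (map_absorbing e hz mul_zero), inferInstance,
      hG.hasRankOneUnits⟩
  · refine ⟨ULift.{u} (Matrix (Fin 2) (Fin 2) ℚ), inferInstance, inferInstance,
      hasFactorModel_reesMatrix hz e (Q := 1) (Q' := 1) (one_mul 1) (one_mul 1) ?_,
      ULift.ringEquiv.symm.isSemisimpleRing, hasRankOneUnits_matrix.ulift⟩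
    simp [Fin.forall_fin_two]
  · refine ⟨ULift.{u} (Matrix (Fin 2) (Fin 2) ℚ), inferInstance, inferInstance,
      hasFactorModel_reesMatrix hz e (Q := !![1, 1; 0, 1]) (Q' := !![1, -1; 0, 1])
        (by simp [Matrix.one_fin_two]) (by simp [Matrix.one_fin_two]) ?_,
      ULift.ringEquiv.symm.isSemisimpleRing, hasRankOneUnits_matrix.ulift⟩
    simp [Fin.forall_fin_two]

theorem IsSemigroupBasis.isSemisimpleRing_and_hasRankOneUnits {S : Type u} [Semigroup S]
    {A : Type*} [Ring A] [Algebra ℚ A] {β : S → A} (h : IsSemigroupBasis β)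
    (P : PrincipalSeries S) (i₀ : Fin P.length) (h₀ : IsExceptionalFactor (P.Factor i₀))
    (hP : ∀ i, i ≠ i₀ → IsHigmanFactor (P.Factor i)) :
    IsSemisimpleRing A ∧ HasRankOneUnits A := by
  have hmodel : ∀ i : Fin P.length, ∃ (B : Type u) (_ : Ring B) (_ : Algebra ℚ B),
      HasFactorModel (ReesFactor.zero : P.Factor i) B ∧ IsSemisimpleRing B ∧
        (i = i₀ → HasRankOneUnits B) ∧ (i ≠ i₀ → HasTorsionUnits B) := by
    intro i
    by_cases hi : i = i₀
    · subst hi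
      obtain ⟨B, _, _, h1, h2, h3⟩ := h₀.exists_model (z := .zero) ReesFactor.zero_mul'
      exact ⟨B, _, _, h1, h2, fun _ => h3, fun hi => absurd rfl hi⟩
    · obtain ⟨B, _, _, h1, h2, h3⟩ := (hP i hi).exists_model (z := .zero) ReesFactor.zero_mul'
      exact ⟨B, _, _, h1, h2, fun hi' => absurd hi' hi, fun _ => h3⟩
  choose B hring halg hB hss hrank htor using hmodel
  choose φ σ hφσ using fun i => h.exists_isBlockModel (P.isIdeal i.castSucc) (P.isIdeal i.succ) (hB i)
  obtain ⟨e⟩ := nonempty_ringEquiv_pi_of_isBlockModel (V := fun i => h.ideal (P.isIdeal i))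
    (fun i x hx a => h.mul_mem_span (P.isIdeal i) hx a)
    (by
      rw [eq_top_iff]
      intro x _
      rw [h.mem_ideal, P.term_zero, Subsemigroup.coe_top, Set.image_univ, h.span_eq_top]
      trivial)
    (by
      rw [eq_bot_iff]
      intro x hx
      rw [h.mem_ideal, P.term_last, Subsemigroup.coe_bot, Set.image_empty, Submodule.span_empty,
        Submodule.mem_bot] at hx
      rw [hx]
      exact Ideal.zero_mem _)
    (fun i x hx => Submodule.span_mono (Set.image_mono (P.le i)) hx) hφσ
  refine ⟨e.symm.isSemisimpleRing, ?_⟩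
  refine hasRankOneUnits_of_injective ((Pi.evalRingHom B i₀).comp e.toRingHom)
    (fun i : {i // i ≠ i₀} => (Pi.evalRingHom B i.1).comp e.toRingHom) (hrank i₀ rfl)
    (fun i => htor i.1 i.2) ?_
  intro x hx hx'
  apply e.injective
  rw [map_zero]
  ext i
  by_cases hi : i = i₀
  · subst hi; exact hx
  · exact hx' ⟨i, hi⟩

end Backward

/-! ### Decomposition into groups -/

section DisjointUnion

variable {S : Type u} [Semigroup S]

lemma ReesFactor.of_ne_zero {T : Type u} {I : Set T} {t : T} (ht : t ∉ I) :
    (ReesFactor.of t ht : ReesFactor T I) ≠ .zero := fun h => by cases h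

/-- A group with zero has no zero divisors, so the layer between two terms is closed under
multiplication. -/
lemma PrincipalSeries.exists_mulEquiv (P : PrincipalSeries S) (i : Fin P.length) {G : Type u}
    [Group G] (e : P.Factor i ≃* WithZero G) : ∃ T : Subsemigroup S,
      (T : Set S) = (P.term i.castSucc : Set S) \ P.term i.succ ∧ Nonempty (T ≃* G) := by
  have he0 : e .zero = 0 := map_absorbing e ReesFactor.zero_mul' mul_zero
  have hne : ∀ x : P.Factor i, x ≠ .zero → e x ≠ 0 := fun x hx h =>
    hx (e.injective (h.trans he0.symm))
  have hmul : ∀ (s t : P.term i.castSucc) (hs : (s : S) ∉ P.term i.succ)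
      (ht : (t : S) ∉ P.term i.succ), ∃ hst : ((s * t : P.term i.castSucc) : S) ∉ P.term i.succ,
        (ReesFactor.of (s * t) hst : P.Factor i) = .of s hs * .of t ht := by
    intro s t hs ht
    have h1 : e (.of s hs * .of t ht) ≠ 0 := by
      rw [map_mul]
      exact mul_ne_zero (hne _ fun h => by cases h) (hne _ fun h => by cases h)
    have h2 : ¬ ((s * t : P.term i.castSucc) : S) ∈ P.term i.succ := by
      intro h3
      apply h1
      exact (congrArg e ((ReesFactor.of_mul_of _ _ _ _).trans (dif_pos h3))).trans he0
    exact ⟨h2, ((ReesFactor.of_mul_of (T := P.term i.castSucc) s t hs ht).trans (dif_neg h2)).symm⟩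
  let T : Subsemigroup S :=
    { carrier := (P.term i.castSucc : Set S) \ P.term i.succ
      mul_mem' := by
        rintro s t ⟨hs, hs'⟩ ⟨ht, ht'⟩
        exact ⟨(P.term i.castSucc).mul_mem hs ht, (hmul ⟨s, hs⟩ ⟨t, ht⟩ hs' ht').1⟩ }
  let f : T →ₙ* G :=
    { toFun := fun s => WithZero.unzero (hne (.of ⟨s, s.2.1⟩ s.2.2) (ReesFactor.of_ne_zero _))
      map_mul' := by
        intro s t
        apply WithZero.coe_injective
        rw [WithZero.coe_mul, WithZero.coe_unzero, WithZero.coe_unzero, WithZero.coe_unzero,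
          ← map_mul]
        obtain ⟨h1, h2⟩ := hmul ⟨s, s.2.1⟩ ⟨t, t.2.1⟩ s.2.2 t.2.2
        rw [← h2]
        rfl }
  have hf : ∀ s : T, (f s : WithZero G) = e (.of ⟨s, s.2.1⟩ s.2.2) := fun s =>
    WithZero.coe_unzero _
  refine ⟨T, rfl, ⟨MulEquiv.ofBijective f ⟨?_, ?_⟩⟩⟩
  · intro s t hst
    have h1 : e (.of ⟨s, s.2.1⟩ s.2.2) = e (.of ⟨t, t.2.1⟩ t.2.2) := by rw [← hf, ← hf, hst]
    have h2 := e.injective h1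
    injection h2 with h3
    exact Subtype.ext (congrArg (fun x : P.term i.castSucc => (x : S)) h3)
  · intro g
    obtain ⟨x, hx⟩ := e.surjective (g : WithZero G)
    rcases x with _ | ⟨s, hs⟩
    · rw [he0] at hx
      exact absurd hx.symm WithZero.coe_ne_zero
    · refine ⟨⟨s, s.2, hs⟩, WithZero.coe_injective ?_⟩
      rw [hf]
      exact hx

theorem PrincipalSeries.isDisjointUnion (P : PrincipalSeries S) (i₀ : Fin P.length) {K : Type u}
    [Group K] (hK : Nonempty (P.Factor i₀ ≃* WithZero K))
    (hP : ∀ i, i ≠ i₀ → IsHigmanFactor (P.Factor i)) : IsDisjointUnionOfHigmanGroupsAnd S K := by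
  have hT : ∀ i : Fin P.length, ∃ T : Subsemigroup S,
      (T : Set S) = (P.term i.castSucc : Set S) \ P.term i.succ ∧ (i = i₀ → Nonempty (T ≃* K)) ∧
      (i ≠ i₀ → ∃ (G : Type u) (_ : Group G), IsHigmanGroup G ∧ Nonempty (T ≃* G)) := by
    intro i
    by_cases hi : i = i₀
    · subst hi
      obtain ⟨e⟩ := hK
      obtain ⟨T, hT, hT'⟩ := P.exists_mulEquiv i e
      exact ⟨T, hT, fun _ => hT', fun hi => absurd rfl hi⟩
    · obtain ⟨G, _, hG, ⟨e⟩⟩ := hP i hi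
      obtain ⟨T, hT, hT'⟩ := P.exists_mulEquiv i e
      exact ⟨T, hT, fun hi' => absurd hi' hi, fun _ => ⟨G, _, hG, hT'⟩⟩
  choose T hT hT0 hT1 using hT
  have hanti : Antitone P.term := Fin.antitone_iff_succ_le.mpr P.le
  have hdisj : ∀ i j, i < j → Disjoint (T i : Set S) (T j : Set S) := by
    intro i j hij
    rw [hT, hT, Set.disjoint_left]
    intro s hs hs'
    exact hs.2 (hanti (Fin.succ_le_castSucc_iff.mpr hij) hs'.1)
  refine ⟨Fin P.length, T, i₀, fun i j hij => ?_, fun s => ?_, hT0 i₀ rfl, hT1⟩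
  · rcases lt_or_gt_of_ne hij with h | h
    · exact hdisj i j h
    · exact (hdisj j i h).symm
  · by_contra! hcon
    have key : ∀ i, s ∈ P.term i := by
      intro i
      induction i using Fin.induction with
      | zero => rw [P.term_zero]; trivial
      | succ i ih =>
        by_contra h1
        apply hcon i
        rw [← SetLike.mem_coe, hT]
        exact ⟨ih, h1⟩
    have h2 := key (Fin.last _)
    rw [P.term_last] at h2
    exact Subsemigroup.notMem_bot h2

end DisjointUnion

/-! ### The main theorem -/

/-- The semigroup is a basis of its semigroup algebra. -/
lemma RatSemigroupAlgebra.isSemigroupBasis {S : Type u} [Semigroup S]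
    (h : IsUnitarySemigroupAlgebra S) :
    IsSemigroupBasis (A := RatSemigroupAlgebra S h)
      fun s => (MonoidAlgebra.single s 1 : MonoidAlgebra ℚ S) where
  map_mul s t := by
    have : (MonoidAlgebra.single (s * t) 1 : MonoidAlgebra ℚ S) = .single s 1 * .single t 1 := by
      rw [MonoidAlgebra.single_mul_single, mul_one]
    exact this
  linearIndependent := by
    have := (MonoidAlgebra.basis S ℚ).linearIndependent
    have e : (fun s => (MonoidAlgebra.single s 1 : MonoidAlgebra ℚ S)) = MonoidAlgebra.basis S ℚ := by
      ext s; simp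
    rw [← e] at this
    exact this
  span_eq_top := by
    have := (MonoidAlgebra.basis S ℚ).span_eq
    have e : (fun s => (MonoidAlgebra.single s 1 : MonoidAlgebra ℚ S)) = MonoidAlgebra.basis S ℚ := by
      ext s; simp
    rw [← e] at this
    exact this

theorem theorem4p4 {S : Type u} [Semigroup S] [Finite S]
    (hunit : IsUnitarySemigroupAlgebra S)
    (hnil : ∃ x : RatSemigroupAlgebra S hunit, x ≠ 0 ∧ IsNilpotent x) :
    ((IsSemisimpleRing (RatSemigroupAlgebra S hunit) ∧
        HasHyperbolicProperty (RatSemigroupAlgebra S hunit)) ↔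
      ∃ (P : PrincipalSeries S) (i₀ : Fin P.length),
        IsExceptionalFactor (P.Factor i₀) ∧ ∀ i, i ≠ i₀ → IsHigmanFactor (P.Factor i)) ∧
    (∀ (P : PrincipalSeries S) (i₀ : Fin P.length) (K : Type u) [Group K],
      IsExceptionalGroup K → Nonempty (P.Factor i₀ ≃* WithZero K) →
      (∀ i, i ≠ i₀ → IsHigmanFactor (P.Factor i)) →
      IsDisjointUnionOfHigmanGroupsAnd S K) := by
  have hβ := RatSemigroupAlgebra.isSemigroupBasis hunit
  refine ⟨⟨?_, ?_⟩, fun P i₀ K _ _ hK hP => P.isDisjointUnion i₀ hK hP⟩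
  · rintro ⟨hss, hhyp⟩
    -- Without an order the hyperbolic property would hold vacuously.
    obtain ⟨Γ, hΓ⟩ := hβ.exists_isZOrder
    refine hβ.exists_series (hhyp.hasRankOneUnits hΓ) fun hred => ?_
    obtain ⟨x, hx0, hx⟩ := hnil
    exact hx0 (hred.eq_zero x hx)
  · rintro ⟨P, i₀, h₀, hP⟩
    obtain ⟨hss, hrank⟩ := hβ.isSemisimpleRing_and_hasRankOneUnits P i₀ h₀ hP
    exact ⟨hss, hrank.hasHyperbolicProperty⟩
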